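/- **Setting.** For every sample size $T\ge 1$ let $n=n_T$ and let, for $1\le i\le n$, $1\le t\le T$, $$x_{it}=\chi_{it}+\epsilon_{it}=\boldsymbol\lambda_i^\top\mathbf f_t+\epsilon_{it},\qquad \mathbf f_t=(f_{1t},\dots,f_{rt})^\top,\quad E(\mathbf f_t)=0,\ E(\epsilon_{it})=0,$$ where $r$ is fixed, the loadings $\boldsymbol\lambda_i\in\mathbb R^r$ are non-random and form the rows of the $n\times r$ matrix $\Lambda$; all quantities may depend on $T$. There are change-points $0=\eta^\chi_0<\eta^\chi_1<\dots<\eta^\chi_{B_\chi+1}=T$ and $0=\eta^\epsilon_0<\dots<\eta^\epsilon_{B_\epsilon+1}=T$; put $\beta(t)=\max\{0\le b\le B_\chi:\eta^\chi_b+1\le t\}$ and $\gamma(t)=\max\{0\le b\le B_\epsilon:\eta^\epsilon_b+1\le t\}$. Assume, with constants that do not depend on $T$ (or on $i,j,t$): 1. There are zero-mean weakly stationary processes $(\mathbf f^b_t)_{t\in\mathbb Z}$, $0\le b\le B_\chi$, and a $\rho_f\in[0,1)$ with $\max_{j}E(f_{jt}-f^{\beta(t)}_{jt})^2=O(\rho_f^{\,t-\eta^\chi_{\beta(t)}})$,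 and a $\bar\tau_\chi<\infty$ such that for each $1\le b\le B_\chi$ the matrices $\Lambda E\{\mathbf f^b_{t+\tau}(\mathbf f^b_t)^\top\}\Lambda^\top$ and $\Lambda E\{\mathbf f^{b-1}_{t+\tau}(\mathbf f^{b-1}_t)^\top\}\Lambda^\top$ differ for some $|\tau|\le\bar\tau_\chi$. Likewise there are zero-mean weakly stationary processes $(\boldsymbol\epsilon^b_t)_{t\in\mathbb Z}$, $0\le b\le B_\epsilon$, and a $\rho_\epsilon\in[0,1)$ with $\max_i E(\epsilon_{it}-\epsilon^{\gamma(t)}_{it})^2=O(\rho_\epsilon^{\,t-\eta^\epsilon_{\gamma(t)}})$, and a $\bar\tau_\epsilon<\infty$ such that for each $1\le b\le B_\epsilon$ the matrices $E\{\boldsymbol\epsilon^b_{t+\tau}(\boldsymbol\epsilon^b_t)^\top\}$ and $E\{\boldsymbol\epsilon^{b-1}_{t+\tau}(\boldsymbol\epsilon^{b-1}_t)^\top\}$ differ for some $|\tau|\le\bar\tau_\epsilon$. 2. $T^{-1}\sum_{t=1}^T E(\mathbf f_t\mathbf f_t^\top)=I_r$, and for some $c_f,\beta_f\in(0,\infty)$,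 $P(|f_{jt}|>z)\le\exp\{1-(z/c_f)^{\beta_f}\}$ for all $z>0$ and all $j,t$. 3. $n^{-1}\Lambda^\top\Lambda\to H$ for a positive definite $r\times r$ matrix $H$ with distinct eigenvalues, and $|\lambda_{ij}|<\bar\lambda$ for all $i,j$, for some $\bar\lambda\in(0,\infty)$. 4. For some $C_\epsilon\in(0,\infty)$, $\frac1{e-s+1}\sum_{i,i'=1}^n\sum_{t,t'=s}^e a_ia_{i'}E(\epsilon_{it}\epsilon_{i't'})<C_\epsilon$ for all $1\le s\le e\le T$ and all $(a_i)$ with $\sum_i a_i^2=1$; the $\epsilon_{it}$ are jointly normally distributed. 5. $\{\mathbf f_t\}_{1\le t\le T}$ and $\{\boldsymbol\epsilon_t\}_{1\le t\le T}$ are independent. With $\mathcal F_s^e$ the $\sigma$-algebra generated by $\{(\mathbf f_t,\boldsymbol\epsilon_t):s\le t\le e\}$ and $\alpha(k)=\max_{1\le t\le T}\sup\{|P(A)P(B)-P(A\cap B)|:A\in\mathcal F_1^t,\,B\in\mathcal F_{t+k}^T\}$, there are $c_\alpha,\beta\in(0,\infty)$ with $3\beta_f^{-1}+\beta^{-1}>1$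 and $\alpha(k)\le\exp(-c_\alpha k^\beta)$ for all integers $k\ge1$. 6. For some $c_\eta\in(0,1)$, $\eta^\chi_{b+1}-\eta^\chi_b\ge c_\eta T$ for $0\le b\le B_\chi$ and $\eta^\epsilon_{b+1}-\eta^\epsilon_b\ge c_\eta T$ for $0\le b\le B_\epsilon$. 7. $n\to\infty$ as $T\to\infty$, and $n=O(T^\kappa)$ for some $\kappa\in(0,\infty)$. **Estimator.** Let $\widehat{\mathbf w}_{x,1},\dots,\widehat{\mathbf w}_{x,n}$ be any orthonormal eigenvectors of $\widehat\Gamma_x=T^{-1}\sum_{t=1}^T\mathbf x_t\mathbf x_t^\top$, with $\widehat{\mathbf w}_{x,j}=(\widehat w_{x,1j},\dots,\widehat w_{x,nj})^\top$ belonging to the $j$-th largest eigenvalue. For $c_w>0$ let $\widetilde w_{x,ij}=\widehat w_{x,ij}$ if $|\widehat w_{x,ij}|\le c_w/\sqrt n$ and $\widetilde w_{x,ij}=\mathrm{sign}(\widehat w_{x,ij})\,c_w/\sqrt n$ otherwise. With $\widetilde{\mathbf w}_{x,j}=(\widetilde w_{x,1j},\dots,\widetilde w_{x,nj})^\top$,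 the capped PCA estimator is $\widehat\chi^k_{it}=\sum_{j=1}^k\widetilde w_{x,ij}\widetilde{\mathbf w}_{x,j}^\top\mathbf x_t$. **Theorem.** There is a fixed $\theta\ge1+(\beta_f^{-1}\vee 1/2)$, depending only on $\beta_f$ and $\beta$, such that the following holds as $T\to\infty$. (i) When $k=r$, for every fixed $c_w$ that is sufficiently large (larger than a constant depending only on $r$, $H$ and $\bar\lambda$), $$\max_{1\le i\le n}\max_{1\le s<e\le T}\frac1{\sqrt{e-s+1}}\Big|\sum_{t=s}^e(\widehat\chi^r_{it}-\chi_{it})\Big|=O_p\Big\{\Big(\sqrt{\tfrac{\log n}{T}}\vee\tfrac1{\sqrt n}\Big)\log^\theta T\Big\}.$$ (ii) For every fixed $k>r$ and every fixed $c_w>0$, $$\max_{1\le i\le n}\max_{1\le s<e\le T}\frac1{\sqrt{e-s+1}}\Big|\sum_{t=s}^e(\widehat\chi^k_{it}-\chi_{it})\Big|=O_p(\log^\theta T).$$ -/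

import Mathlib

open MeasureTheory ProbabilityTheory Filter Topology
open scoped Matrix

noncomputable section

namespace PSFactor

/-- `X_T = O_p(a_T)` as `T → ∞`, for a sequence of probability spaces `(Ω T, P T)`: for every
`δ > 0` there is an `M > 0` with `P_T(|X_T| > M a_T) ≤ δ` for all large `T`. -/
def IsBigOp {Ω : ℕ → Type*} [∀ T, MeasurableSpace (Ω T)] (P : ∀ T, Measure (Ω T))
    (X : ∀ T, Ω T → ℝ) (a : ℕ → ℝ) : Prop :=
  ∀ δ : ℝ, 0 < δ → ∃ M : ℝ, 0 < M ∧
    ∀ᶠ T in atTop, P T {ω | M * a T < |X T ω|} ≤ ENNReal.ofReal δ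

/-- A family of real processes, jointly weakly stationary, indexed by `t ∈ ℤ`: square integrable,
with constant means and second moments depending on the lag only. -/
structure WeaklyStationary {Ω ι : Type*} [MeasurableSpace Ω] (X : ℤ → ι → Ω → ℝ)
    (P : Measure Ω) : Prop where
  memLp : ∀ t i, MemLp (X t i) 2 P
  mean_eq : ∀ t i, ∫ ω, X t i ω ∂P = ∫ ω, X 0 i ω ∂P
  second_moment_eq : ∀ t τ i j,
    ∫ ω, X (t + τ) i ω * X t j ω ∂P = ∫ ω, X τ i ω * X 0 j ω ∂P

/-- The matrix `E{X_{t+τ} X_tᵀ}` of a weakly stationary zero-mean process (taken at `t = 0`). -/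
def autocov {Ω ι : Type*} [MeasurableSpace Ω] (X : ℤ → ι → Ω → ℝ) (P : Measure Ω) (τ : ℤ) :
    Matrix ι ι ℝ :=
  Matrix.of fun i j => ∫ ω, X τ i ω * X 0 j ω ∂P

/-- `w 0, w 1, …` is an orthonormal basis of eigenvectors of `A`, the `j`-th of them belonging to
the `j`-th largest eigenvalue; `w j i` is the `i`-th entry of the `j`-th eigenvector. -/
def IsOrderedEigenbasis {n : ℕ} (A : Matrix (Fin n) (Fin n) ℝ) (w : Fin n → Fin n → ℝ) : Prop :=
  ∃ μ : Fin n → ℝ, Antitone μ ∧ (∀ j, A *ᵥ w j = μ j • w j) ∧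
    ∀ j l, w j ⬝ᵥ w l = if j = l then 1 else 0

/-- Capping at level `c`: `x 𝕀(|x| ≤ c) + sign(x) c 𝕀(|x| > c)`. -/
def cap (c x : ℝ) : ℝ := if |x| ≤ c then x else Real.sign x * c

/-- The index `max {0 ≤ b ≤ B : η_b + 1 ≤ t}` of the last change-point strictly before `t`. -/
def segIndex (η : ℕ → ℕ) (B t : ℕ) : ℕ := Nat.findGreatest (fun b => η b + 1 ≤ t) B

/-- The data of the `r`-factor model with change-points, as a triangular array indexed by the
sample size `T`: the time points of the `T`-th row are `1, …, T`, its cross-section has size `n T`.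
Values at times outside `1, …, T` play no role. -/
structure Model (r : ℕ) (Ω : ℕ → Type*) [∀ T, MeasurableSpace (Ω T)] where
  P : ∀ T, Measure (Ω T)
  isProb : ∀ T, IsProbabilityMeasure (P T)
  /-- cross-sectional dimension -/
  n : ℕ → ℕ
  /-- loadings -/
  Λ : ∀ T, Matrix (Fin (n T)) (Fin r) ℝ
  /-- factors `f_{jt}` -/
  f : ∀ T, ℕ → Fin r → Ω T → ℝ
  /-- idiosyncratic components `ε_{it}` -/
  ε : ∀ T, ℕ → Fin (n T) → Ω T → ℝ
  f_meas : ∀ T, ∀ t ∈ Finset.Icc 1 T, ∀ j, Measurable (f T t j)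
  ε_meas : ∀ T, ∀ t ∈ Finset.Icc 1 T, ∀ i, Measurable (ε T t i)
  f_mean : ∀ T, ∀ t ∈ Finset.Icc 1 T, ∀ j, Integrable (f T t j) (P T) ∧ ∫ ω, f T t j ω ∂P T = 0
  ε_mean : ∀ T, ∀ t ∈ Finset.Icc 1 T, ∀ i, Integrable (ε T t i) (P T) ∧ ∫ ω, ε T t i ω ∂P T = 0
  /-- number of change-points in the common components -/
  Bχ : ℕ → ℕ
  /-- change-points in the common components, with `η_0 = 0` and `η_{B+1} = T` -/
  ηχ : ℕ → ℕ → ℕ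
  ηχ_zero : ∀ T, ηχ T 0 = 0
  ηχ_last : ∀ T, ηχ T (Bχ T + 1) = T
  ηχ_lt : ∀ T, 1 ≤ T → ∀ b ≤ Bχ T, ηχ T b < ηχ T (b + 1)
  /-- number of change-points in the idiosyncratic components -/
  Bε : ℕ → ℕ
  /-- change-points in the idiosyncratic components, with `η_0 = 0` and `η_{B+1} = T` -/
  ηε : ℕ → ℕ → ℕ
  ηε_zero : ∀ T, ηε T 0 = 0
  ηε_last : ∀ T, ηε T (Bε T + 1) = T
  ηε_lt : ∀ T, 1 ≤ T → ∀ b ≤ Bε T, ηε T b < ηε T (b + 1)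

namespace Model

variable {r : ℕ} {Ω : ℕ → Type*} [∀ T, MeasurableSpace (Ω T)] (M : Model r Ω)

/-- Common components `χ_{it} = λ_iᵀ f_t`. -/
def χ (T t : ℕ) (i : Fin (M.n T)) (ω : Ω T) : ℝ := ∑ j, M.Λ T i j * M.f T t j ω

/-- Observations `x_{it} = χ_{it} + ε_{it}`. -/
def x (T t : ℕ) (i : Fin (M.n T)) (ω : Ω T) : ℝ := M.χ T t i ω + M.ε T t i ω

/-- Sample covariance matrix `T⁻¹ ∑_t x_t x_tᵀ` of the (zero-mean) observations. -/
def sampleCov (T : ℕ) (ω : Ω T) : Matrix (Fin (M.n T)) (Fin (M.n T)) ℝ :=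
  Matrix.of fun i l => (T : ℝ)⁻¹ * ∑ t ∈ Finset.Icc 1 T, M.x T t i ω * M.x T t l ω

/-- Approximate piecewise stationarity of the factors, and genuineness of the change-points in the
common components. -/
def PiecewiseStationaryCommon : Prop :=
  ∃ fb : ∀ T, ℕ → ℤ → Fin r → Ω T → ℝ,
    (∀ T, 1 ≤ T → ∀ b ≤ M.Bχ T, WeaklyStationary (fb T b) (M.P T) ∧
      ∀ t j, ∫ ω, fb T b t j ω ∂M.P T = 0) ∧
    (∃ ρ : ℝ, 0 ≤ ρ ∧ ρ < 1 ∧ ∃ C : ℝ, ∀ T, ∀ t ∈ Finset.Icc 1 T, ∀ j,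
      ∫ ω, (M.f T t j ω - fb T (segIndex (M.ηχ T) (M.Bχ T) t) t j ω) ^ 2 ∂M.P T
        ≤ C * ρ ^ (t - M.ηχ T (segIndex (M.ηχ T) (M.Bχ T) t))) ∧
    ∃ τmax : ℕ, ∀ T, 1 ≤ T → ∀ b, 1 ≤ b → b ≤ M.Bχ T → ∃ τ : ℤ, |τ| ≤ τmax ∧
      M.Λ T * autocov (fb T b) (M.P T) τ * (M.Λ T)ᵀ
        - M.Λ T * autocov (fb T (b - 1)) (M.P T) τ * (M.Λ T)ᵀ ≠ 0

/-- Approximate piecewise stationarity of the idiosyncratic components, and genuineness of their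
change-points. -/
def PiecewiseStationaryIdio : Prop :=
  ∃ εb : ∀ T, ℕ → ℤ → Fin (M.n T) → Ω T → ℝ,
    (∀ T, 1 ≤ T → ∀ b ≤ M.Bε T, WeaklyStationary (εb T b) (M.P T) ∧
      ∀ t i, ∫ ω, εb T b t i ω ∂M.P T = 0) ∧
    (∃ ρ : ℝ, 0 ≤ ρ ∧ ρ < 1 ∧ ∃ C : ℝ, ∀ T, ∀ t ∈ Finset.Icc 1 T, ∀ i,
      ∫ ω, (M.ε T t i ω - εb T (segIndex (M.ηε T) (M.Bε T) t) t i ω) ^ 2 ∂M.P T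
        ≤ C * ρ ^ (t - M.ηε T (segIndex (M.ηε T) (M.Bε T) t))) ∧
    ∃ τmax : ℕ, ∀ T, 1 ≤ T → ∀ b, 1 ≤ b → b ≤ M.Bε T → ∃ τ : ℤ, |τ| ≤ τmax ∧
      autocov (εb T b) (M.P T) τ - autocov (εb T (b - 1)) (M.P T) τ ≠ 0

/-- Normalisation `T⁻¹ ∑_t E(f_t f_tᵀ) = I_r`, and exponential-type tails of the factors with
exponent `βf`. -/
def FactorMoments (βf : ℝ) : Prop :=
  (∀ T : ℕ, 1 ≤ T → ∀ j l, (T : ℝ)⁻¹ * ∑ t ∈ Finset.Icc 1 T, ∫ ω, M.f T t j ω * M.f T t l ω ∂M.P T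
      = (1 : Matrix (Fin r) (Fin r) ℝ) j l) ∧
  ∃ cf : ℝ, 0 < cf ∧ ∀ T : ℕ, ∀ t ∈ Finset.Icc 1 T, ∀ j, ∀ z : ℝ, 0 < z →
    (M.P T).real {ω | z < |M.f T t j ω|} ≤ Real.exp (1 - (z / cf) ^ βf)

/-- `n⁻¹ Λᵀ Λ → H`, where `H` is positive definite with distinct eigenvalues, and the loadings are
bounded by `lbar`. -/
def PervasiveLoadings (H : Matrix (Fin r) (Fin r) ℝ) (lbar : ℝ) : Prop :=
  H.PosDef ∧ (∀ hH : H.IsHermitian, Function.Injective hH.eigenvalues) ∧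
  Tendsto (fun T => (M.n T : ℝ)⁻¹ • ((M.Λ T)ᵀ * M.Λ T)) atTop (𝓝 H) ∧
  ∀ T i j, |M.Λ T i j| < lbar

/-- Weak dependence over the cross-section and over time, and (joint) normality, of the
idiosyncratic components. -/
def WeakIdiosyncrasy : Prop :=
  (∃ C : ℝ, 0 < C ∧ ∀ T s e, 1 ≤ s → s ≤ e → e ≤ T → ∀ a : Fin (M.n T) → ℝ, ∑ i, a i ^ 2 = 1 →
    ((e - s + 1 : ℕ) : ℝ)⁻¹ * ∑ i, ∑ i', ∑ t ∈ Finset.Icc s e, ∑ t' ∈ Finset.Icc s e,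
      a i * a i' * ∫ ω, M.ε T t i ω * M.ε T t' i' ω ∂M.P T < C) ∧
  ∀ T, HasGaussianLaw
    (fun ω (p : Finset.Icc 1 T × Fin (M.n T)) => M.ε T p.1 p.2 ω) (M.P T)

/-- Independence of the factors and the idiosyncratic components. -/
def FactorIdioIndep : Prop :=
  ∀ T, IndepFun
    (fun ω (p : Finset.Icc 1 T × Fin r) => M.f T p.1 p.2 ω)
    (fun ω (p : Finset.Icc 1 T × Fin (M.n T)) => M.ε T p.1 p.2 ω) (M.P T)

/-- The σ-algebra generated by `(f_t, ε_t)`, `s ≤ t ≤ e`. -/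
@[reducible] def sigmaAlg (T s e : ℕ) : MeasurableSpace (Ω T) :=
  ⨆ t ∈ Finset.Icc s e,
    (⨆ j, MeasurableSpace.comap (M.f T t j) inferInstance) ⊔
    (⨆ i, MeasurableSpace.comap (M.ε T t i) inferInstance)

/-- The strong mixing coefficient `α(k)` of the `T`-th row of the array. -/
def alpha (T k : ℕ) : ℝ :=
  sSup {y | ∃ t ∈ Finset.Icc 1 T, ∃ A B : Set (Ω T),
    MeasurableSet[M.sigmaAlg T 1 t] A ∧ MeasurableSet[M.sigmaAlg T (t + k) T] B ∧
    y = |(M.P T).real A * (M.P T).real B - (M.P T).real (A ∩ B)|}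

/-- Strong mixing at the rate `α(k) ≤ exp(-c k^β)`. -/
def StrongMixing (β : ℝ) : Prop :=
  ∃ c : ℝ, 0 < c ∧ ∀ T, 1 ≤ T → ∀ k : ℕ, 1 ≤ k → M.alpha T k ≤ Real.exp (-c * (k : ℝ) ^ β)

/-- Adjacent change-points are at a distance of at least `c T`. -/
def SpacedChangePoints : Prop :=
  ∃ c : ℝ, 0 < c ∧ c < 1 ∧ ∀ T : ℕ,
    (∀ b ≤ M.Bχ T, c * T ≤ (M.ηχ T (b + 1) : ℝ) - M.ηχ T b) ∧
    (∀ b ≤ M.Bε T, c * T ≤ (M.ηε T (b + 1) : ℝ) - M.ηε T b)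

/-- `n → ∞` as `T → ∞`, with `n = O(T^κ)` for some `κ > 0`. -/
def DimensionGrowth : Prop :=
  Tendsto M.n atTop atTop ∧ ∃ κ : ℝ, 0 < κ ∧
    (fun T => (M.n T : ℝ)) =O[atTop] fun T : ℕ => (T : ℝ) ^ κ

/-- `w T ω` is a choice of ordered orthonormal eigenvectors of the sample covariance matrix. -/
def IsPCA (w : ∀ T, Ω T → Fin (M.n T) → Fin (M.n T) → ℝ) : Prop :=
  ∀ T ω, IsOrderedEigenbasis (M.sampleCov T ω) (w T ω)

/-- The capped PCA estimator `∑_{j ≤ k} w̃_{ij} w̃_jᵀ x_t` with `k` factors, where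
`w̃` has the entries of `w` capped at `c_w / √n` in absolute value. -/
def cappedEst (w : ∀ T, Ω T → Fin (M.n T) → Fin (M.n T) → ℝ) (cw : ℝ) (k T t : ℕ)
    (i : Fin (M.n T)) (ω : Ω T) : ℝ :=
  ∑ j with j.val < k, cap (cw / √(M.n T)) (w T ω j i) *
    ∑ l, cap (cw / √(M.n T)) (w T ω j l) * M.x T t l ω

/-- `max_{1 ≤ i ≤ n} max_{1 ≤ s < e ≤ T} (e-s+1)^{-1/2} |∑_{t=s}^e (χ̂^k_{it} - χ_{it})|`
(the maximum of a finite set, nonempty once `n ≥ 1` and `T ≥ 2`). -/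
def maxErr (w : ∀ T, Ω T → Fin (M.n T) → Fin (M.n T) → ℝ) (cw : ℝ) (k T : ℕ) (ω : Ω T) : ℝ :=
  sSup {y | ∃ (i : Fin (M.n T)) (s e : ℕ), 1 ≤ s ∧ s < e ∧ e ≤ T ∧
    y = 1 / √((e - s + 1 : ℕ) : ℝ) *
      |∑ t ∈ Finset.Icc s e, (M.cappedEst w cw k T t i ω - M.χ T t i ω)|}

end Model

end PSFactor

end

-- All randomness is confined to one event, `Model.Controlled`. On it, every normalised partial sum
-- of products of two base processes (the constant one, the factors, the `ε_it`, and the averages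
-- `n^{-1/2} Λᵀ ε_t`) lies within `L = C log^θ₀ T` of its mean. On that event the rest is
-- deterministic linear algebra.
--
-- Probability of the event. From each truncated summand subtract its conditional expectation given
-- the past `q` steps earlier. Within one residue class modulo `q` the differences are bounded
-- martingale differences, so Azuma–Hoeffding applies; the subtracted terms are close to their means
-- in `L¹` by strong mixing. Taking `q` and the truncation level to be powers of `log T` makes the
-- failure probability smaller than a prescribed power of `1/T`
-- (`exists_eventually_measureReal_sum_le`). A union bound over all pairs of processes and all
-- intervals then survives, since `n` is polynomial in `T`.
--
-- Linear algebra (`FactorDecomp`). The sample covariance equals `ΛFΛᵀ + ΛG + GᵀΛᵀ + S + Δ`, where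
-- `F - 1`, `G`, `Δ` have entries at most `τ = L/√T` and `S` is a bounded positive form. Dimension
-- counting puts the first `r` eigenvalues at order `n` and the others below `O(1 + nτ)`. Dividing
-- the eigenvector equation by the eigenvalue writes each leading eigenvector as `Λα` plus a
-- remainder with entries `O((τ + n^{-1/2})/√n)`. Hence its entries are `O(n^{-1/2})`, so a large
-- cap never acts, and it averages out the idiosyncratic part. Moreover the projection onto the
-- leading eigenvectors almost fixes every row of `Λ`. Only the span of these eigenvectors matters,
-- so they are never matched one by one with population counterparts.
--
-- The estimator is linear in the data with weights constant in time, so these bounds apply to the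
-- normalised partial sums and give an error of order `(τ + n^{-1/2}) L`. For `k > r` the cap alone
-- suffices: each of the `k` terms is at most `c_w²` times the largest normalised partial sum of the
-- observations, which is `O(L)`.

universe u

namespace PSFactor

/-! ### Covariance inequalities under strong mixing -/

section Mixing

variable {Ω : Type*} {m m' mΩ : MeasurableSpace Ω} {P : Measure Ω} [IsProbabilityMeasure P]

/-- The `L¹` distance between a conditional expectation and the mean is twice a covariance with
an event of the conditioning σ-algebra. -/
lemma exists_integral_abs_condExp_sub_eq (hm : m ≤ mΩ) {W : Ω → ℝ}
    (hW : Integrable W P) :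
    ∃ A, MeasurableSet[m] A ∧ ∫ ω, |(P[W|m]) ω - ∫ ω', W ω' ∂P| ∂P =
      2 * (∫ ω in A, W ω ∂P - P.real A * ∫ ω, W ω ∂P) := by
  set μ := ∫ ω', W ω' ∂P with hμ
  set Y : Ω → ℝ := fun ω => (P[W|m]) ω - μ with hY
  have hYm : StronglyMeasurable[m] Y := stronglyMeasurable_condExp.sub stronglyMeasurable_const
  have hYi : Integrable Y P := integrable_condExp.sub (integrable_const _)
  -- `Y` has mean zero, so its integral off this event is minus its integral on it; hence the factor
  -- two.
  have hA : MeasurableSet[m] {ω | 0 ≤ Y ω} :=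
    @measurableSet_le _ _ _ _ _ m _ _ _ _ _ measurable_const hYm.measurable
  refine ⟨{ω | 0 ≤ Y ω}, hA, ?_⟩
  set A := {ω | 0 ≤ Y ω}
  have hset : ∫ ω in A, Y ω ∂P = ∫ ω in A, W ω ∂P - P.real A * μ := by
    rw [hY, integral_sub integrable_condExp.integrableOn (integrable_const _).integrableOn,
      setIntegral_condExp hm hW hA]
    simp
  have hzero : ∫ ω, Y ω ∂P = 0 := by
    rw [hY, integral_sub integrable_condExp (integrable_const _), integral_condExp hm]
    simp [hμ]
  have hcompl : ∫ ω in Aᶜ, Y ω ∂P = - ∫ ω in A, Y ω ∂P := by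
    have := integral_add_compl (hm _ hA) hYi
    rw [hzero] at this; linarith
  rw [← integral_add_compl (hm _ hA) hYi.abs,
    setIntegral_congr_fun (g := Y) (hm _ hA) (fun ω hω => abs_of_nonneg hω),
    setIntegral_congr_fun (g := fun ω => - Y ω) (hm _ hA).compl
      (fun ω hω => abs_of_nonpos (le_of_not_ge hω)), integral_neg, hcompl, ← hset]
  ring

/-- Covariance inequality for a bounded variable: `E|E[Z|m] - E Z| ≤ 4 B α`. -/
lemma integral_abs_condExp_sub_le (hm : m ≤ mΩ) (hm' : m' ≤ mΩ)
    {Z : Ω → ℝ} (hZ : Measurable[m'] Z) {B α : ℝ} (hB : ∀ ω, |Z ω| ≤ B)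
    (hα : ∀ A A', MeasurableSet[m] A → MeasurableSet[m'] A' →
      |P.real A * P.real A' - P.real (A ∩ A')| ≤ α) :
    ∫ ω, |(P[Z|m]) ω - ∫ ω', Z ω' ∂P| ∂P ≤ 4 * B * α := by
  have hZm : Measurable Z := hZ.mono hm' le_rfl
  have hZi : Integrable Z P := Integrable.of_bound hZm.aestronglyMeasurable B (ae_of_all _ hB)
  have hB0 : 0 ≤ B := by
    obtain ⟨ω⟩ := nonempty_of_isProbabilityMeasure P
    exact (abs_nonneg _).trans (hB ω)
  obtain ⟨A, hA, hAeq⟩ := exists_integral_abs_condExp_sub_eq (P := P) hm hZi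
  rw [hAeq]
  -- Duality: the covariance of `Z` with the event `A` equals the integral of `Z` against `E[1_A |
  -- m'] - P(A)`. Boundedness of `Z` leaves the `L¹` norm of that difference, which the previous
  -- lemma turns into a covariance of two events. Each use of the lemma contributes a factor two.
  set I : Ω → ℝ := A.indicator 1 with hI
  have hIi : Integrable I P := (integrable_const (1 : ℝ)).indicator (hm _ hA)
  have hIint : ∫ ω, I ω ∂P = P.real A := integral_indicator_one (hm _ hA)
  obtain ⟨A', hA', hAeq'⟩ := exists_integral_abs_condExp_sub_eq (P := P) hm' hIi
  have h1 : ∫ ω in A, Z ω ∂P - P.real A * ∫ ω, Z ω ∂P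
      = ∫ ω, Z ω * ((P[I|m']) ω - ∫ ω', I ω' ∂P) ∂P := by
    have hZI : Integrable (fun ω => Z ω * I ω) P := hIi.bdd_mul hZm.aestronglyMeasurable
      (ae_of_all _ hB)
    have h2 : ∫ ω, Z ω * (P[I|m']) ω ∂P = ∫ ω, Z ω * I ω ∂P := by
      have := condExp_mul_of_stronglyMeasurable_left (μ := P) (m := m') (f := Z) (g := I)
        hZ.stronglyMeasurable hZI hIi
      rw [← integral_condExp (μ := P) hm' (f := fun ω => Z ω * I ω)]
      exact (integral_congr_ae this).symm
    have h3 : ∫ ω, Z ω * I ω ∂P = ∫ ω in A, Z ω ∂P := by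
      rw [← integral_indicator (hm _ hA)]
      congr 1; ext ω; by_cases h : ω ∈ A <;> simp [hI, h]
    simp only [mul_sub]
    rw [integral_sub (integrable_condExp.bdd_mul hZm.aestronglyMeasurable (ae_of_all _ hB))
      (hZi.mul_const _), h2, h3, integral_mul_const, hIint, mul_comm (P.real A)]
  have h4 : ∫ ω, Z ω * ((P[I|m']) ω - ∫ ω', I ω' ∂P) ∂P
      ≤ B * ∫ ω, |(P[I|m']) ω - ∫ ω', I ω' ∂P| ∂P := by
    rw [← integral_const_mul]
    have hi : Integrable (fun ω => (P[I|m']) ω - ∫ ω', I ω' ∂P) P :=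
      integrable_condExp.sub (integrable_const _)
    refine integral_mono (hi.bdd_mul hZm.aestronglyMeasurable (ae_of_all _ hB))
      (hi.abs.const_mul _) fun ω => ?_
    refine (le_abs_self _).trans ?_
    rw [abs_mul]
    exact mul_le_mul_of_nonneg_right (hB ω) (abs_nonneg _)
  have h5 : ∫ ω in A', I ω ∂P - P.real A' * ∫ ω, I ω ∂P ≤ α := by
    have : ∫ ω in A', I ω ∂P = P.real (A ∩ A') := by
      rw [hI, integral_indicator_one (hm _ hA), measureReal_restrict_apply (hm _ hA)]
    rw [this, hIint]
    have := hα A A' hA hA'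
    rw [abs_le] at this
    linarith [this.1]
  rw [hAeq'] at h4
  have := mul_le_mul_of_nonneg_left h5 hB0
  nlinarith

end Mixing

/-! ### One step of Azuma–Hoeffding -/

section Azuma

variable {Ω : Type*} {m m' mΩ : MeasurableSpace Ω} {P : Measure Ω} [IsProbabilityMeasure P]

/-- The right side is the chord of the convex function `exp(l ·)` over `[-b, b]`. Being affine in
`d`, it leaves only the `cosh` term once `d` is a martingale difference. -/
lemma exp_mul_le_cosh_add {l b d : ℝ} (hb : 0 < b) (hd : |d| ≤ b) :
    Real.exp (l * d) ≤ Real.cosh (l * b) + d * (Real.sinh (l * b) / b) := by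
  have hd' := abs_le.mp hd
  have h := convexOn_exp.2 (Set.mem_univ (l * b)) (Set.mem_univ (-(l * b)))
    (show 0 ≤ (b + d) / (2 * b) from div_nonneg (by linarith) (by linarith))
    (show 0 ≤ (b - d) / (2 * b) from div_nonneg (by linarith) (by linarith))
    (by field_simp; ring)
  have e1 : ((b + d) / (2 * b)) • (l * b) + ((b - d) / (2 * b)) • (-(l * b)) = l * d := by
    simp only [smul_eq_mul]; field_simp; ring
  rw [e1] at h
  refine h.trans_eq ?_
  simp only [smul_eq_mul, Real.cosh_eq, Real.sinh_eq]
  field_simp; ring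

/-- One step of the Azuma–Hoeffding inequality. -/
lemma integral_exp_mul_add_le (hm : m ≤ mΩ) {S D : Ω → ℝ} {b K l : ℝ}
    (hb : 0 < b) (hS : Measurable[m] S) (hSK : ∀ᵐ ω ∂P, |S ω| ≤ K) (hD : AEStronglyMeasurable D P)
    (hDb : ∀ᵐ ω ∂P, |D ω| ≤ b) (hD0 : P[D|m] =ᵐ[P] 0) :
    ∫ ω, Real.exp (l * (S ω + D ω)) ∂P
      ≤ Real.exp ((l * b) ^ 2 / 2) * ∫ ω, Real.exp (l * S ω) ∂P := by
  have hSm : Measurable S := hS.mono hm le_rfl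
  have hE : Measurable[m] (fun ω => Real.exp (l * S ω)) :=
    Real.measurable_exp.comp (hS.const_mul l)
  have hEb : ∀ᵐ ω ∂P, ‖Real.exp (l * S ω)‖ ≤ Real.exp (|l| * K) := by
    filter_upwards [hSK] with ω hω
    rw [Real.norm_eq_abs, abs_of_pos (Real.exp_pos _), Real.exp_le_exp]
    refine (le_abs_self _).trans ?_
    rw [abs_mul]; exact mul_le_mul_of_nonneg_left hω (abs_nonneg _)
  have hEm : AEStronglyMeasurable (fun ω => Real.exp (l * S ω)) P :=
    (hE.mono hm le_rfl).aestronglyMeasurable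
  have hEi : Integrable (fun ω => Real.exp (l * S ω)) P :=
    Integrable.of_bound hEm _ hEb
  have hDi : Integrable D P := Integrable.of_bound hD b hDb
  have hED : Integrable (fun ω => Real.exp (l * S ω) * D ω) P :=
    hDi.bdd_mul hEm hEb
  have hz : ∫ ω, Real.exp (l * S ω) * D ω ∂P = 0 := by
    have h1 := condExp_mul_of_stronglyMeasurable_left (μ := P) (m := m)
      (f := fun ω => Real.exp (l * S ω)) (g := D) hE.stronglyMeasurable hED hDi
    rw [← integral_condExp (μ := P) hm (f := fun ω => Real.exp (l * S ω) * D ω)]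
    refine (integral_congr_ae (h1.trans ?_)).trans (integral_zero _ _)
    filter_upwards [hD0] with ω hω
    simp [hω]
  calc ∫ ω, Real.exp (l * (S ω + D ω)) ∂P
      ≤ ∫ ω, (Real.exp (l * S ω) * Real.cosh (l * b)
          + Real.exp (l * S ω) * D ω * (Real.sinh (l * b) / b)) ∂P := by
        refine integral_mono_of_nonneg (ae_of_all _ fun ω => (Real.exp_pos _).le)
          ((hEi.mul_const _).add (hED.mul_const _)) ?_
        filter_upwards [hDb] with ω hω
        rw [mul_add, Real.exp_add]
        have := mul_le_mul_of_nonneg_left (exp_mul_le_cosh_add (l := l) hb hω)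
          (Real.exp_pos (l * S ω)).le
        linarith
    _ = Real.cosh (l * b) * ∫ ω, Real.exp (l * S ω) ∂P := by
        rw [integral_add (hEi.mul_const _) (hED.mul_const _), integral_mul_const,
          integral_mul_const, hz]; ring
    _ ≤ _ := mul_le_mul_of_nonneg_right (Real.cosh_le_exp_half_sq _)
        (integral_nonneg fun ω => (Real.exp_pos _).le)

end Azuma

/-! ### Concentration of sums of bounded variables under mixing -/

/-- Past σ-algebras `𝔽 t` and present σ-algebras `𝔾 t ≤ 𝔽 t`, `1 ≤ t ≤ T`, whose strong mixing
coefficient at lag `q` is at most `α`. -/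
structure MixingAt {Ω : Type*} [mΩ : MeasurableSpace Ω] (P : Measure Ω) (T : ℕ)
    (𝔽 𝔾 : ℕ → MeasurableSpace Ω) (q : ℕ) (α : ℝ) : Prop where
  le : ∀ t ≤ T, 𝔽 t ≤ mΩ
  mono : Monotone 𝔽
  zero : 𝔽 0 = ⊥
  present_le : ∀ t, 1 ≤ t → t ≤ T → 𝔾 t ≤ 𝔽 t
  lag_pos : 1 ≤ q
  nonneg : 0 ≤ α
  mixing : ∀ t, 1 ≤ t → t + q ≤ T → ∀ A A', MeasurableSet[𝔽 t] A →
    MeasurableSet[𝔾 (t + q)] A' → |P.real A * P.real A' - P.real (A ∩ A')| ≤ α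

section Concentration

variable {Ω : Type*} {mΩ : MeasurableSpace Ω} {P : Measure Ω} [IsProbabilityMeasure P]
  {T q : ℕ} {𝔽 𝔾 : ℕ → MeasurableSpace Ω} {α : ℝ}

lemma MixingAt.integral_abs_condExp_sub_le (h : MixingAt P T 𝔽 𝔾 q α) {t : ℕ} (ht : 1 ≤ t)
    (htT : t ≤ T) {Y : Ω → ℝ} (hY : Measurable[𝔾 t] Y) {B : ℝ} (hB : ∀ ω, |Y ω| ≤ B) :
    ∫ ω, |(P[Y|𝔽 (t - q)]) ω - ∫ ω', Y ω' ∂P| ∂P ≤ 4 * B * α := by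
  refine PSFactor.integral_abs_condExp_sub_le (h.le _ (by omega))
    ((h.present_le t ht htT).trans (h.le t htT)) hY hB fun A A' hA hA' => ?_
  rcases Nat.lt_or_ge q t with hq | hq
  · refine h.mixing (t - q) (by omega) (by omega) A A' hA ?_
    rwa [Nat.sub_add_cancel hq.le]
  -- For `t ≤ q` the truncated subtraction gives time zero, where the σ-algebra is trivial and both
  -- possible events have covariance zero with anything.
  · rw [Nat.sub_eq_zero_of_le hq, h.zero, MeasurableSpace.measurableSet_bot_iff] at hA
    rcases hA with rfl | rfl <;> simpa using h.nonneg

/-- Azuma–Hoeffding bound for the terms of one residue class modulo `q`. -/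
lemma MixingAt.integral_exp_residue_le (h : MixingAt P T 𝔽 𝔾 q α) {D : ℕ → Ω → ℝ} {b : ℝ}
    (hb : 0 < b) (hD : ∀ t, 1 ≤ t → t ≤ T → Measurable[𝔽 t] (D t))
    (hDb : ∀ t, 1 ≤ t → t ≤ T → ∀ᵐ ω ∂P, |D t ω| ≤ b)
    (hD0 : ∀ t, 1 ≤ t → t ≤ T → P[D t|𝔽 (t - q)] =ᵐ[P] 0) (a : ℕ) {s : ℕ} (hs : 1 ≤ s) (l : ℝ)
    (k : ℕ) (hk : s + k ≤ T + 1) :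
    ∫ ω, Real.exp (l * ∑ t ∈ Finset.Ico s (s + k), if t % q = a then D t ω else 0) ∂P
      ≤ Real.exp (k * ((l * b) ^ 2 / 2)) := by
  induction k with
  | zero => simp
  | succ k ih =>
    have ih := ih (by omega)
    have hfac : Real.exp (k * ((l * b) ^ 2 / 2)) ≤
        Real.exp ((k + 1 : ℕ) * ((l * b) ^ 2 / 2)) := by
      rw [Real.exp_le_exp]; push_cast; nlinarith [sq_nonneg (l * b)]
    have e : ∀ ω, ∑ t ∈ Finset.Ico s (s + (k + 1)), (if t % q = a then D t ω else 0) =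
        ∑ t ∈ Finset.Ico s (s + k), (if t % q = a then D t ω else 0) +
          if (s + k) % q = a then D (s + k) ω else 0 := fun ω =>
      Finset.sum_Ico_succ_top (Nat.le_add_right s k) _
    simp only [e]
    by_cases hr : (s + k) % q = a
    · simp only [hr, if_true]
      have hS : Measurable[𝔽 (s + k - q)]
          (fun ω => ∑ t ∈ Finset.Ico s (s + k), if t % q = a then D t ω else 0) := by
        refine Finset.measurable_fun_sum _ fun t ht => ?_
        rw [Finset.mem_Ico] at ht
        split_ifs with hta
        -- Two distinct times in one residue class are at least `q` apart, so the earlier terms are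
        -- all known at time `s + k - q`, given which the new term has mean zero.
        · have hmod : t ≡ s + k [MOD q] := hta.trans hr.symm
          have hdvd := (Nat.modEq_iff_dvd' (by omega)).mp hmod
          have := Nat.le_of_dvd (by omega) hdvd
          exact (hD t (by omega) (by omega)).mono (h.mono (by omega)) le_rfl
        · exact measurable_const
      have hSK : ∀ᵐ ω ∂P, |∑ t ∈ Finset.Ico s (s + k), if t % q = a then D t ω else 0|
          ≤ k * b := by
        have hall : ∀ᵐ ω ∂P, ∀ t ∈ Finset.Ico s (s + k), |D t ω| ≤ b :=
          (Finset.eventually_all _).2 fun t ht => by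
            rw [Finset.mem_Ico] at ht
            exact hDb t (by omega) (by omega)
        filter_upwards [hall] with ω hω
        refine (Finset.abs_sum_le_sum_abs _ _).trans ((Finset.sum_le_card_nsmul _ _ b ?_).trans ?_)
        · intro t ht
          split_ifs
          · exact hω t ht
          · simpa using hb.le
        · simp
      have hDm : AEStronglyMeasurable (D (s + k)) P :=
        ((hD _ (by omega) (by omega)).mono (h.le _ (by omega)) le_rfl).aestronglyMeasurable
      have step := integral_exp_mul_add_le (l := l) (h.le (s + k - q) (by omega)) hb hS hSK hDm
        (hDb _ (by omega) (by omega)) (hD0 _ (by omega) (by omega))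
      refine step.trans ?_
      calc _ ≤ Real.exp ((l * b) ^ 2 / 2) * Real.exp (k * ((l * b) ^ 2 / 2)) :=
            mul_le_mul_of_nonneg_left ih (Real.exp_pos _).le
        _ = _ := by rw [← Real.exp_add]; push_cast; ring_nf
    · simp only [hr, if_false, add_zero]
      exact ih.trans hfac

lemma MixingAt.measureReal_residue_le (h : MixingAt P T 𝔽 𝔾 q α) {D : ℕ → Ω → ℝ} {b : ℝ}
    (hb : 0 < b) (hD : ∀ t, 1 ≤ t → t ≤ T → Measurable[𝔽 t] (D t))
    (hDb : ∀ t, 1 ≤ t → t ≤ T → ∀ᵐ ω ∂P, |D t ω| ≤ b)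
    (hD0 : ∀ t, 1 ≤ t → t ≤ T → P[D t|𝔽 (t - q)] =ᵐ[P] 0) (a : ℕ) {s : ℕ} (hs : 1 ≤ s)
    (k : ℕ) (hk0 : 0 < k) (hk : s + k ≤ T + 1) {y : ℝ} (hy : 0 ≤ y) :
    P.real {ω | y ≤ |∑ t ∈ Finset.Ico s (s + k), if t % q = a then D t ω else 0|}
      ≤ 2 * Real.exp (-(y ^ 2 / (2 * k * b ^ 2))) := by
  set S : Ω → ℝ := fun ω => ∑ t ∈ Finset.Ico s (s + k), if t % q = a then D t ω else 0 with hS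
  have hSm : Measurable S := by
    refine Finset.measurable_fun_sum _ fun t ht => ?_
    rw [Finset.mem_Ico] at ht
    split_ifs
    · exact (hD t (by omega) (by omega)).mono (h.le _ (by omega)) le_rfl
    · exact measurable_const
  have hSK : ∀ᵐ ω ∂P, |S ω| ≤ k * b := by
    have hall : ∀ᵐ ω ∂P, ∀ t ∈ Finset.Ico s (s + k), |D t ω| ≤ b :=
      (Finset.eventually_all _).2 fun t ht => by
        rw [Finset.mem_Ico] at ht
        exact hDb t (by omega) (by omega)
    filter_upwards [hall] with ω hω
    refine (Finset.abs_sum_le_sum_abs _ _).trans ((Finset.sum_le_card_nsmul _ _ b ?_).trans ?_)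
    · intro t ht
      split_ifs
      · exact hω t ht
      · simpa using hb.le
    · simp
  have hint : ∀ l : ℝ, Integrable (fun ω => Real.exp (l * S ω)) P := fun l => by
    refine Integrable.of_bound (Real.measurable_exp.comp (hSm.const_mul l)).aestronglyMeasurable
      (Real.exp (|l| * (k * b))) ?_
    filter_upwards [hSK] with ω hω
    rw [Real.norm_eq_abs, abs_of_pos (Real.exp_pos _), Real.exp_le_exp]
    refine (le_abs_self _).trans ?_
    rw [abs_mul]; exact mul_le_mul_of_nonneg_left hω (abs_nonneg _)
  have hk' : (0 : ℝ) < k := by exact_mod_cast hk0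
  -- The minimiser of the Chernoff exponent `-l y + k (l b)² / 2`.
  set l : ℝ := y / (k * b ^ 2) with hl
  have hl0 : 0 ≤ l := by positivity
  have key : -l * y + k * ((l * b) ^ 2 / 2) = -(y ^ 2 / (2 * k * b ^ 2)) := by
    rw [hl]; field_simp; ring
  have h1 : P.real {ω | y ≤ S ω} ≤ Real.exp (-(y ^ 2 / (2 * k * b ^ 2))) := by
    refine (measure_ge_le_exp_mul_mgf y hl0 (hint l)).trans ?_
    rw [← key, Real.exp_add]
    exact mul_le_mul_of_nonneg_left (h.integral_exp_residue_le hb hD hDb hD0 a hs l k hk)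
      (Real.exp_pos _).le
  have h2 : P.real {ω | S ω ≤ -y} ≤ Real.exp (-(y ^ 2 / (2 * k * b ^ 2))) := by
    refine (measure_le_le_exp_mul_mgf (-y) (neg_nonpos.2 hl0) (hint (-l))).trans ?_
    rw [← key, Real.exp_add]
    refine mul_le_mul (by simp) ?_ (integral_nonneg fun ω => (Real.exp_pos _).le)
      (Real.exp_pos _).le
    have := h.integral_exp_residue_le hb hD hDb hD0 a hs (-l) k hk
    rwa [neg_mul, neg_sq] at this
  have hsub : {ω | y ≤ |S ω|} ⊆ {ω | y ≤ S ω} ∪ {ω | S ω ≤ -y} := fun ω hω => by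
    rcases le_abs.mp (show y ≤ |S ω| from hω) with h | h
    · exact Or.inl h
    · exact Or.inr (show S ω ≤ -y by linarith)
  have := (measureReal_mono (μ := P) hsub).trans (measureReal_union_le _ _)
  linarith

/-- Concentration of the sums of bounded variables under strong mixing. -/
lemma MixingAt.measureReal_sum_bounded_le (h : MixingAt P T 𝔽 𝔾 q α) {Y : ℕ → Ω → ℝ} {B : ℝ}
    (hB0 : 0 < B) (hY : ∀ t, 1 ≤ t → t ≤ T → Measurable[𝔾 t] (Y t))
    (hB : ∀ t ω, |Y t ω| ≤ B) {s : ℕ} (hs : 1 ≤ s)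
    (k : ℕ) (hk0 : 0 < k) (hk : s + k ≤ T + 1) {y : ℝ} (hy : 0 ≤ y) :
    P.real {ω | q * y + 1 < |∑ t ∈ Finset.Ico s (s + k), (Y t ω - ∫ ω', Y t ω' ∂P)|}
      ≤ q * (2 * Real.exp (-(y ^ 2 / (2 * k * (2 * B) ^ 2)))) + k * (4 * B * α) := by
  have hYm : ∀ t, 1 ≤ t → t ≤ T → Measurable (Y t) := fun t h1 h2 =>
    (hY t h1 h2).mono ((h.present_le t h1 h2).trans (h.le t h2)) le_rfl
  have hYi : ∀ t, 1 ≤ t → t ≤ T → Integrable (Y t) P := fun t h1 h2 =>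
    Integrable.of_bound (hYm t h1 h2).aestronglyMeasurable B (ae_of_all _ (hB t))
  -- `Y t - E(Y t)` splits into the innovation `D t` over the past `q` steps earlier, handled class
  -- by class, and `c t - E(Y t)`, which mixing makes small in `L¹`.
  set c : ℕ → Ω → ℝ := fun t => P[Y t|𝔽 (t - q)] with hc
  set D : ℕ → Ω → ℝ := fun t ω => Y t ω - c t ω with hD
  have hcm : ∀ t, Measurable[𝔽 (t - q)] (c t) := fun t => stronglyMeasurable_condExp.measurable
  have hDm : ∀ t, 1 ≤ t → t ≤ T → Measurable[𝔽 t] (D t) := fun t h1 h2 =>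
    Measurable.sub ((hY t h1 h2).mono (h.present_le t h1 h2) le_rfl)
      ((hcm t).mono (h.mono (by omega)) le_rfl)
  have hDb : ∀ t, 1 ≤ t → t ≤ T → ∀ᵐ ω ∂P, |D t ω| ≤ 2 * B := fun t h1 h2 => by
    have : ∀ᵐ ω ∂P, |c t ω| ≤ B := by
      have := ae_bdd_abs_condExp_of_ae_bdd_abs (m := 𝔽 (t - q)) (μ := P) (f := Y t) (R := B)
        (ae_of_all _ (hB t))
      exact this
    filter_upwards [this] with ω hω
    have := hB t ω
    rw [abs_le] at *
    constructor <;> simp only [hD] <;> linarith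
  have hD0 : ∀ t, 1 ≤ t → t ≤ T → P[D t|𝔽 (t - q)] =ᵐ[P] 0 := fun t h1 h2 => by
    have h3 := condExp_sub (m := 𝔽 (t - q)) (hYi t h1 h2)
      (integrable_condExp (m := 𝔽 (t - q)) (μ := P) (f := Y t))
    have h4 : P[c t|𝔽 (t - q)] = c t :=
      condExp_of_stronglyMeasurable (h.le _ (by omega)) stronglyMeasurable_condExp
        integrable_condExp
    have h5 : D t = Y t - c t := rfl
    rw [h5]
    refine h3.trans ?_
    rw [h4]
    filter_upwards with ω
    simp [hc]
  set R : ℕ → Ω → ℝ := fun a ω => ∑ t ∈ Finset.Ico s (s + k), if t % q = a then D t ω else 0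
  set V : Ω → ℝ := fun ω => ∑ t ∈ Finset.Ico s (s + k), |c t ω - ∫ ω', Y t ω' ∂P| with hV
  have hVi : ∀ t, Integrable (fun ω => |c t ω - ∫ ω', Y t ω' ∂P|) P := fun t =>
    (integrable_condExp.sub (integrable_const _)).abs
  -- Markov's inequality at level one, the source of `+ 1` in the threshold.
  have hV1 : P.real {ω | 1 ≤ V ω} ≤ k * (4 * B * α) := by
    have := mul_meas_ge_le_integral_of_nonneg (μ := P) (f := V)
      (ae_of_all _ fun ω => Finset.sum_nonneg fun t _ => abs_nonneg _)
      (integrable_finsetSum _ fun t _ => hVi t) 1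
    rw [one_mul] at this
    refine this.trans ?_
    rw [hV, integral_finsetSum _ fun t _ => hVi t]
    refine (Finset.sum_le_card_nsmul _ _ (4 * B * α) fun t ht => ?_).trans (by simp)
    rw [Finset.mem_Ico] at ht
    exact h.integral_abs_condExp_sub_le (by omega) (by omega) (hY t (by omega) (by omega)) (hB t)
  have hsub : {ω | q * y + 1 < |∑ t ∈ Finset.Ico s (s + k), (Y t ω - ∫ ω', Y t ω' ∂P)|}
      ⊆ (⋃ a ∈ Finset.range q, {ω | y ≤ |R a ω|}) ∪ {ω | 1 ≤ V ω} := by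
    intro ω hω
    by_contra hcon
    simp only [Set.mem_union, Set.mem_iUnion, Set.mem_ofPred_eq, not_or, not_exists, not_le,
      Finset.mem_range] at hcon hω
    have e1 : ∑ t ∈ Finset.Ico s (s + k), (Y t ω - ∫ ω', Y t ω' ∂P) =
        ∑ a ∈ Finset.range q, R a ω + ∑ t ∈ Finset.Ico s (s + k), (c t ω - ∫ ω', Y t ω' ∂P) := by
      rw [Finset.sum_comm, ← Finset.sum_add_distrib]
      refine Finset.sum_congr rfl fun t _ => ?_
      rw [Finset.sum_ite_eq, if_pos (Finset.mem_range.2 (Nat.mod_lt _ h.lag_pos))]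
      simp [hD]
    have e2 : |∑ a ∈ Finset.range q, R a ω| ≤ q * y := by
      refine (Finset.abs_sum_le_sum_abs _ _).trans
        ((Finset.sum_le_card_nsmul _ _ y fun a ha => ?_).trans (by simp))
      exact (hcon.1 a (Finset.mem_range.1 ha)).le
    have e3 : |∑ t ∈ Finset.Ico s (s + k), (c t ω - ∫ ω', Y t ω' ∂P)| ≤ V ω :=
      Finset.abs_sum_le_sum_abs _ _
    rw [e1] at hω
    have := abs_add_le (∑ a ∈ Finset.range q, R a ω)
      (∑ t ∈ Finset.Ico s (s + k), (c t ω - ∫ ω', Y t ω' ∂P))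
    linarith [hcon.2]
  refine (measureReal_mono hsub).trans ((measureReal_union_le _ _).trans (add_le_add ?_ hV1))
  refine (measureReal_biUnion_finset_le _ _).trans
    ((Finset.sum_le_card_nsmul _ _
      (2 * Real.exp (-(y ^ 2 / (2 * k * (2 * B) ^ 2)))) fun a _ => ?_).trans (by simp))
  exact h.measureReal_residue_le (by positivity) hDm hDb hD0 a hs k hk0 hk hy

end Concentration

/-! ### Exponential-type tails and truncation -/

/-- Exponential-type tails `P(|X| > z) ≤ K exp(-(z/c)^b)`. -/
def HasTail {Ω : Type*} [MeasurableSpace Ω] (P : Measure Ω) (X : Ω → ℝ) (K c b : ℝ) : Prop :=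
  ∀ z : ℝ, 0 < z → P.real {ω | z < |X ω|} ≤ K * Real.exp (-(z / c) ^ b)

/-- Exponential-type tails give a second moment bound. -/
lemma exists_integral_sq_le_of_hasTail {K c b : ℝ} (hK : 0 ≤ K) (hc : 0 < c) (hb : 0 < b) :
    ∃ K₂ : ℝ, 0 ≤ K₂ ∧ ∀ (Ω : Type u) [MeasurableSpace Ω] (P : Measure Ω) [IsProbabilityMeasure P]
      (X : Ω → ℝ), Measurable X → HasTail P X K c b → MemLp X 2 P ∧ ∫ ω, X ω ^ 2 ∂P ≤ K₂ := by
  -- Layer cake: `E X² = 2 ∫ t P(|X| > t) dt`, and `K g` dominates the integrand.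
  set g : ℝ → ℝ := fun t => t ^ (1 : ℝ) * Real.exp (-(c ^ b)⁻¹ * t ^ b) with hg
  have hgi : IntegrableOn g (Set.Ioi 0) :=
    integrableOn_rpow_mul_exp_neg_mul_rpow (by norm_num) hb (by positivity)
  have hg0 : ∀ t ∈ Set.Ioi (0 : ℝ), 0 ≤ g t := fun t ht => by
    have : 0 < t := ht
    positivity
  refine ⟨2 * (K * ∫ t in Set.Ioi 0, g t), ?_, ?_⟩
  · have := setIntegral_nonneg (μ := volume) measurableSet_Ioi hg0
    positivity
  intro Ω _ P _ X hX hT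
  have h1 := lintegral_rpow_eq_lintegral_meas_lt_mul P (f := fun ω => |X ω|)
    (ae_of_all _ fun ω => abs_nonneg _) hX.abs.aemeasurable (p := 2) (by norm_num)
  have h2 : ∫⁻ t in Set.Ioi (0 : ℝ), P {a | t < |X a|} * ENNReal.ofReal (t ^ ((2 : ℝ) - 1))
      ≤ ENNReal.ofReal (K * ∫ t in Set.Ioi 0, g t) := by
    rw [← integral_const_mul, ofReal_integral_eq_lintegral_ofReal (hgi.const_mul K)
      ((ae_restrict_iff' measurableSet_Ioi).2 (ae_of_all _ fun t ht => mul_nonneg hK (hg0 t ht)))]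
    refine setLIntegral_mono' measurableSet_Ioi fun t ht => ?_
    have ht0 : 0 < t := ht
    have h3 := hT t ht0
    rw [← ofReal_measureReal, ← ENNReal.ofReal_mul measureReal_nonneg]
    refine ENNReal.ofReal_le_ofReal ?_
    have e : (t / c) ^ b = (c ^ b)⁻¹ * t ^ b := by
      rw [Real.div_rpow ht0.le hc.le]; ring
    rw [e] at h3
    have : (2 : ℝ) - 1 = 1 := by norm_num
    rw [this, hg]
    calc _ ≤ K * Real.exp (-((c ^ b)⁻¹ * t ^ b)) * t ^ (1 : ℝ) :=
          mul_le_mul_of_nonneg_right h3 (by positivity)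
      _ = _ := by ring_nf
  have e2 : ∀ ω, |X ω| ^ (2 : ℝ) = X ω ^ 2 := fun ω => by
    rw [Real.rpow_two, sq_abs]
  simp only [e2] at h1
  have h4 : ∫⁻ ω, ENNReal.ofReal (X ω ^ 2) ∂P ≤ ENNReal.ofReal (2 * (K * ∫ t in Set.Ioi 0, g t)) := by
    rw [h1, ENNReal.ofReal_mul (by norm_num)]
    exact mul_le_mul_right h2 _
  have hint : Integrable (fun ω => X ω ^ 2) P := by
    refine ⟨(hX.pow_const 2).aestronglyMeasurable, ?_⟩
    rw [hasFiniteIntegral_iff_ofReal (ae_of_all _ fun ω => sq_nonneg _)]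
    exact h4.trans_lt ENNReal.ofReal_lt_top
  refine ⟨(memLp_two_iff_integrable_sq hX.aestronglyMeasurable).2 hint, ?_⟩
  rw [integral_eq_lintegral_of_nonneg_ae (ae_of_all _ fun ω => sq_nonneg _)
    (hX.pow_const 2).aestronglyMeasurable]
  refine ENNReal.toReal_le_of_le_ofReal ?_ h4
  have := setIntegral_nonneg (μ := volume) measurableSet_Ioi hg0
  positivity

section Concentration

variable {Ω : Type*} {mΩ : MeasurableSpace Ω} {P : Measure Ω} [IsProbabilityMeasure P]
  {T q : ℕ} {𝔽 𝔾 : ℕ → MeasurableSpace Ω} {α : ℝ}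

/-- Truncation discards `Z` times the indicator of `{B < |Z|}`, and Cauchy–Schwarz, here through a
discriminant, bounds the mean of that product. -/
lemma abs_integral_sub_integral_truncate_le {Z : Ω → ℝ} (hZ : Measurable Z) (hZ2 : MemLp Z 2 P)
    {K₂ B p : ℝ} (hK₂ : ∫ ω, Z ω ^ 2 ∂P ≤ K₂) (hp : P.real {ω | B < |Z ω|} ≤ p) :
    |∫ ω, Z ω ∂P - ∫ ω, (if |Z ω| ≤ B then Z ω else 0) ∂P| ≤ √(K₂ * p) := by
  set A : Set Ω := {ω | B < |Z ω|} with hA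
  have hAm : MeasurableSet A := measurableSet_lt measurable_const hZ.abs
  have hYi : Integrable (fun ω => if |Z ω| ≤ B then Z ω else 0) P := by
    refine (hZ2.integrable (by norm_num)).mono
      (Measurable.ite (measurableSet_le hZ.abs measurable_const) hZ
        measurable_const).aestronglyMeasurable (ae_of_all _ fun ω => ?_)
    split_ifs <;> simp
  have e : ∫ ω, Z ω ∂P - ∫ ω, (if |Z ω| ≤ B then Z ω else 0) ∂P
      = ∫ ω, Z ω * A.indicator 1 ω ∂P := by
    rw [← integral_sub (hZ2.integrable (by norm_num)) hYi]
    congr 1; ext ω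
    by_cases h : |Z ω| ≤ B
    · simp [hA, h]
    · have h' : B < |Z ω| := not_le.1 h
      simp [hA, h, h']
  rw [e]
  refine Real.le_sqrt_of_sq_le ?_
  rw [sq_abs]
  have hI2 : MemLp (A.indicator (1 : Ω → ℝ)) 2 P := (memLp_const (1 : ℝ)).indicator hAm
  have cs : (∫ ω, Z ω * A.indicator 1 ω ∂P) ^ 2 ≤
      (∫ ω, Z ω ^ 2 ∂P) * ∫ ω, (A.indicator (1 : Ω → ℝ) ω) ^ 2 ∂P := by
    have hZI : Integrable (fun ω => Z ω * A.indicator (1 : Ω → ℝ) ω) P := hZ2.integrable_mul hI2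
    have hq : ∀ x : ℝ, 0 ≤ (∫ ω, (A.indicator (1 : Ω → ℝ) ω) ^ 2 ∂P) * (x * x)
        + (2 * ∫ ω, Z ω * A.indicator 1 ω ∂P) * x + ∫ ω, Z ω ^ 2 ∂P := fun x => by
      have : 0 ≤ ∫ ω, (Z ω + x * A.indicator 1 ω) ^ 2 ∂P := integral_nonneg fun ω => sq_nonneg _
      have e3 : ∀ ω, (Z ω + x * A.indicator (1 : Ω → ℝ) ω) ^ 2 =
          (x * x) * (A.indicator (1 : Ω → ℝ) ω) ^ 2 +
            (2 * x) * (Z ω * A.indicator (1 : Ω → ℝ) ω) + Z ω ^ 2 := fun ω => by ring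
      simp only [e3] at this
      have i1 := hI2.integrable_sq.const_mul (x * x)
      have i2 := hZI.const_mul (2 * x)
      rw [integral_add (f := fun ω => (x * x) * (A.indicator (1 : Ω → ℝ) ω) ^ 2 +
        (2 * x) * (Z ω * A.indicator (1 : Ω → ℝ) ω)) (i1.add i2) hZ2.integrable_sq,
        integral_add i1 i2, integral_const_mul, integral_const_mul] at this
      linarith
    have := discrim_le_zero hq
    rw [discrim] at this
    nlinarith
  have e4 : ∫ ω, (A.indicator (1 : Ω → ℝ) ω) ^ 2 ∂P = P.real A := by
    rw [← integral_indicator_one hAm]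
    congr 1; ext ω
    by_cases h : ω ∈ A <;> simp [h]
  rw [e4] at cs
  refine cs.trans (mul_le_mul hK₂ hp measureReal_nonneg ?_)
  exact (integral_nonneg fun ω => sq_nonneg _).trans hK₂

/-- Concentration of the sums of square integrable variables under strong mixing. -/
lemma MixingAt.measureReal_sum_le (h : MixingAt P T 𝔽 𝔾 q α) {Z : ℕ → Ω → ℝ} {B K₂ p : ℝ}
    (hB0 : 0 < B) (hZ : ∀ t, 1 ≤ t → t ≤ T → Measurable[𝔾 t] (Z t))
    (hZ2 : ∀ t, 1 ≤ t → t ≤ T → MemLp (Z t) 2 P)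
    (hK₂ : ∀ t, 1 ≤ t → t ≤ T → ∫ ω, Z t ω ^ 2 ∂P ≤ K₂)
    (hp : ∀ t, 1 ≤ t → t ≤ T → P.real {ω | B < |Z t ω|} ≤ p) {s : ℕ} (hs : 1 ≤ s)
    (k : ℕ) (hk0 : 0 < k) (hk : s + k ≤ T + 1) {y : ℝ} (hy : 0 ≤ y) :
    P.real {ω | q * y + 1 + k * √(K₂ * p) <
        |∑ t ∈ Finset.Ico s (s + k), (Z t ω - ∫ ω', Z t ω' ∂P)|}
      ≤ q * (2 * Real.exp (-(y ^ 2 / (2 * k * (2 * B) ^ 2)))) + k * (4 * B * α) + k * p := by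
  set Y : ℕ → Ω → ℝ := fun t ω => if |Z t ω| ≤ B then Z t ω else 0 with hY
  have hYm : ∀ t, 1 ≤ t → t ≤ T → Measurable[𝔾 t] (Y t) := fun t h1 h2 => by
    have h3 := hZ t h1 h2
    exact Measurable.ite (@measurableSet_le _ _ _ _ _ (𝔾 t) _ _ _ _ _
      (continuous_abs.measurable.comp h3) measurable_const) h3 measurable_const
  have hYB : ∀ t ω, |Y t ω| ≤ B := fun t ω => by
    simp only [hY]
    split_ifs with h
    · exact h
    · simpa using hB0.le
  have hsub : {ω | q * y + 1 + k * √(K₂ * p) <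
        |∑ t ∈ Finset.Ico s (s + k), (Z t ω - ∫ ω', Z t ω' ∂P)|} ⊆
      {ω | q * y + 1 < |∑ t ∈ Finset.Ico s (s + k), (Y t ω - ∫ ω', Y t ω' ∂P)|} ∪
        ⋃ t ∈ Finset.Ico s (s + k), {ω | B < |Z t ω|} := by
    intro ω hω
    by_contra hcon
    simp only [Set.mem_union, Set.mem_iUnion, Set.mem_ofPred_eq, not_or, not_exists, not_lt]
      at hcon hω
    have e1 : ∑ t ∈ Finset.Ico s (s + k), (Z t ω - ∫ ω', Z t ω' ∂P) =
        ∑ t ∈ Finset.Ico s (s + k), (Y t ω - ∫ ω', Y t ω' ∂P) -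
          ∑ t ∈ Finset.Ico s (s + k), (∫ ω', Z t ω' ∂P - ∫ ω', Y t ω' ∂P) := by
      rw [← Finset.sum_sub_distrib]
      refine Finset.sum_congr rfl fun t ht => ?_
      have : Y t ω = Z t ω := if_pos (hcon.2 t ht)
      rw [this]; ring
    have e2 : |∑ t ∈ Finset.Ico s (s + k), (∫ ω', Z t ω' ∂P - ∫ ω', Y t ω' ∂P)|
        ≤ k * √(K₂ * p) := by
      refine (Finset.abs_sum_le_sum_abs _ _).trans
        ((Finset.sum_le_card_nsmul _ _ (√(K₂ * p)) fun t ht => ?_).trans (by simp))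
      rw [Finset.mem_Ico] at ht
      have h1 : 1 ≤ t := by omega
      have h2 : t ≤ T := by omega
      exact abs_integral_sub_integral_truncate_le
        ((hZ t h1 h2).mono ((h.present_le t h1 h2).trans (h.le t h2)) le_rfl)
        (hZ2 t h1 h2) (hK₂ t h1 h2) (hp t h1 h2)
    rw [e1] at hω
    have := abs_sub (∑ t ∈ Finset.Ico s (s + k), (Y t ω - ∫ ω', Y t ω' ∂P))
      (∑ t ∈ Finset.Ico s (s + k), (∫ ω', Z t ω' ∂P - ∫ ω', Y t ω' ∂P))
    linarith [hcon.1]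
  refine (measureReal_mono hsub).trans ((measureReal_union_le _ _).trans (add_le_add
    (h.measureReal_sum_bounded_le hB0 hYm hYB hs k hk0 hk hy) ?_))
  refine (measureReal_biUnion_finset_le _ _).trans
    ((Finset.sum_le_card_nsmul _ _ p fun t ht => ?_).trans (by simp))
  rw [Finset.mem_Ico] at ht
  exact hp t (by omega) (by omega)

end Concentration

/-! ### Calibrating lag and truncation to powers of `log T` -/

lemma eventually_const_mul_log_rpow_le (C a : ℝ) :
    ∀ᶠ T : ℕ in atTop, C * Real.log T ^ a ≤ T := by
  have h1 : (fun x : ℝ => Real.log x ^ a) =o[atTop] fun x : ℝ => x ^ (1 : ℝ) :=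
    isLittleO_log_rpow_rpow_atTop a one_pos
  have h2 := (h1.const_mul_left C).comp_tendsto tendsto_natCast_atTop_atTop
  filter_upwards [h2.def one_pos] with T hT
  simp only [Function.comp, Real.rpow_one, one_mul, Real.norm_eq_abs, Nat.abs_cast] at hT
  exact (le_abs_self _).trans hT

lemma eventually_one_le_log : ∀ᶠ T : ℕ in atTop, 1 ≤ Real.log T :=
  (Real.tendsto_log_atTop.comp tendsto_natCast_atTop_atTop).eventually_ge_atTop 1

/-- Polynomially small failure probability for normalised sums, up to a power of `log T`, under
exponentially decaying strong mixing coefficients and exponential-type tails. -/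
theorem exists_eventually_measureReal_sum_le {K c b cα β A : ℝ} (hK : 0 ≤ K) (hc : 0 < c)
    (hb : 0 < b) (hcα : 0 < cα) (hβ : 0 < β) (hA : 0 ≤ A) :
    ∃ C : ℝ, 0 < C ∧ ∀ᶠ T : ℕ in atTop, ∀ (Ω : Type u) [MeasurableSpace Ω] (P : Measure Ω)
      [IsProbabilityMeasure P] (𝔽 𝔾 : ℕ → MeasurableSpace Ω) (Z : ℕ → Ω → ℝ),
      (∀ q : ℕ, 1 ≤ q → MixingAt P T 𝔽 𝔾 q (Real.exp (-cα * (q : ℝ) ^ β))) →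
      (∀ t, 1 ≤ t → t ≤ T → Measurable[𝔾 t] (Z t) ∧ HasTail P (Z t) K c b) →
      ∀ s e, 1 ≤ s → s ≤ e → e ≤ T →
        P.real {ω | C * Real.log T ^ (β⁻¹ + b⁻¹ + 1 / 2) * √((e - s + 1 : ℕ) : ℝ) <
          |∑ t ∈ Finset.Icc s e, (Z t ω - ∫ ω', Z t ω' ∂P)|} ≤ (T : ℝ) ^ (-A) := by
  obtain ⟨K₂, hK₂0, hK₂⟩ := exists_integral_sq_le_of_hasTail.{u} hK hc hb
  -- Every part of the failure probability is at most a constant times `T² T^{-a}`; the third power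
  -- of `T` absorbs the constants.
  set a : ℝ := A + 3 with ha
  have ha0 : 0 < a := by linarith
  set C₁ : ℝ := (a / cα) ^ β⁻¹ + 1 with hC₁
  have hC₁0 : 0 < C₁ := by positivity
  set C₂ : ℝ := c * a ^ b⁻¹ with hC₂
  have hC₂0 : 0 < C₂ := by positivity
  refine ⟨C₁ * (2 * C₂ * √(2 * a)) + 1 + √(K₂ * K), by positivity, ?_⟩
  filter_upwards [eventually_one_le_log, eventually_const_mul_log_rpow_le 1 β⁻¹,
    eventually_const_mul_log_rpow_le 1 b⁻¹, eventually_ge_atTop 1,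
    tendsto_natCast_atTop_atTop.eventually_ge_atTop (2 * C₁ + 4 * C₂ + K)] with T hl hT1 hT2 hT3 hT4
  intro Ω _ P _ 𝔽 𝔾 Z hmix hZ s e hs hse heT
  set ℓ := Real.log T with hℓ
  have hT0 : (0 : ℝ) < T := by exact_mod_cast hT3
  have hT1' : (1 : ℝ) ≤ T := by exact_mod_cast hT3
  have hℓ0 : 0 < ℓ := by linarith
  -- The least lag at which the mixing bound is at most `T^{-a}`. It costs a factor `log^{1/β} T` in
  -- the threshold.
  set q : ℕ := ⌈(a * ℓ / cα) ^ β⁻¹⌉₊ with hq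
  have hq1 : 1 ≤ q := Nat.one_le_iff_ne_zero.2 (Nat.ceil_pos.2 (by positivity)).ne'
  have hqle : (q : ℝ) ≤ C₁ * ℓ ^ β⁻¹ := by
    have h1 : (q : ℝ) ≤ (a * ℓ / cα) ^ β⁻¹ + 1 := (Nat.ceil_lt_add_one (by positivity)).le
    have h2 : (a * ℓ / cα) ^ β⁻¹ = (a / cα) ^ β⁻¹ * ℓ ^ β⁻¹ := by
      rw [← Real.mul_rpow (by positivity) hℓ0.le]; congr 1; ring
    have h3 : 1 ≤ ℓ ^ β⁻¹ := Real.one_le_rpow hl (by positivity)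
    rw [h2] at h1
    rw [hC₁]; linarith
  have hexp : Real.exp (-(a * ℓ)) = (T : ℝ) ^ (-a) := by
    rw [Real.rpow_def_of_pos hT0]; congr 1; ring
  have hα : Real.exp (-cα * (q : ℝ) ^ β) ≤ (T : ℝ) ^ (-a) := by
    rw [← hexp, Real.exp_le_exp, neg_mul, neg_le_neg_iff]
    have h1 : (a * ℓ / cα) ^ β⁻¹ ≤ q := Nat.le_ceil _
    have h2 := Real.rpow_le_rpow (by positivity) h1 hβ.le
    rw [← Real.rpow_mul (by positivity), inv_mul_cancel₀ hβ.ne', Real.rpow_one,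
      div_le_iff₀ hcα] at h2
    linarith
  -- The level that is exceeded with probability at most `K T^{-a}`.
  set B : ℝ := c * (a * ℓ) ^ b⁻¹ with hB
  have hB0 : 0 < B := by positivity
  have hBe : B = C₂ * ℓ ^ b⁻¹ := by
    rw [hB, hC₂, Real.mul_rpow ha0.le hℓ0.le]; ring
  have hp : ∀ t, 1 ≤ t → t ≤ T → P.real {ω | B < |Z t ω|} ≤ K * (T : ℝ) ^ (-a) := by
    intro t h1 h2
    refine ((hZ t h1 h2).2 B hB0).trans_eq ?_
    rw [← hexp, hB, mul_div_cancel_left₀ _ hc.ne', ← Real.rpow_mul (by positivity),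
      inv_mul_cancel₀ hb.ne', Real.rpow_one]
  have hM := hmix q hq1
  have hZm : ∀ t, 1 ≤ t → t ≤ T → Measurable (Z t) := fun t h1 h2 =>
    (hZ t h1 h2).1.mono ((hM.present_le t h1 h2).trans (hM.le t h2)) le_rfl
  set k : ℕ := e - s + 1 with hk
  have hk0 : 0 < k := by omega
  have hkT : k ≤ T := by omega
  have hk1 : (1 : ℝ) ≤ k := by exact_mod_cast hk0
  have hkT' : (k : ℝ) ≤ T := by exact_mod_cast hkT
  have hIco : Finset.Icc s e = Finset.Ico s (s + k) := by
    ext t; simp only [Finset.mem_Icc, Finset.mem_Ico]; omega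
  -- Chosen so that the Azuma exponent `y² / (2k(2B)²)` is exactly `a log T`.
  set y : ℝ := 2 * B * √(2 * k * (a * ℓ)) with hy
  have hy0 : 0 ≤ y := by positivity
  have key := hM.measureReal_sum_le hB0 (fun t h1 h2 => (hZ t h1 h2).1)
    (fun t h1 h2 => (hK₂ Ω P (Z t) (hZm t h1 h2) (hZ t h1 h2).2).1)
    (fun t h1 h2 => (hK₂ Ω P (Z t) (hZm t h1 h2) (hZ t h1 h2).2).2) hp hs k hk0 (by omega) hy0
  have hsk : 1 ≤ √(k : ℝ) := Real.one_le_sqrt.2 hk1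
  have hTa : (0 : ℝ) < (T : ℝ) ^ (-a) := Real.rpow_pos_of_pos hT0 _
  have hlb : ∀ x : ℝ, 0 ≤ x → 1 ≤ ℓ ^ x := fun x hx => Real.one_le_rpow hl hx
  have hth : 1 ≤ ℓ ^ (β⁻¹ + b⁻¹ + 1 / 2) := hlb _ (by positivity)
  rw [hIco]
  have hthr : q * y + 1 + k * √(K₂ * (K * (T : ℝ) ^ (-a))) ≤
      (C₁ * (2 * C₂ * √(2 * a)) + 1 + √(K₂ * K)) * ℓ ^ (β⁻¹ + b⁻¹ + 1 / 2) * √(k : ℝ) := by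
    have h1 : q * y ≤ C₁ * (2 * C₂ * √(2 * a)) * ℓ ^ (β⁻¹ + b⁻¹ + 1 / 2) * √k := by
      have e1 : √(2 * k * (a * ℓ)) = √(2 * a) * ℓ ^ (1 / 2 : ℝ) * √k := by
        rw [← Real.sqrt_eq_rpow, ← Real.sqrt_mul (by positivity), ← Real.sqrt_mul (by positivity)]
        congr 1; ring
      rw [hy, e1, hBe, Real.rpow_add hℓ0, Real.rpow_add hℓ0]
      calc (q : ℝ) * (2 * (C₂ * ℓ ^ b⁻¹) * (√(2 * a) * ℓ ^ (1 / 2 : ℝ) * √k))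
          ≤ (C₁ * ℓ ^ β⁻¹) * (2 * (C₂ * ℓ ^ b⁻¹) * (√(2 * a) * ℓ ^ (1 / 2 : ℝ) * √k)) :=
            mul_le_mul_of_nonneg_right hqle (by positivity)
        _ = _ := by ring
    have h2 : 1 ≤ ℓ ^ (β⁻¹ + b⁻¹ + 1 / 2) * √k := one_le_mul_of_one_le_of_one_le hth hsk
    have h3 : k * √(K₂ * (K * (T : ℝ) ^ (-a))) ≤ √(K₂ * K) * (ℓ ^ (β⁻¹ + b⁻¹ + 1 / 2) * √k) := by
      have e2 : k * √(K₂ * (K * (T : ℝ) ^ (-a))) = √(K₂ * K) * (√k * √(k * (T : ℝ) ^ (-a))) := by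
        rw [← mul_assoc K₂, Real.sqrt_mul (by positivity), Real.sqrt_mul (by positivity) ((T : ℝ) ^ (-a))]
        nth_rewrite 1 [← Real.mul_self_sqrt (show (0 : ℝ) ≤ k by positivity)]
        ring
      have h4 : √(k * (T : ℝ) ^ (-a)) ≤ 1 := by
        refine Real.sqrt_le_one.2 ?_
        calc (k : ℝ) * (T : ℝ) ^ (-a) ≤ T * (T : ℝ) ^ (-1 : ℝ) := by
              refine mul_le_mul hkT' (Real.rpow_le_rpow_of_exponent_le hT1' (by linarith))
                hTa.le hT0.le
          _ = 1 := by rw [Real.rpow_neg_one, mul_inv_cancel₀ hT0.ne']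
      rw [e2]
      refine mul_le_mul_of_nonneg_left ?_ (Real.sqrt_nonneg _)
      exact (mul_le_of_le_one_right (Real.sqrt_nonneg _) h4).trans
        (le_mul_of_one_le_left (Real.sqrt_nonneg _) hth)
    calc _ ≤ C₁ * (2 * C₂ * √(2 * a)) * ℓ ^ (β⁻¹ + b⁻¹ + 1 / 2) * √k
          + ℓ ^ (β⁻¹ + b⁻¹ + 1 / 2) * √k + √(K₂ * K) * (ℓ ^ (β⁻¹ + b⁻¹ + 1 / 2) * √k) := by
          linarith
      _ = _ := by ring
  have hsub : {ω | (C₁ * (2 * C₂ * √(2 * a)) + 1 + √(K₂ * K)) * ℓ ^ (β⁻¹ + b⁻¹ + 1 / 2) *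
        √(k : ℝ) < |∑ t ∈ Finset.Ico s (s + k), (Z t ω - ∫ ω', Z t ω' ∂P)|} ⊆
      {ω | q * y + 1 + k * √(K₂ * (K * (T : ℝ) ^ (-a))) <
        |∑ t ∈ Finset.Ico s (s + k), (Z t ω - ∫ ω', Z t ω' ∂P)|} :=
    fun ω hω => lt_of_le_of_lt hthr hω
  refine (measureReal_mono hsub).trans (key.trans ?_)
  · have e3 : y ^ 2 / (2 * k * (2 * B) ^ 2) = a * ℓ := by
      rw [hy, mul_pow, Real.sq_sqrt (by positivity)]
      field_simp
    rw [e3, hexp]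
    have hqT : (q : ℝ) ≤ C₁ * T := hqle.trans (mul_le_mul_of_nonneg_left (by linarith) hC₁0.le)
    have hBT : B ≤ C₂ * T := by
      rw [hBe]; exact mul_le_mul_of_nonneg_left (by linarith) hC₂0.le
    have hTT : (T : ℝ) ≤ T * T := le_mul_of_one_le_left hT0.le hT1'
    have h5 : k * (4 * B * Real.exp (-cα * (q : ℝ) ^ β)) ≤ T * (4 * (C₂ * T) * (T : ℝ) ^ (-a)) := by
      gcongr
    have h6 : k * (K * (T : ℝ) ^ (-a)) ≤ T * (K * (T : ℝ) ^ (-a)) := by gcongr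
    have h7 : q * (2 * (T : ℝ) ^ (-a)) ≤ C₁ * T * (2 * (T : ℝ) ^ (-a)) := by gcongr
    have h8 : C₁ * T * 2 + T * (4 * (C₂ * T)) + T * K ≤ T ^ 3 := by
      have : (2 * C₁ + 4 * C₂ + K) * (T * T) ≤ T * (T * T) :=
        mul_le_mul_of_nonneg_right hT4 (by positivity)
      have h9 : C₁ * T ≤ C₁ * (T * T) := by gcongr
      have h10 : K * T ≤ K * (T * T) := by gcongr
      have e4 : (T : ℝ) ^ 3 = T * (T * T) := by ring
      rw [e4]
      linarith
    have h11 : (T : ℝ) ^ (-A) = T ^ 3 * (T : ℝ) ^ (-a) := by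
      rw [← Real.rpow_natCast, ← Real.rpow_add hT0]; congr 1; rw [ha]; push_cast; ring
    rw [h11]
    have := mul_le_mul_of_nonneg_right h8 hTa.le
    linarith

/-! ### Tails of products and of Gaussian variables -/

section Tails

variable {Ω : Type*} {mΩ : MeasurableSpace Ω} {P : Measure Ω} [IsProbabilityMeasure P]
  {X Y : Ω → ℝ} {K c c' b b' : ℝ}

/-- For `z ≥ c'` a smaller exponent weakens the bound because `z / c' ≥ 1`. For `z < c'` the
prefactor `e` makes the claimed bound at least one, which is why it is fixed. -/
lemma HasTail.mono (h : HasTail P X (Real.exp 1) c b) (hc : 0 < c) (hcc : c ≤ c') (hb' : 0 < b')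
    (hbb : b' ≤ b) : HasTail P X (Real.exp 1) c' b' := by
  intro z hz
  have hc' : 0 < c' := hc.trans_le hcc
  rcases le_or_gt c' z with hz' | hz'
  · refine (h z hz).trans (mul_le_mul_of_nonneg_left ?_ (Real.exp_pos _).le)
    rw [Real.exp_le_exp, neg_le_neg_iff]
    have h1 : 1 ≤ z / c' := (one_le_div hc').2 hz'
    have h2 : z / c' ≤ z / c := div_le_div_of_nonneg_left hz.le hc hcc
    exact (Real.rpow_le_rpow_of_exponent_le h1 hbb).trans
      (Real.rpow_le_rpow (by positivity) h2 (hb'.le.trans hbb))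
  · refine measureReal_le_one.trans ?_
    rw [← Real.exp_add]
    refine Real.one_le_exp ?_
    have : (z / c') ^ b' ≤ 1 :=
      Real.rpow_le_one (by positivity) ((div_le_one hc').2 hz'.le) hb'.le
    linarith

lemma hasTail_one (hc : 1 ≤ c) (hb : 0 < b) :
    HasTail P (fun _ => (1 : ℝ)) (Real.exp 1) c b := by
  intro z hz
  rcases le_or_gt 1 z with hz' | hz'
  · have : {ω : Ω | z < |(1 : ℝ)|} = ∅ := by
      ext ω; simp [hz']
    rw [this]; simp; positivity
  · refine measureReal_le_one.trans ?_
    rw [← Real.exp_add]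
    refine Real.one_le_exp ?_
    have : (z / c) ^ b ≤ 1 :=
      Real.rpow_le_one (by positivity) ((div_le_one (by linarith)).2 (by linarith)) hb.le
    linarith

/-- A product above `z` forces a factor above `√z`; the square root halves the exponent. -/
lemma HasTail.mul (hX : HasTail P X K c b) (hY : HasTail P Y K c b) (hc : 0 < c) :
    HasTail P (fun ω => X ω * Y ω) (2 * K) (c ^ 2) (b / 2) := by
  intro z hz
  have hs : 0 < √z := Real.sqrt_pos.2 hz
  have hsub : {ω | z < |X ω * Y ω|} ⊆ {ω | √z < |X ω|} ∪ {ω | √z < |Y ω|} := by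
    intro ω hω
    by_contra hcon
    simp only [Set.mem_union, Set.mem_ofPred_eq, not_or, not_lt] at hcon hω
    rw [abs_mul] at hω
    have := mul_le_mul hcon.1 hcon.2 (abs_nonneg _) hs.le
    rw [Real.mul_self_sqrt hz.le] at this
    linarith
  have e : (√z / c) ^ b = (z / c ^ 2) ^ (b / 2) := by
    rw [show z / c ^ 2 = (√z / c) ^ (2 : ℝ) by
      rw [Real.rpow_two, div_pow, Real.sq_sqrt hz.le], ← Real.rpow_mul (by positivity)]
    congr 1; ring
  have h1 := hX _ hs
  have h2 := hY _ hs
  rw [e] at h1 h2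
  have := (measureReal_mono (μ := P) hsub).trans (measureReal_union_le _ _)
  linarith

/-- Tails of a centred Gaussian variable with variance at most `V`. -/
lemma hasTail_of_hasGaussianLaw (hX : HasGaussianLaw X P) (h0 : ∫ ω, X ω ∂P = 0) {V : ℝ}
    (hV : 0 < V) (hVar : ∫ ω, X ω ^ 2 ∂P ≤ V) : HasTail P X (Real.exp 1) √(2 * V) 2 := by
  have hmap := hX.map_eq_gaussianReal
  have hXm := hX.aemeasurable
  have hvar : Var[X; P] = ∫ ω, X ω ^ 2 ∂P := variance_of_integral_eq_zero hXm h0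
  set v : NNReal := Var[X; P].toNNReal with hv
  have hvV : (v : ℝ) ≤ V := by
    rw [hv, Real.coe_toNNReal _ (variance_nonneg _ _), hvar]; exact hVar
  rw [h0] at hmap
  have hmgf : ∀ l : ℝ, mgf X P l ≤ Real.exp (V * l ^ 2 / 2) := fun l => by
    rw [mgf_gaussianReal hmap, Real.exp_le_exp]
    nlinarith [sq_nonneg l]
  have hint : ∀ l : ℝ, Integrable (fun ω => Real.exp (l * X ω)) P := fun l => by
    have : Integrable (fun x => Real.exp (l * x)) (P.map X) := by
      rw [hmap]; exact integrable_exp_mul_gaussianReal l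
    exact this.comp_aemeasurable hXm
  intro z hz
  -- The Chernoff exponent at its optimal parameter `z / V`. The two sides give a prefactor two,
  -- which is below `e`.
  have key : -(z / V) * z + V * (z / V) ^ 2 / 2 = -(z / √(2 * V)) ^ (2 : ℝ) := by
    rw [Real.rpow_two, div_pow z √(2 * V), Real.sq_sqrt (by positivity)]; field_simp; ring
  have h1 : P.real {ω | z ≤ X ω} ≤ Real.exp (-(z / √(2 * V)) ^ (2 : ℝ)) := by
    refine (measure_ge_le_exp_mul_mgf z (t := z / V) (by positivity) (hint _)).trans ?_
    rw [← key, Real.exp_add]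
    exact mul_le_mul_of_nonneg_left (hmgf _) (Real.exp_pos _).le
  have h2 : P.real {ω | X ω ≤ -z} ≤ Real.exp (-(z / √(2 * V)) ^ (2 : ℝ)) := by
    refine (measure_le_le_exp_mul_mgf (-z) (t := -(z / V)) (by simp; positivity) (hint _)).trans ?_
    rw [← key, Real.exp_add]
    refine mul_le_mul (by simp) ?_ mgf_nonneg (Real.exp_pos _).le
    simpa using hmgf (-(z / V))
  have hsub : {ω | z < |X ω|} ⊆ {ω | z ≤ X ω} ∪ {ω | X ω ≤ -z} := fun ω hω => by
    rcases lt_abs.mp (show z < |X ω| from hω) with h | h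
    · exact Or.inl h.le
    · exact Or.inr (show X ω ≤ -z by linarith)
  have h3 := (measureReal_mono (μ := P) hsub).trans (measureReal_union_le _ _)
  have h4 : (2 : ℝ) ≤ Real.exp 1 := by have := Real.add_one_le_exp (1 : ℝ); linarith
  nlinarith [Real.exp_pos (-(z / √(2 * V)) ^ (2 : ℝ))]

end Tails

/-! ### The base processes: mixing, moments and tails -/

namespace Model

variable {r : ℕ} {Ω : ℕ → Type u} [∀ T, MeasurableSpace (Ω T)] (M : Model r Ω)

lemma sigmaAlg_mono {T s s' e e' : ℕ} (hs : s' ≤ s) (he : e ≤ e') :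
    M.sigmaAlg T s e ≤ M.sigmaAlg T s' e' :=
  biSup_mono fun t ht => by
    rw [Finset.mem_Icc] at *
    omega

lemma sigmaAlg_le {T s e : ℕ} (hs : 1 ≤ s) (he : e ≤ T) :
    M.sigmaAlg T s e ≤ (inferInstance : MeasurableSpace (Ω T)) := by
  refine iSup₂_le fun t ht => ?_
  rw [Finset.mem_Icc] at ht
  have ht' : t ∈ Finset.Icc 1 T := Finset.mem_Icc.2 ⟨by omega, by omega⟩
  exact sup_le (iSup_le fun j => (M.f_meas T t ht' j).comap_le)
    (iSup_le fun i => (M.ε_meas T t ht' i).comap_le)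

lemma measurable_f_sigmaAlg (T t : ℕ) (j : Fin r) : Measurable[M.sigmaAlg T t t] (M.f T t j) := by
  rw [measurable_iff_comap_le]
  refine le_trans ?_ (le_iSup₂ (f := fun t _ => (⨆ j, MeasurableSpace.comap (M.f T t j) inferInstance) ⊔
    (⨆ i, MeasurableSpace.comap (M.ε T t i) inferInstance)) t (by simp))
  exact (le_iSup (fun j => MeasurableSpace.comap (M.f T t j) inferInstance) j).trans le_sup_left

lemma measurable_ε_sigmaAlg (T t : ℕ) (i : Fin (M.n T)) :
    Measurable[M.sigmaAlg T t t] (M.ε T t i) := by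
  rw [measurable_iff_comap_le]
  refine le_trans ?_ (le_iSup₂ (f := fun t _ => (⨆ j, MeasurableSpace.comap (M.f T t j) inferInstance) ⊔
    (⨆ i, MeasurableSpace.comap (M.ε T t i) inferInstance)) t (by simp))
  exact (le_iSup (fun i => MeasurableSpace.comap (M.ε T t i) inferInstance) i).trans le_sup_right

lemma abs_le_alpha {T t k : ℕ} (ht : t ∈ Finset.Icc 1 T) {A B : Set (Ω T)}
    (hA : MeasurableSet[M.sigmaAlg T 1 t] A) (hB : MeasurableSet[M.sigmaAlg T (t + k) T] B) :
    |(M.P T).real A * (M.P T).real B - (M.P T).real (A ∩ B)| ≤ M.alpha T k := by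
  have := M.isProb T
  refine le_csSup ⟨1, ?_⟩ ⟨t, ht, A, B, hA, hB, rfl⟩
  rintro y ⟨t, _, A, B, _, _, rfl⟩
  have h1 := measureReal_nonneg (μ := M.P T) (s := A)
  have h2 := measureReal_nonneg (μ := M.P T) (s := B)
  have h3 := measureReal_nonneg (μ := M.P T) (s := A ∩ B)
  have h4 := measureReal_le_one (μ := M.P T) (s := A)
  have h5 := measureReal_le_one (μ := M.P T) (s := B)
  have h6 := measureReal_le_one (μ := M.P T) (s := A ∩ B)
  rw [abs_le]
  constructor <;> nlinarith

/-- The present is a single time, hence part of the future in the definition of `alpha`. -/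
lemma mixingAt {c β : ℝ} {T : ℕ}
    (h : ∀ k : ℕ, 1 ≤ k → M.alpha T k ≤ Real.exp (-c * (k : ℝ) ^ β)) (q : ℕ) (hq : 1 ≤ q) :
    MixingAt (M.P T) T (fun t => M.sigmaAlg T 1 t) (fun t => M.sigmaAlg T t t) q
      (Real.exp (-c * (q : ℝ) ^ β)) where
  le t ht := M.sigmaAlg_le le_rfl ht
  mono s t hst := M.sigmaAlg_mono le_rfl hst
  zero := by simp [sigmaAlg]
  present_le t ht _ := M.sigmaAlg_mono ht le_rfl
  lag_pos := hq
  nonneg := (Real.exp_pos _).le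
  mixing t ht htT A A' hA hA' :=
    (M.abs_le_alpha (Finset.mem_Icc.2 ⟨ht, by omega⟩) hA
      (M.sigmaAlg_mono le_rfl htT _ hA')).trans (h q hq)

lemma hasGaussianLaw_linearCombination (hW : M.WeakIdiosyncrasy) {T t : ℕ}
    (ht : t ∈ Finset.Icc 1 T) (a : Fin (M.n T) → ℝ) :
    HasGaussianLaw (fun ω => ∑ i, a i * M.ε T t i ω) (M.P T) := by
  have h := (hW.2 T).map_fun (∑ i, a i • ContinuousLinearMap.proj (R := ℝ)
    (φ := fun _ : Finset.Icc 1 T × Fin (M.n T) => ℝ) ((⟨t, ht⟩ : Finset.Icc 1 T), i))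
  refine h.congr (ae_of_all _ fun ω => ?_)
  simp

lemma memLp_ε (hW : M.WeakIdiosyncrasy) {T t : ℕ} (ht : t ∈ Finset.Icc 1 T) (i : Fin (M.n T)) :
    MemLp (M.ε T t i) 2 (M.P T) := by
  have := (M.hasGaussianLaw_linearCombination hW ht (Pi.single i 1)).memLp_two
  simpa [Pi.single_apply] using this

lemma integral_linearCombination_eq_zero {T t : ℕ} (ht : t ∈ Finset.Icc 1 T)
    (a : Fin (M.n T) → ℝ) : ∫ ω, ∑ i, a i * M.ε T t i ω ∂M.P T = 0 := by
  rw [integral_finsetSum _ fun i _ => ((M.ε_mean T t ht i).1.const_mul _)]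
  simp [integral_const_mul, (M.ε_mean T t ht _).2]

lemma integral_linearCombination_sq (hW : M.WeakIdiosyncrasy) {T t : ℕ}
    (ht : t ∈ Finset.Icc 1 T) (a : Fin (M.n T) → ℝ) :
    ∫ ω, (∑ i, a i * M.ε T t i ω) ^ 2 ∂M.P T =
      ∑ i, ∑ l, a i * a l * ∫ ω, M.ε T t i ω * M.ε T t l ω ∂M.P T := by
  have hi : ∀ i l, Integrable (fun ω => M.ε T t i ω * M.ε T t l ω) (M.P T) := fun i l =>
    (M.memLp_ε hW ht i).integrable_mul (M.memLp_ε hW ht l)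
  have e : ∀ ω, (∑ i, a i * M.ε T t i ω) ^ 2 =
      ∑ i, ∑ l, a i * a l * (M.ε T t i ω * M.ε T t l ω) := fun ω => by
    rw [sq, Finset.sum_mul_sum]
    exact Finset.sum_congr rfl fun i _ => Finset.sum_congr rfl fun l _ => by ring
  simp only [e]
  rw [integral_finsetSum _ fun i _ => integrable_finsetSum _ fun l _ => (hi i l).const_mul _]
  refine Finset.sum_congr rfl fun i _ => ?_
  rw [integral_finsetSum _ fun l _ => (hi i l).const_mul _]
  exact Finset.sum_congr rfl fun l _ => integral_const_mul _ _

/-- The variance of a linear combination of the idiosyncratic components at one time. -/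
lemma exists_integral_linearCombination_sq_le (hW : M.WeakIdiosyncrasy) :
    ∃ C : ℝ, 1 ≤ C ∧ ∀ T, ∀ t ∈ Finset.Icc 1 T, ∀ a : Fin (M.n T) → ℝ,
      ∫ ω, (∑ i, a i * M.ε T t i ω) ^ 2 ∂M.P T ≤ C * ∑ i, a i ^ 2 := by
  obtain ⟨C, hC0, hC⟩ := hW.1
  refine ⟨C + 1, by linarith, fun T t ht a => ?_⟩
  have ht' := Finset.mem_Icc.1 ht
  set N := ∑ i, a i ^ 2 with hN
  have hN0 : 0 ≤ N := Finset.sum_nonneg fun i _ => sq_nonneg _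
  rcases hN0.eq_or_lt with h0 | hpos
  · have ha : ∀ i, a i = 0 := fun i => by
      have := (Finset.sum_eq_zero_iff_of_nonneg fun i _ => sq_nonneg (a i)).1 h0.symm i
        (Finset.mem_univ _)
      exact pow_eq_zero_iff two_ne_zero |>.1 this
    simp [ha, ← h0]
  -- The weak dependence bound is stated for unit vectors; it is used on the one-point interval `s =
  -- e = t` and rescaled.
  · set b : Fin (M.n T) → ℝ := fun i => a i / √N with hb
    have hbsum : ∑ i, b i ^ 2 = 1 := by
      simp only [hb, div_pow, Real.sq_sqrt hN0, ← Finset.sum_div]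
      exact div_self hpos.ne'
    have h1 := hC T t t ht'.1 le_rfl ht'.2 b hbsum
    simp only [Finset.Icc_self, Finset.sum_singleton, Nat.sub_self, zero_add, Nat.cast_one, inv_one,
      one_mul] at h1
    rw [← M.integral_linearCombination_sq hW ht] at h1
    have e : ∀ ω, (∑ i, b i * M.ε T t i ω) ^ 2 = N⁻¹ * (∑ i, a i * M.ε T t i ω) ^ 2 := fun ω => by
      have : ∑ i, b i * M.ε T t i ω = (√N)⁻¹ * ∑ i, a i * M.ε T t i ω := by
        rw [Finset.mul_sum]
        exact Finset.sum_congr rfl fun i _ => by rw [hb]; ring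
      rw [this, mul_pow, inv_pow, Real.sq_sqrt hN0]
    simp only [e] at h1
    rw [integral_const_mul, inv_mul_lt_iff₀ hpos] at h1
    nlinarith

/-- The processes whose partial sums are controlled: `1`, the factors, the idiosyncratic
components and the normalised cross-sectional averages `n^{-1/2} Λᵀ ε_t`. -/
noncomputable def base (T t : ℕ) : Option (Fin r ⊕ Fin (M.n T) ⊕ Fin r) → Ω T → ℝ
  | none => fun _ => 1
  | some (Sum.inl j) => M.f T t j
  | some (Sum.inr (Sum.inl i)) => M.ε T t i
  | some (Sum.inr (Sum.inr j)) => fun ω => ∑ i, ((√(M.n T))⁻¹ * M.Λ T i j) * M.ε T t i ω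

lemma measurable_base (T t : ℕ) (v : Option (Fin r ⊕ Fin (M.n T) ⊕ Fin r)) :
    Measurable[M.sigmaAlg T t t] (M.base T t v) := by
  match v with
  | none => exact measurable_const
  | some (Sum.inl j) => exact M.measurable_f_sigmaAlg T t j
  | some (Sum.inr (Sum.inl i)) => exact M.measurable_ε_sigmaAlg T t i
  | some (Sum.inr (Sum.inr j)) =>
    exact Finset.measurable_fun_sum _ fun i _ => (M.measurable_ε_sigmaAlg T t i).const_mul _

/-- The idiosyncratic combinations are Gaussian, with variance bounded uniformly because their
coefficient vectors have bounded length: one, or at most `lbar` for `n^{-1/2}` times a column of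
`Λ`. The minimum of `βf` and the Gaussian exponent serves all processes. -/
lemma exists_hasTail_base {βf lbar : ℝ} (hβf : 0 < βf) (hF : M.FactorMoments βf)
    (hW : M.WeakIdiosyncrasy) (hΛ : ∀ T i j, |M.Λ T i j| < lbar) :
    ∃ c : ℝ, 0 < c ∧ ∀ T, ∀ t ∈ Finset.Icc 1 T, ∀ v,
      HasTail (M.P T) (M.base T t v) (Real.exp 1) c (min βf 2) := by
  obtain ⟨C, hC1, hC⟩ := M.exists_integral_linearCombination_sq_le hW
  obtain ⟨cf, hcf, hf⟩ := hF.2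
  set V : ℝ := C * (1 + lbar ^ 2) with hV
  have hV0 : 0 < V := by positivity
  have hb : 0 < min βf 2 := lt_min hβf two_pos
  refine ⟨cf + √(2 * V) + 1, by positivity, fun T t ht v => ?_⟩
  have := M.isProb T
  have hsV := Real.sqrt_nonneg (2 * V)
  have hgauss : ∀ a : Fin (M.n T) → ℝ, ∑ i, a i ^ 2 ≤ 1 + lbar ^ 2 →
      HasTail (M.P T) (fun ω => ∑ i, a i * M.ε T t i ω) (Real.exp 1) (cf + √(2 * V) + 1)
        (min βf 2) := fun a ha => by
    refine (hasTail_of_hasGaussianLaw (M.hasGaussianLaw_linearCombination hW ht a)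
      (M.integral_linearCombination_eq_zero ht a) hV0 ((hC T t ht a).trans ?_)).mono
      (by positivity) (by linarith) hb (min_le_right _ _)
    exact mul_le_mul_of_nonneg_left ha (by linarith)
  match v with
  | none => exact hasTail_one (by linarith) hb
  | some (Sum.inl j) =>
    have : HasTail (M.P T) (M.f T t j) (Real.exp 1) cf βf := fun z hz => by
      refine (hf T t ht j z hz).trans_eq ?_
      rw [← Real.exp_add]; rfl
    exact this.mono hcf (by linarith) hb (min_le_left _ _)
  | some (Sum.inr (Sum.inl i)) =>
    have h1 := hgauss (Pi.single i 1) (by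
      rw [Finset.sum_eq_single i (by intro l _ hl; simp [hl]) (by simp)]
      simp [sq_nonneg])
    simpa [Pi.single_apply, base] using h1
  | some (Sum.inr (Sum.inr j)) =>
    refine hgauss _ ?_
    have h2 : ∀ i, ((√(M.n T))⁻¹ * M.Λ T i j) ^ 2 ≤ (M.n T : ℝ)⁻¹ * lbar ^ 2 := fun i => by
      rw [mul_pow, inv_pow, Real.sq_sqrt (Nat.cast_nonneg _)]
      refine mul_le_mul_of_nonneg_left ?_ (by positivity)
      rw [← sq_abs]
      exact pow_le_pow_left₀ (abs_nonneg _) (hΛ T i j).le 2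
    refine (Finset.sum_le_sum fun i _ => h2 i).trans ?_
    rw [Finset.sum_const, Finset.card_univ, Fintype.card_fin, nsmul_eq_mul, ← mul_assoc]
    have h3 : (M.n T : ℝ) * (M.n T : ℝ)⁻¹ ≤ 1 := mul_inv_le_one
    nlinarith [sq_nonneg lbar]

end Model

/-! ### The controlled event has probability tending to one -/

namespace Model

variable {r : ℕ} {Ω : ℕ → Type u} [∀ T, MeasurableSpace (Ω T)] (M : Model r Ω)

/-- All normalised partial sums of products of two base processes are within `L` of their means. -/
def Controlled (T : ℕ) (L : ℝ) (ω : Ω T) : Prop :=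
  ∀ u v s e, 1 ≤ s → s ≤ e → e ≤ T →
    |∑ t ∈ Finset.Icc s e, (M.base T t u ω * M.base T t v ω
      - ∫ ω', M.base T t u ω' * M.base T t v ω' ∂M.P T)| ≤ L * √((e - s + 1 : ℕ) : ℝ)

lemma exists_eventually_card_le (hD : M.DimensionGrowth) :
    ∃ A : ℝ, 0 ≤ A ∧ ∀ᶠ T : ℕ in atTop, ((1 + 2 * r + M.n T : ℕ) : ℝ) ≤ (T : ℝ) ^ A := by
  obtain ⟨κ, hκ, hO⟩ := hD.2
  obtain ⟨C, hC⟩ := hO.bound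
  refine ⟨κ + 1, by linarith, ?_⟩
  filter_upwards [hC, tendsto_natCast_atTop_atTop.eventually_ge_atTop (1 + 2 * r + C),
    eventually_ge_atTop 1] with T h1 h2 h3
  have h3' : (1 : ℝ) ≤ T := by exact_mod_cast h3
  have hTκ : 1 ≤ (T : ℝ) ^ κ := Real.one_le_rpow h3' hκ.le
  simp only [Real.norm_eq_abs, Nat.abs_cast] at h1
  rw [abs_of_nonneg (by linarith)] at h1
  rw [Real.rpow_add_one (by linarith)]
  push_cast
  have h4 : (1 + 2 * (r : ℝ)) ≤ (1 + 2 * r) * (T : ℝ) ^ κ :=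
    le_mul_of_one_le_right (by positivity) hTκ
  have h5 := mul_le_mul_of_nonneg_right h2 (by linarith : (0 : ℝ) ≤ (T : ℝ) ^ κ)
  linarith

/-- Union bound: at most `T^{2A+2}` choices of two processes and an interval, each failing with
probability at most `T^{-(2A+3)}`. The exponent of the logarithm contains `min βf 2 / 2` because
products are summed. The constant `C` is the same for all `δ`. -/
theorem exists_eventually_controlled {βf β lbar : ℝ} (hβf : 0 < βf) (hβ : 0 < β)
    (hF : M.FactorMoments βf) (hW : M.WeakIdiosyncrasy) (hΛ : ∀ T i j, |M.Λ T i j| < lbar)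
    (hα : M.StrongMixing β) (hD : M.DimensionGrowth) :
    ∃ C : ℝ, 0 < C ∧ ∀ δ : ℝ, 0 < δ → ∀ᶠ T : ℕ in atTop,
      M.P T {ω | ¬ M.Controlled T (C * Real.log T ^ (β⁻¹ + (min βf 2 / 2)⁻¹ + 1 / 2)) ω}
        ≤ ENNReal.ofReal δ := by
  obtain ⟨c, hc, htail⟩ := M.exists_hasTail_base hβf hF hW hΛ
  obtain ⟨cα, hcα, hmix⟩ := hα
  obtain ⟨A, hA0, hA⟩ := M.exists_eventually_card_le hD
  obtain ⟨C, hC0, hC⟩ := exists_eventually_measureReal_sum_le.{u} (K := 2 * Real.exp 1)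
    (c := c ^ 2) (b := min βf 2 / 2) (A := 2 * A + 3) (by positivity) (by positivity)
    (by have : 0 < min βf 2 := lt_min hβf two_pos
        positivity) hcα hβ (by linarith)
  refine ⟨C, hC0, fun δ hδ => ?_⟩
  filter_upwards [hC, hA, eventually_ge_atTop 1,
    tendsto_natCast_atTop_atTop.eventually_ge_atTop (δ⁻¹)] with T hCT hAT hT1 hTδ
  have := M.isProb T
  set L : ℝ := C * Real.log T ^ (β⁻¹ + (min βf 2 / 2)⁻¹ + 1 / 2) with hL
  have hT0 : (0 : ℝ) < T := by exact_mod_cast hT1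
  set I := (Option (Fin r ⊕ Fin (M.n T) ⊕ Fin r) × Option (Fin r ⊕ Fin (M.n T) ⊕ Fin r)) ×
    (Fin T × Fin T) with hI
  set bad : I → Set (Ω T) := fun p => {ω | p.2.1.val + 1 ≤ p.2.2.val + 1 ∧
    L * √((p.2.2.val + 1 - (p.2.1.val + 1) + 1 : ℕ) : ℝ) <
      |∑ t ∈ Finset.Icc (p.2.1.val + 1) (p.2.2.val + 1), (M.base T t p.1.1 ω * M.base T t p.1.2 ω
        - ∫ ω', M.base T t p.1.1 ω' * M.base T t p.1.2 ω' ∂M.P T)|} with hbad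
  have hbadP : ∀ p, (M.P T).real (bad p) ≤ (T : ℝ) ^ (-(2 * A + 3)) := fun p => by
    by_cases hp : p.2.1.val + 1 ≤ p.2.2.val + 1
    · have h1 := hCT (Ω T) (M.P T) (fun t => M.sigmaAlg T 1 t) (fun t => M.sigmaAlg T t t)
        (fun t ω => M.base T t p.1.1 ω * M.base T t p.1.2 ω)
        (M.mixingAt (hmix T hT1))
        (fun t h1 h2 => ⟨(M.measurable_base T t _).mul (M.measurable_base T t _),
          (htail T t (Finset.mem_Icc.2 ⟨h1, h2⟩) _).mul
            (htail T t (Finset.mem_Icc.2 ⟨h1, h2⟩) _) hc⟩)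
        (p.2.1.val + 1) (p.2.2.val + 1) (by omega) hp (by omega)
      refine (measureReal_mono fun ω hω => ?_).trans h1
      exact hω.2
    · have : bad p = ∅ := by
        ext ω; simp only [hbad, Set.mem_ofPred_eq, hp, false_and, Set.mem_empty_iff_false]
      rw [this, measureReal_empty]
      positivity
  have hsub : {ω | ¬ M.Controlled T L ω} ⊆ ⋃ p, bad p := by
    intro ω hω
    simp only [Set.mem_ofPred_eq, Controlled, not_forall, not_le] at hω
    obtain ⟨u, v, s, e, hs, hse, he, h⟩ := hω
    rw [Set.mem_iUnion]
    refine ⟨⟨⟨u, v⟩, ⟨⟨s - 1, by omega⟩, ⟨e - 1, by omega⟩⟩⟩, ?_⟩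
    simp only [hbad, Set.mem_ofPred_eq, Nat.sub_add_cancel hs, Nat.sub_add_cancel (hs.trans hse)]
    exact ⟨hse, h⟩
  have hcard : (Fintype.card I : ℝ) = ((1 + 2 * r + M.n T : ℕ) : ℝ) ^ 2 * (T : ℝ) ^ 2 := by
    simp only [hI, Fintype.card_prod, Fintype.card_option, Fintype.card_sum, Fintype.card_fin]
    push_cast
    ring
  have hle : (M.P T).real {ω | ¬ M.Controlled T L ω} ≤ δ := by
    refine (measureReal_mono hsub).trans ((measureReal_iUnion_fintype_le _).trans ?_)
    refine (Finset.sum_le_card_nsmul _ _ _ fun p _ => hbadP p).trans ?_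
    rw [nsmul_eq_mul, Finset.card_univ, hcard]
    have h2 : ((1 + 2 * r + M.n T : ℕ) : ℝ) ^ 2 ≤ ((T : ℝ) ^ A) ^ 2 :=
      pow_le_pow_left₀ (Nat.cast_nonneg _) hAT 2
    calc _ ≤ ((T : ℝ) ^ A) ^ 2 * (T : ℝ) ^ 2 * (T : ℝ) ^ (-(2 * A + 3)) := by gcongr
      _ = (T : ℝ)⁻¹ := by
        rw [← Real.rpow_natCast, ← Real.rpow_natCast, ← Real.rpow_mul hT0.le, ← Real.rpow_add hT0,
          ← Real.rpow_add hT0, ← Real.rpow_neg_one]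
        congr 1; push_cast; ring
      _ ≤ δ := inv_le_of_inv_le₀ hδ hTδ
  rw [← ofReal_measureReal]
  exact ENNReal.ofReal_le_ofReal hle

end Model

/-! ### Elementary vector inequalities -/

section Vectors

variable {n : ℕ} {u v a : Fin n → ℝ}

lemma dotProduct_self_nonneg' (v : Fin n → ℝ) : 0 ≤ v ⬝ᵥ v :=
  Finset.sum_nonneg fun i _ => mul_self_nonneg (v i)

lemma dotProduct_sq_le (u v : Fin n → ℝ) : (u ⬝ᵥ v) ^ 2 ≤ (u ⬝ᵥ u) * (v ⬝ᵥ v) := by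
  have := Finset.sum_mul_sq_le_sq_mul_sq Finset.univ u v
  simpa [dotProduct, sq] using this

lemma sq_le_dotProduct_self (v : Fin n → ℝ) (i : Fin n) : v i ^ 2 ≤ v ⬝ᵥ v := by
  rw [sq]
  exact Finset.single_le_sum (f := fun i => v i * v i) (fun i _ => mul_self_nonneg (v i))
    (Finset.mem_univ i)

lemma abs_le_sqrt_dotProduct_self (v : Fin n → ℝ) (i : Fin n) : |v i| ≤ √(v ⬝ᵥ v) := by
  rw [← Real.sqrt_sq_eq_abs]
  exact Real.sqrt_le_sqrt (sq_le_dotProduct_self v i)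

lemma dotProduct_self_le {A : ℝ} (ha : ∀ i, |a i| ≤ A) : a ⬝ᵥ a ≤ n * A ^ 2 := by
  refine (Finset.sum_le_card_nsmul _ _ (A ^ 2) fun i _ => ?_).trans (by simp)
  rw [← sq, ← sq_abs]
  exact pow_le_pow_left₀ (abs_nonneg _) (ha i) 2

lemma abs_dotProduct_le_sqrt {A : ℝ} (hA : 0 ≤ A) (ha : ∀ i, |a i| ≤ A) (v : Fin n → ℝ) :
    |a ⬝ᵥ v| ≤ A * √n * √(v ⬝ᵥ v) := by
  refine abs_le_of_sq_le_sq ?_ (by positivity)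
  refine (dotProduct_sq_le a v).trans ?_
  rw [mul_pow, mul_pow, Real.sq_sqrt (Nat.cast_nonneg _), Real.sq_sqrt (dotProduct_self_nonneg' v),
    mul_comm (A ^ 2)]
  exact mul_le_mul_of_nonneg_right (dotProduct_self_le ha) (dotProduct_self_nonneg' v)

lemma abs_dotProduct_le {A B : ℝ} (hA : 0 ≤ A) (ha : ∀ i, |a i| ≤ A) (hv : ∀ i, |v i| ≤ B) :
    |a ⬝ᵥ v| ≤ n * (A * B) := by
  refine (Finset.abs_sum_le_sum_abs _ _).trans
    ((Finset.sum_le_card_nsmul _ _ (A * B) fun i _ => ?_).trans (by simp))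
  rw [abs_mul]
  exact mul_le_mul (ha i) (hv i) (abs_nonneg _) hA

lemma abs_sum_filter_lt_le {k : ℕ} {g : Fin n → ℝ} {B : ℝ} (hB : 0 ≤ B)
    (hg : ∀ j : Fin n, j.val < k → |g j| ≤ B) : |∑ j with j.val < k, g j| ≤ k * B := by
  refine (Finset.abs_sum_le_sum_abs _ _).trans
    ((Finset.sum_le_card_nsmul _ _ B fun j hj => hg j (by simpa using hj)).trans ?_)
  rw [nsmul_eq_mul, Fin.card_filter_val_lt]
  exact mul_le_mul_of_nonneg_right (by exact_mod_cast min_le_right _ _) hB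

/-- A positive semidefinite symmetric form bounded by `C` on the unit sphere has norm at most
`C`. -/
lemma abs_dotProduct_mulVec_le {S : Matrix (Fin n) (Fin n) ℝ} {C : ℝ} (hS : Sᵀ = S)
    (h0 : ∀ v, 0 ≤ v ⬝ᵥ S *ᵥ v) (hC : ∀ v, v ⬝ᵥ S *ᵥ v ≤ C * (v ⬝ᵥ v))
    (hu : u ⬝ᵥ u = 1) (hv : v ⬝ᵥ v = 1) : |u ⬝ᵥ S *ᵥ v| ≤ C := by
  have hsym : v ⬝ᵥ S *ᵥ u = u ⬝ᵥ S *ᵥ v := by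
    rw [Matrix.dotProduct_mulVec, ← Matrix.mulVec_transpose, hS, dotProduct_comm]
  -- Nonnegativity of the form at `u + v` and `u - v` bounds twice the cross term, up to sign, by
  -- the sum of the two diagonal values.
  have e1 : (u + v) ⬝ᵥ S *ᵥ (u + v) = u ⬝ᵥ S *ᵥ u + 2 * (u ⬝ᵥ S *ᵥ v) + v ⬝ᵥ S *ᵥ v := by
    rw [Matrix.mulVec_add, dotProduct_add, add_dotProduct, add_dotProduct, hsym]; ring
  have e2 : (u - v) ⬝ᵥ S *ᵥ (u - v) = u ⬝ᵥ S *ᵥ u - 2 * (u ⬝ᵥ S *ᵥ v) + v ⬝ᵥ S *ᵥ v := by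
    rw [Matrix.mulVec_sub, dotProduct_sub, sub_dotProduct, sub_dotProduct, hsym]; ring
  have h1 := h0 (u + v)
  have h2 := h0 (u - v)
  have h3 := hC u
  have h4 := hC v
  rw [hu] at h3; rw [hv] at h4
  rw [abs_le]
  constructor <;> linarith

end Vectors

/-! ### Perturbation of a rank `r` matrix: eigenvalues -/

/-- A symmetric matrix `Γ` which is close to `Λ Λᵀ`, with ordered orthonormal eigenvectors `w`. -/
structure FactorDecomp {n r : ℕ} (Γ : Matrix (Fin n) (Fin n) ℝ) (Λ : Matrix (Fin n) (Fin r) ℝ)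
    (F : Matrix (Fin r) (Fin r) ℝ) (G : Matrix (Fin r) (Fin n) ℝ) (S Δ : Matrix (Fin n) (Fin n) ℝ)
    (w : Fin n → Fin n → ℝ) (μ : Fin n → ℝ) (lb C h τ : ℝ) : Prop where
  -- In the application `F` is the sample second moment of the factors, `G` their cross moment with
  -- the noise, `S` the mean noise covariance and `Δ` its fluctuation. `S` need not be entrywise
  -- small and is bounded as a form instead.
  eq : Γ = Λ * F * Λᵀ + Λ * G + Gᵀ * Λᵀ + S + Δ
  anti : Antitone μ
  eigen : ∀ j, Γ *ᵥ w j = μ j • w j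
  ortho : ∀ j l, w j ⬝ᵥ w l = if j = l then 1 else 0
  n_pos : 0 < n
  one_le_lb : 1 ≤ lb
  one_le_C : 1 ≤ C
  h_pos : 0 < h
  τ_nonneg : 0 ≤ τ
  τ_le_one : τ ≤ 1
  rτ_le : r * τ ≤ 1 / 2
  Dτ_le : (2 * r * lb + 1) * τ ≤ h / 4
  Λ_le : ∀ i a, |Λ i a| ≤ lb
  F_le : ∀ a b, |(F - 1) a b| ≤ τ
  G_le : ∀ a i, |G a i| ≤ τ
  Δ_le : ∀ i l, |Δ i l| ≤ τ
  S_symm : Sᵀ = S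
  S_nonneg : ∀ v, 0 ≤ v ⬝ᵥ S *ᵥ v
  S_le : ∀ v, v ⬝ᵥ S *ᵥ v ≤ C * (v ⬝ᵥ v)
  le_gram : ∀ u, h * n * (u ⬝ᵥ u) ≤ (Λ *ᵥ u) ⬝ᵥ (Λ *ᵥ u)

namespace FactorDecomp

variable {n r : ℕ} {Γ : Matrix (Fin n) (Fin n) ℝ} {Λ : Matrix (Fin n) (Fin r) ℝ}
  {F : Matrix (Fin r) (Fin r) ℝ} {G : Matrix (Fin r) (Fin n) ℝ} {S Δ : Matrix (Fin n) (Fin n) ℝ}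
  {w : Fin n → Fin n → ℝ} {μ : Fin n → ℝ} {lb C h τ : ℝ}

lemma expand (d : FactorDecomp Γ Λ F G S Δ w μ lb C h τ) (v : Fin n → ℝ) :
    v = ∑ j, (w j ⬝ᵥ v) • w j := by
  have h1 : (Matrix.of w) * (Matrix.of w)ᵀ = 1 := by
    ext j l
    rw [Matrix.mul_apply, Matrix.one_apply, ← d.ortho j l]
    rfl
  have h2 := mul_eq_one_comm.1 h1
  have h3 : (Matrix.of w)ᵀ *ᵥ ((Matrix.of w) *ᵥ v) = v := by
    rw [Matrix.mulVec_mulVec, h2, Matrix.one_mulVec]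
  conv_lhs => rw [← h3]
  ext i
  simp only [Matrix.mulVec, dotProduct, Matrix.transpose_apply, Matrix.of_apply, Finset.sum_apply,
    Pi.smul_apply, smul_eq_mul]
  exact Finset.sum_congr rfl fun j _ => mul_comm _ _

lemma dotProduct_eq (d : FactorDecomp Γ Λ F G S Δ w μ lb C h τ) (u v : Fin n → ℝ) :
    u ⬝ᵥ v = ∑ j, (w j ⬝ᵥ u) * (w j ⬝ᵥ v) := by
  conv_lhs => rw [d.expand v]
  rw [dotProduct_sum]
  refine Finset.sum_congr rfl fun j _ => ?_
  rw [dotProduct_smul, smul_eq_mul, dotProduct_comm u, mul_comm]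

lemma quadForm_eq (d : FactorDecomp Γ Λ F G S Δ w μ lb C h τ) (v : Fin n → ℝ) :
    v ⬝ᵥ Γ *ᵥ v = ∑ j, μ j * (w j ⬝ᵥ v) ^ 2 := by
  conv_lhs => enter [2]; rw [d.expand v]
  rw [Matrix.mulVec_sum, dotProduct_sum]
  refine Finset.sum_congr rfl fun j _ => ?_
  rw [Matrix.mulVec_smul, d.eigen, dotProduct_smul, dotProduct_smul, smul_eq_mul, smul_eq_mul,
    dotProduct_comm v]
  ring

lemma abs_G_mulVec_le (d : FactorDecomp Γ Λ F G S Δ w μ lb C h τ) (v : Fin n → ℝ) (a : Fin r) :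
    |(G *ᵥ v) a| ≤ τ * √n * √(v ⬝ᵥ v) :=
  abs_dotProduct_le_sqrt d.τ_nonneg (d.G_le a) v

lemma abs_Δ_mulVec_le (d : FactorDecomp Γ Λ F G S Δ w μ lb C h τ) (v : Fin n → ℝ) (i : Fin n) :
    |(Δ *ᵥ v) i| ≤ τ * √n * √(v ⬝ᵥ v) :=
  abs_dotProduct_le_sqrt d.τ_nonneg (d.Δ_le i) v

lemma lb_pos (d : FactorDecomp Γ Λ F G S Δ w μ lb C h τ) : 0 < lb := by
  linarith [d.one_le_lb]

lemma abs_Λ_transpose_mulVec_le (d : FactorDecomp Γ Λ F G S Δ w μ lb C h τ) (v : Fin n → ℝ)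
    (a : Fin r) : |(Λᵀ *ᵥ v) a| ≤ lb * √n * √(v ⬝ᵥ v) :=
  abs_dotProduct_le_sqrt d.lb_pos.le (fun i => d.Λ_le i a) v

lemma mulVec_eq (d : FactorDecomp Γ Λ F G S Δ w μ lb C h τ) (v : Fin n → ℝ) :
    Γ *ᵥ v = Λ *ᵥ (F *ᵥ (Λᵀ *ᵥ v)) + Λ *ᵥ (G *ᵥ v) + Gᵀ *ᵥ (Λᵀ *ᵥ v) + S *ᵥ v + Δ *ᵥ v := by
  rw [d.eq]
  simp only [Matrix.add_mulVec, Matrix.mulVec_mulVec, Matrix.mul_assoc]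

lemma dotProduct_mulVec_eq_transpose {m k : ℕ} (A : Matrix (Fin m) (Fin k) ℝ) (u : Fin m → ℝ)
    (v : Fin k → ℝ) : u ⬝ᵥ A *ᵥ v = (Aᵀ *ᵥ u) ⬝ᵥ v := by
  rw [Matrix.dotProduct_mulVec, Matrix.mulVec_transpose]

/-- The quadratic form of `Γ` is close to that of `Λ Λᵀ + S`. -/
lemma abs_quadForm_sub_le (d : FactorDecomp Γ Λ F G S Δ w μ lb C h τ) (v : Fin n → ℝ) :
    |v ⬝ᵥ Γ *ᵥ v - (Λᵀ *ᵥ v) ⬝ᵥ (Λᵀ *ᵥ v) - v ⬝ᵥ S *ᵥ v| ≤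
      r * τ * ((Λᵀ *ᵥ v) ⬝ᵥ (Λᵀ *ᵥ v)) + (2 * r * lb + 1) * τ * n * (v ⬝ᵥ v) := by
  set p := Λᵀ *ᵥ v with hp
  have hn := Real.mul_self_sqrt (Nat.cast_nonneg (α := ℝ) n)
  have hN := Real.mul_self_sqrt (dotProduct_self_nonneg' v)
  have e : v ⬝ᵥ Γ *ᵥ v - p ⬝ᵥ p - v ⬝ᵥ S *ᵥ v =
      p ⬝ᵥ (F - 1) *ᵥ p + 2 * ((G *ᵥ v) ⬝ᵥ p) + (Δ *ᵥ v) ⬝ᵥ v := by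
    rw [d.mulVec_eq v]
    simp only [dotProduct_add]
    rw [dotProduct_mulVec_eq_transpose Λ v, dotProduct_mulVec_eq_transpose Λ v,
      dotProduct_mulVec_eq_transpose Gᵀ v, Matrix.transpose_transpose, ← hp, Matrix.sub_mulVec,
      Matrix.one_mulVec, dotProduct_sub, dotProduct_comm p (G *ᵥ v), dotProduct_comm v (Δ *ᵥ v)]
    ring
  have hF : ∀ a, |((F - 1) *ᵥ p) a| ≤ τ * √r * √(p ⬝ᵥ p) := fun a =>
    abs_dotProduct_le_sqrt d.τ_nonneg (d.F_le a) p
  have h1 : |p ⬝ᵥ (F - 1) *ᵥ p| ≤ r * τ * (p ⬝ᵥ p) := by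
    rw [dotProduct_comm]
    refine (abs_dotProduct_le_sqrt (by have := d.τ_nonneg; positivity) hF p).trans_eq ?_
    have e1 := Real.mul_self_sqrt (dotProduct_self_nonneg' p)
    have e2 := Real.mul_self_sqrt (Nat.cast_nonneg (α := ℝ) r)
    calc _ = (√r * √r) * τ * (√(p ⬝ᵥ p) * √(p ⬝ᵥ p)) := by ring
      _ = _ := by rw [e1, e2]
  have h2 : |(G *ᵥ v) ⬝ᵥ p| ≤ r * lb * τ * n * (v ⬝ᵥ v) := by
    refine (abs_dotProduct_le (by have := d.τ_nonneg; positivity) (d.abs_G_mulVec_le v)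
      (d.abs_Λ_transpose_mulVec_le v)).trans_eq ?_
    calc _ = r * lb * τ * (√n * √n) * (√(v ⬝ᵥ v) * √(v ⬝ᵥ v)) := by ring
      _ = _ := by rw [hn, hN]
  have h3 : |(Δ *ᵥ v) ⬝ᵥ v| ≤ τ * n * (v ⬝ᵥ v) := by
    refine (abs_dotProduct_le_sqrt (by have := d.τ_nonneg; positivity)
      (d.abs_Δ_mulVec_le v) v).trans_eq ?_
    calc _ = τ * (√n * √n) * (√(v ⬝ᵥ v) * √(v ⬝ᵥ v)) := by ring
      _ = _ := by rw [hn, hN]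
  rw [e]
  refine (abs_add_three _ _ _).trans ?_
  rw [abs_mul, abs_two]
  linarith

/-- `S` only increases the form of `Γ`, and `rτ ≤ 1/2` lets half of `|Λᵀv|²` absorb the error in
`F`. -/
lemma le_quadForm (d : FactorDecomp Γ Λ F G S Δ w μ lb C h τ) (v : Fin n → ℝ) :
    (Λᵀ *ᵥ v) ⬝ᵥ (Λᵀ *ᵥ v) ≤
      2 * (v ⬝ᵥ Γ *ᵥ v + (2 * r * lb + 1) * τ * n * (v ⬝ᵥ v)) := by
  have h1 := (abs_le.1 (d.abs_quadForm_sub_le v)).1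
  have h2 := d.S_nonneg v
  have h3 := mul_le_mul_of_nonneg_right d.rτ_le (dotProduct_self_nonneg' (Λᵀ *ᵥ v))
  linarith

/-- The eigenvalues after the `r`-th one are small. -/
lemma eigenvalue_le (d : FactorDecomp Γ Λ F G S Δ w μ lb C h τ) {j : Fin n} (hj : r ≤ j.val) :
    μ j ≤ C + (2 * r * lb + 1) * τ * n := by
  have hrn : r < n := lt_of_le_of_lt hj j.isLt
  set k : Fin n := ⟨r, hrn⟩ with hk
  refine (d.anti (show k ≤ j from hj)).trans ?_
  -- Min-max by counting: `r + (n - 1 - r) < n` linear conditions leave a nonzero `v` with `Λᵀv = 0`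
  -- in the span of the eigenvectors up to index `r`, so its Rayleigh quotient is at least `μ k`.
  let φ : (Fin n → ℝ) →ₗ[ℝ] (Fin r → ℝ) × ({j : Fin n // k < j} → ℝ) :=
    (Matrix.mulVecLin Λᵀ).prod
      ((LinearMap.funLeft ℝ ℝ Subtype.val).comp (Matrix.mulVecLin (Matrix.of w)))
  have hker : LinearMap.ker φ ≠ ⊥ := by
    refine LinearMap.ker_ne_bot_of_finrank_lt ?_
    rw [Module.finrank_prod, Module.finrank_fintype_fun_eq_card, Module.finrank_fintype_fun_eq_card,
      Module.finrank_fintype_fun_eq_card, Fintype.card_subtype, Fintype.card_fin, Fintype.card_fin]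
    have : (Finset.univ.filter fun j : Fin n => k < j).card = n - 1 - r := by
      rw [Finset.filter_lt_eq_Ioi, Fin.card_Ioi]
    omega
  obtain ⟨v, hv, hv0⟩ := (Submodule.ne_bot_iff _).1 hker
  rw [LinearMap.mem_ker] at hv
  have hp : Λᵀ *ᵥ v = 0 := congrArg Prod.fst hv
  have hc : ∀ l : Fin n, k < l → w l ⬝ᵥ v = 0 := fun l hl =>
    congrFun (congrArg Prod.snd hv) ⟨l, hl⟩
  have hN : 0 < v ⬝ᵥ v := lt_of_le_of_ne (dotProduct_self_nonneg' v)
    fun h => hv0 (dotProduct_self_eq_zero.1 h.symm)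
  have h1 : μ k * (v ⬝ᵥ v) ≤ v ⬝ᵥ Γ *ᵥ v := by
    rw [d.quadForm_eq v, d.dotProduct_eq v v, Finset.mul_sum]
    refine Finset.sum_le_sum fun l _ => ?_
    rw [← sq]
    rcases le_or_gt l k with hl | hl
    · exact mul_le_mul_of_nonneg_right (d.anti hl) (sq_nonneg _)
    · simp [hc l hl]
  have h2 := (abs_le.1 (d.abs_quadForm_sub_le v)).2
  rw [hp, dotProduct_zero, mul_zero] at h2
  have h3 := d.S_le v
  refine le_of_mul_le_mul_right ?_ hN
  linarith

/-- The first `r` eigenvalues are of the order `n`. -/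
lemma le_eigenvalue (d : FactorDecomp Γ Λ F G S Δ w μ lb C h τ) {j : Fin n} (hj : j.val < r) :
    h / 4 * n ≤ μ j := by
  -- Here `j < r` conditions leave a nonzero `u` for which `Λu` is orthogonal to all eigenvectors
  -- before `j`, so its Rayleigh quotient is at most `μ j`.
  let φ : (Fin r → ℝ) →ₗ[ℝ] ({l : Fin n // l < j} → ℝ) :=
    (LinearMap.funLeft ℝ ℝ Subtype.val).comp
      ((Matrix.mulVecLin (Matrix.of w)).comp (Matrix.mulVecLin Λ))
  have hker : LinearMap.ker φ ≠ ⊥ := by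
    refine LinearMap.ker_ne_bot_of_finrank_lt ?_
    rw [Module.finrank_fintype_fun_eq_card, Module.finrank_fintype_fun_eq_card,
      Fintype.card_subtype, Fintype.card_fin]
    have : (Finset.univ.filter fun l : Fin n => l < j).card = j := by
      rw [Finset.filter_gt_eq_Iio, Fin.card_Iio]
    omega
  obtain ⟨u, hu, hu0⟩ := (Submodule.ne_bot_iff _).1 hker
  rw [LinearMap.mem_ker] at hu
  set v := Λ *ᵥ u with hv
  have hc : ∀ l : Fin n, l < j → w l ⬝ᵥ v = 0 := fun l hl => congrFun hu ⟨l, hl⟩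
  have hU : 0 < u ⬝ᵥ u := lt_of_le_of_ne (dotProduct_self_nonneg' u)
    fun h => hu0 (dotProduct_self_eq_zero.1 h.symm)
  have hn : (0 : ℝ) < n := by exact_mod_cast d.n_pos
  have hhn : 0 < h * n := mul_pos d.h_pos hn
  have hg : h * n * (u ⬝ᵥ u) ≤ v ⬝ᵥ v := d.le_gram u
  have hN : 0 < v ⬝ᵥ v := (mul_pos hhn hU).trans_le hg
  set p := Λᵀ *ᵥ v with hp
  have hNp : v ⬝ᵥ v = p ⬝ᵥ u := by
    conv_lhs => enter [2]; rw [hv]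
    rw [dotProduct_mulVec_eq_transpose]
  -- As `|v|² = p·u`, Cauchy–Schwarz carries the Gram bound from `Λ` on `u` over to `Λᵀ` on its
  -- range.
  have hpN : h * n * (v ⬝ᵥ v) ≤ p ⬝ᵥ p := by
    have h1 := dotProduct_sq_le p u
    rw [← hNp] at h1
    have h2 : 0 ≤ p ⬝ᵥ p := dotProduct_self_nonneg' p
    have h3 : (p ⬝ᵥ p) * (h * n * (u ⬝ᵥ u)) ≤ (p ⬝ᵥ p) * (v ⬝ᵥ v) :=
      mul_le_mul_of_nonneg_left hg h2
    refine le_of_mul_le_mul_right ?_ hN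
    calc h * n * (v ⬝ᵥ v) * (v ⬝ᵥ v) = h * n * (v ⬝ᵥ v) ^ 2 := by ring
      _ ≤ h * n * ((p ⬝ᵥ p) * (u ⬝ᵥ u)) := mul_le_mul_of_nonneg_left h1 hhn.le
      _ = (p ⬝ᵥ p) * (h * n * (u ⬝ᵥ u)) := by ring
      _ ≤ _ := h3
  have h1 : v ⬝ᵥ Γ *ᵥ v ≤ μ j * (v ⬝ᵥ v) := by
    rw [d.quadForm_eq v, d.dotProduct_eq v v, Finset.mul_sum]
    refine Finset.sum_le_sum fun l _ => ?_
    rw [← sq]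
    rcases lt_or_ge l j with hl | hl
    · simp [hc l hl]
    · exact mul_le_mul_of_nonneg_right (d.anti hl) (sq_nonneg _)
  have h2 := d.le_quadForm v
  have h3 : (2 * r * lb + 1) * τ * (n * (v ⬝ᵥ v)) ≤ h / 4 * (n * (v ⬝ᵥ v)) :=
    mul_le_mul_of_nonneg_right d.Dτ_le (by positivity)
  refine le_of_mul_le_mul_right ?_ hN
  linarith

end FactorDecomp

/-! ### Leading eigenvectors and the column space of the loadings -/

namespace FactorDecomp

variable {n r : ℕ} {Γ : Matrix (Fin n) (Fin n) ℝ} {Λ : Matrix (Fin n) (Fin r) ℝ}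
  {F : Matrix (Fin r) (Fin r) ℝ} {G : Matrix (Fin r) (Fin n) ℝ} {S Δ : Matrix (Fin n) (Fin n) ℝ}
  {w : Fin n → Fin n → ℝ} {μ : Fin n → ℝ} {lb C h τ : ℝ}

lemma n_pos' (d : FactorDecomp Γ Λ F G S Δ w μ lb C h τ) : (0 : ℝ) < n := by
  exact_mod_cast d.n_pos

lemma sqrt_pos (d : FactorDecomp Γ Λ F G S Δ w μ lb C h τ) : 0 < √(n : ℝ) :=
  Real.sqrt_pos.2 d.n_pos'

lemma sqrt_dotProduct_eigenvector (d : FactorDecomp Γ Λ F G S Δ w μ lb C h τ) (j : Fin n) :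
    √(w j ⬝ᵥ w j) = 1 := by
  rw [d.ortho j j, if_pos rfl, Real.sqrt_one]

lemma abs_loading_le (d : FactorDecomp Γ Λ F G S Δ w μ lb C h τ) (j : Fin n) (a : Fin r) :
    |(Λᵀ *ᵥ w j) a| ≤ lb * √n := by
  have := d.abs_Λ_transpose_mulVec_le (w j) a
  rwa [d.sqrt_dotProduct_eigenvector, mul_one] at this

lemma eigenvalue_pos (d : FactorDecomp Γ Λ F G S Δ w μ lb C h τ) {j : Fin n} (hj : j.val < r) :
    0 < μ j :=
  lt_of_lt_of_le (mul_pos (by have := d.h_pos; positivity) d.n_pos') (d.le_eigenvalue hj)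

/-- The coefficients of the leading eigenvectors in terms of the loadings. -/
lemma abs_coeff_le (d : FactorDecomp Γ Λ F G S Δ w μ lb C h τ) {j : Fin n} (hj : j.val < r)
    (a : Fin r) : |(F *ᵥ (Λᵀ *ᵥ w j)) a / μ j| ≤ 8 * r * lb / h / √n := by
  have hμ := d.eigenvalue_pos hj
  have hF : ∀ b, |F a b| ≤ 2 := fun b => by
    have h1 := abs_le.1 (d.F_le a b)
    have h2 := d.τ_le_one
    rw [Matrix.sub_apply, Matrix.one_apply] at h1
    rw [abs_le]
    split_ifs at h1 <;> constructor <;> linarith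
  have h1 : |(F *ᵥ (Λᵀ *ᵥ w j)) a| ≤ r * (2 * (lb * √n)) :=
    abs_dotProduct_le two_pos.le hF (d.abs_loading_le j)
  rw [abs_div, abs_of_pos hμ, div_le_iff₀ hμ]
  have hh := d.h_pos
  have hs := d.sqrt_pos
  have hlb := d.lb_pos
  have hn := Real.mul_self_sqrt (Nat.cast_nonneg (α := ℝ) n)
  calc |(F *ᵥ (Λᵀ *ᵥ w j)) a| ≤ r * (2 * (lb * √n)) := h1
    _ = 8 * r * lb / h / √n * (h / 4 * (√n * √n)) := by field_simp; ring
    _ = 8 * r * lb / h / √n * (h / 4 * n) := by rw [hn]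
    _ ≤ _ := mul_le_mul_of_nonneg_left (d.le_eigenvalue hj) (by positivity)

/-- The leading eigenvectors are, up to a small remainder, in the column space of `Λ`. -/
lemma abs_remainder_le (d : FactorDecomp Γ Λ F G S Δ w μ lb C h τ) {j : Fin n} (hj : j.val < r)
    (i : Fin n) :
    |w j i - ∑ a, Λ i a * ((F *ᵥ (Λᵀ *ᵥ w j)) a / μ j)| ≤
      4 * (2 * r * lb + 1 + C) / h * (τ + 1 / √n) / √n := by
  have hμ := d.eigenvalue_pos hj
  have hh := d.h_pos
  have hs := d.sqrt_pos
  have hlb := d.lb_pos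
  have hτ := d.τ_nonneg
  have hn := Real.mul_self_sqrt (Nat.cast_nonneg (α := ℝ) n)
  have h0 := congrFun (d.mulVec_eq (w j)) i
  rw [d.eigen, Pi.smul_apply, smul_eq_mul] at h0
  simp only [Pi.add_apply] at h0
  -- The eigenvector equation divided by `μ j`. The four terms left over have size `O(τ√n + 1)`, and
  -- `μ j` is at least of order `n`.
  have e : w j i - ∑ a, Λ i a * ((F *ᵥ (Λᵀ *ᵥ w j)) a / μ j) =
      ((Λ *ᵥ (G *ᵥ w j)) i + (Gᵀ *ᵥ (Λᵀ *ᵥ w j)) i + (S *ᵥ w j) i + (Δ *ᵥ w j) i) / μ j := by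
    have e1 : ∑ a, Λ i a * ((F *ᵥ (Λᵀ *ᵥ w j)) a / μ j) = (Λ *ᵥ (F *ᵥ (Λᵀ *ᵥ w j))) i / μ j := by
      rw [Matrix.mulVec, dotProduct, Finset.sum_div]
      exact Finset.sum_congr rfl fun a _ => by ring
    rw [e1, eq_div_iff hμ.ne', sub_mul, div_mul_cancel₀ _ hμ.ne', mul_comm, h0]
    ring
  have h1 : |(Λ *ᵥ (G *ᵥ w j)) i| ≤ r * (lb * (τ * √n)) :=
    abs_dotProduct_le hlb.le (d.Λ_le i) fun a => by
      have := d.abs_G_mulVec_le (w j) a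
      rwa [d.sqrt_dotProduct_eigenvector, mul_one] at this
  have h2 : |(Gᵀ *ᵥ (Λᵀ *ᵥ w j)) i| ≤ r * (τ * (lb * √n)) :=
    abs_dotProduct_le hτ (fun a => d.G_le a i) (d.abs_loading_le j)
  have h3 : |(S *ᵥ w j) i| ≤ C := by
    have := abs_dotProduct_mulVec_le (u := Pi.single i 1) (v := w j) d.S_symm d.S_nonneg d.S_le
      (by simp) (by rw [d.ortho, if_pos rfl])
    simpa using this
  have h4 : |(Δ *ᵥ w j) i| ≤ τ * √n := by
    have := d.abs_Δ_mulVec_le (w j) i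
    rwa [d.sqrt_dotProduct_eigenvector, mul_one] at this
  have h5 : |(Λ *ᵥ (G *ᵥ w j)) i + (Gᵀ *ᵥ (Λᵀ *ᵥ w j)) i + (S *ᵥ w j) i + (Δ *ᵥ w j) i| ≤
      (2 * r * lb + 1 + C) * (τ * √n + 1) := by
    refine (abs_add_le _ _).trans ?_
    have := abs_add_three ((Λ *ᵥ (G *ᵥ w j)) i) ((Gᵀ *ᵥ (Λᵀ *ᵥ w j)) i) ((S *ᵥ w j) i)
    have h6 : 0 ≤ C * (τ * √n) := by have := d.one_le_C; positivity
    have h7 : 0 ≤ 2 * r * lb := by positivity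
    linarith
  rw [e, abs_div, abs_of_pos hμ, div_le_iff₀ hμ]
  have hC := d.one_le_C
  calc _ ≤ (2 * r * lb + 1 + C) * (τ * √n + 1) := h5
    _ = 4 * (2 * r * lb + 1 + C) / h * (τ + 1 / √n) / √n * (h / 4 * (√n * √n)) := by
        field_simp
    _ = 4 * (2 * r * lb + 1 + C) / h * (τ + 1 / √n) / √n * (h / 4 * n) := by rw [hn]
    _ ≤ _ := mul_le_mul_of_nonneg_left (d.le_eigenvalue hj) (by positivity)

lemma η_pos (d : FactorDecomp Γ Λ F G S Δ w μ lb C h τ) : 0 < τ + 1 / √(n : ℝ) := by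
  have := d.τ_nonneg
  have := d.sqrt_pos
  positivity

/-- Entries of the leading eigenvectors. -/
lemma abs_eigenvector_le (d : FactorDecomp Γ Λ F G S Δ w μ lb C h τ)
    (hη : 4 * (2 * r * lb + 1 + C) / h * (τ + 1 / √n) ≤ 1) {j : Fin n} (hj : j.val < r)
    (i : Fin n) : |w j i| ≤ (r * lb * (8 * r * lb / h) + 1) / √n := by
  have h1 := d.abs_remainder_le hj i
  have h2 : |∑ a, Λ i a * ((F *ᵥ (Λᵀ *ᵥ w j)) a / μ j)| ≤ r * (lb * (8 * r * lb / h / √n)) :=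
    abs_dotProduct_le d.lb_pos.le (d.Λ_le i) (d.abs_coeff_le hj)
  have h3 := div_le_div_of_nonneg_right hη d.sqrt_pos.le
  have h4 := abs_add_le (w j i - ∑ a, Λ i a * ((F *ᵥ (Λᵀ *ᵥ w j)) a / μ j))
    (∑ a, Λ i a * ((F *ᵥ (Λᵀ *ᵥ w j)) a / μ j))
  rw [sub_add_cancel] at h4
  rw [add_div]
  have e : r * lb * (8 * r * lb / h) / √n = r * (lb * (8 * r * lb / h / √n)) := by ring
  linarith

/-- The leading eigenvectors average out the idiosyncratic components. -/
lemma abs_eigenvector_dotProduct_le (d : FactorDecomp Γ Λ F G S Δ w μ lb C h τ) {j : Fin n}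
    (hj : j.val < r) {e : Fin n → ℝ} {L : ℝ} (he : ∀ i, |e i| ≤ L)
    (hΛe : ∀ a, |(Λᵀ *ᵥ e) a| ≤ L * √n) :
    |w j ⬝ᵥ e| ≤ (8 * r * lb / h * r + 4 * (2 * r * lb + 1 + C) / h) *
      (τ + 1 / √n) * √n * L := by
  have hs := d.sqrt_pos
  have hlb := d.lb_pos
  have hh := d.h_pos
  have hτ := d.τ_nonneg
  have hC := d.one_le_C
  have hL : 0 ≤ L := (abs_nonneg _).trans (he j)
  set α : Fin r → ℝ := fun a => (F *ᵥ (Λᵀ *ᵥ w j)) a / μ j with hα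
  -- The small remainder meets `e` entrywise; the main part meets only `Λᵀe`, where the assumed
  -- `L√n` gains `√n` over the trivial order `nL`.
  have e1 : w j ⬝ᵥ e = (w j - Λ *ᵥ α) ⬝ᵥ e + α ⬝ᵥ (Λᵀ *ᵥ e) := by
    rw [sub_dotProduct, dotProduct_mulVec_eq_transpose Λᵀ α e, Matrix.transpose_transpose]; ring
  have h1 : |(w j - Λ *ᵥ α) ⬝ᵥ e| ≤
      n * (4 * (2 * r * lb + 1 + C) / h * (τ + 1 / √n) / √n * L) :=
    abs_dotProduct_le (by positivity) (fun i => d.abs_remainder_le hj i) he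
  have h2 : |α ⬝ᵥ (Λᵀ *ᵥ e)| ≤ r * (8 * r * lb / h / √n * (L * √n)) :=
    abs_dotProduct_le (by positivity) (d.abs_coeff_le hj) hΛe
  have hn := Real.mul_self_sqrt (Nat.cast_nonneg (α := ℝ) n)
  have e2 : n * (4 * (2 * r * lb + 1 + C) / h * (τ + 1 / √n) / √n * L) =
      4 * (2 * r * lb + 1 + C) / h * (τ + 1 / √n) * √n * L := by
    have hn2 : (n : ℝ) / √n = √n := by rw [div_eq_iff hs.ne', hn]
    calc _ = 4 * (2 * r * lb + 1 + C) / h * (τ + 1 / √n) * (n / √n) * L := by ring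
      _ = _ := by rw [hn2]
  have e3 : r * (8 * r * lb / h / √n * (L * √n)) = 8 * r * lb / h * r * 1 * L := by
    field_simp
  have h3 : 8 * r * lb / h * r * 1 * L ≤ 8 * r * lb / h * r * ((τ + 1 / √n) * √n) * L := by
    have : 1 ≤ (τ + 1 / √n) * √n := by
      rw [add_mul, div_mul_cancel₀ _ hs.ne']
      have : 0 ≤ τ * √n := by positivity
      linarith
    gcongr
  rw [e1]
  refine (abs_add_le _ _).trans ?_
  rw [e2] at h1
  rw [e3] at h2
  linarith

/-- The part of the loadings outside the span of the leading eigenvectors. -/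
lemma sum_loading_sq_le (d : FactorDecomp Γ Λ F G S Δ w μ lb C h τ) (b : Fin r) :
    ∑ j : Fin n with ¬ j.val < r, (Λᵀ *ᵥ w j) b ^ 2 ≤
      (2 * C + 4 * (2 * r * lb + 1)) * (n * (τ + 1 / √n)) := by
  -- The projection of column `b` of `Λ` on the trailing eigenvectors. Both `|v|²` and `(Λᵀv) b`
  -- equal `N`, so `N² ≤ |Λᵀv|²`, which `le_quadForm` and the trailing eigenvalues bound by a
  -- multiple of `N`; one factor `N` cancels.
  set v : Fin n → ℝ := ∑ j : Fin n with ¬ j.val < r, (Λᵀ *ᵥ w j) b • w j with hv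
  set N := ∑ j : Fin n with ¬ j.val < r, (Λᵀ *ᵥ w j) b ^ 2 with hN
  have hwv : ∀ l, w l ⬝ᵥ v = if l.val < r then 0 else (Λᵀ *ᵥ w l) b := fun l => by
    rw [hv, dotProduct_sum]
    simp only [dotProduct_smul, d.ortho, smul_eq_mul, mul_ite, mul_one, mul_zero]
    rw [Finset.sum_ite_eq]
    simp only [Finset.mem_filter, Finset.mem_univ, true_and, ite_not]
  have hvv : v ⬝ᵥ v = N := by
    rw [d.dotProduct_eq, hN, Finset.sum_filter]
    refine Finset.sum_congr rfl fun l _ => ?_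
    rw [hwv]
    split_ifs
    · simp
    · ring
  have hΛv : (Λᵀ *ᵥ v) b = N := by
    rw [hv, Matrix.mulVec_sum, Finset.sum_apply, hN]
    refine Finset.sum_congr rfl fun l _ => ?_
    rw [Matrix.mulVec_smul, Pi.smul_apply, smul_eq_mul, sq]
  have hN0 : 0 ≤ N := Finset.sum_nonneg fun j _ => sq_nonneg _
  have h1 : v ⬝ᵥ Γ *ᵥ v ≤ (C + (2 * r * lb + 1) * τ * n) * N := by
    rw [d.quadForm_eq, ← hvv, d.dotProduct_eq v v, Finset.mul_sum]
    refine Finset.sum_le_sum fun l _ => ?_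
    rw [← sq]
    by_cases hl : l.val < r
    · simp [hwv, hl]
    · exact mul_le_mul_of_nonneg_right (d.eigenvalue_le (not_lt.1 hl)) (sq_nonneg _)
  have h2 := d.le_quadForm v
  have h3 := sq_le_dotProduct_self (Λᵀ *ᵥ v) b
  rw [hΛv] at h3
  rw [hvv] at h2
  have h4 : N * N ≤ (2 * C + 4 * ((2 * r * lb + 1) * τ * n)) * N := by
    rw [← sq]; linarith
  have hs := d.sqrt_pos
  have hlb := d.lb_pos
  have hτ := d.τ_nonneg
  have hC := d.one_le_C
  have h5 : N ≤ 2 * C + 4 * ((2 * r * lb + 1) * τ * n) := by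
    rcases hN0.eq_or_lt with h0 | h0
    · rw [← h0]; positivity
    · exact le_of_mul_le_mul_right h4 h0
  have hn1 : 1 ≤ √(n : ℝ) := Real.one_le_sqrt.2 (by exact_mod_cast d.n_pos)
  have e : n * (τ + 1 / √n) = n * τ + √n := by
    have hn := Real.mul_self_sqrt (Nat.cast_nonneg (α := ℝ) n)
    rw [mul_add]; congr 1
    rw [mul_one_div, div_eq_iff hs.ne', hn]
  rw [e]
  have h6 : 2 * C * 1 ≤ 2 * C * √n := by gcongr
  have h7 : 0 ≤ 2 * C * (n * τ) := by positivity
  have h8 : 0 ≤ 4 * (2 * r * lb + 1) * √n := by positivity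
  linarith

end FactorDecomp

/-! ### Rowwise projection bound and the error of uncapped PCA -/

/-- The constant in the bound for the rows of `(Ŵ Ŵᵀ - I) Λ`. -/
noncomputable def projConst (r : ℕ) (lb C h : ℝ) : ℝ :=
  r * (lb * ((2 * C + 4 * (2 * r * lb + 1) + r * (4 * (2 * r * lb + 1 + C) / h) * lb ^ 2) *
    √r / h)) + r * (4 * (2 * r * lb + 1 + C) / h * lb)

/-- The constant in the bound for the error of the uncapped PCA estimator. -/
noncomputable def errConst (r : ℕ) (lb C h : ℝ) : ℝ :=
  r * projConst r lb C h + r * ((r * lb * (8 * r * lb / h) + 1) *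
    (8 * r * lb / h * r + 4 * (2 * r * lb + 1 + C) / h))

namespace FactorDecomp

variable {n r : ℕ} {Γ : Matrix (Fin n) (Fin n) ℝ} {Λ : Matrix (Fin n) (Fin r) ℝ}
  {F : Matrix (Fin r) (Fin r) ℝ} {G : Matrix (Fin r) (Fin n) ℝ} {S Δ : Matrix (Fin n) (Fin n) ℝ}
  {w : Fin n → Fin n → ℝ} {μ : Fin n → ℝ} {lb C h τ : ℝ}

/-- The rows of `(Ŵ Ŵᵀ - I) Λ` are small, where `Ŵ` consists of the leading eigenvectors. -/
lemma abs_projection_loading_sub_le (d : FactorDecomp Γ Λ F G S Δ w μ lb C h τ) (i : Fin n)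
    (b : Fin r) :
    |∑ j : Fin n with j.val < r, w j i * (Λᵀ *ᵥ w j) b - Λ i b| ≤
      projConst r lb C h * (τ + 1 / √n) := by
  have hs := d.sqrt_pos
  have hlb := d.lb_pos
  have hh := d.h_pos
  have hτ := d.τ_nonneg
  have hC := d.one_le_C
  have hn0 := d.n_pos'
  have hη := d.η_pos
  set η := τ + 1 / √(n : ℝ) with hηdef
  set c₂ := 4 * (2 * r * lb + 1 + C) / h with hc₂
  have hc₂0 : 0 ≤ c₂ := by positivity
  set c₄ := 2 * C + 4 * (2 * r * lb + 1) with hc₄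
  have hc₄0 : 0 ≤ c₄ := by positivity
  set p : Fin n → Fin r → ℝ := fun j => Λᵀ *ᵥ w j with hp
  set α : Fin n → Fin r → ℝ := fun j a => (F *ᵥ p j) a / μ j with hα
  -- `V` is column `b` of `Λ` minus its projection. Its length alone would not give good bounds on
  -- single entries, but replacing each `w j` by `Λ α j` shows `V = -Λq - R` with `R` entrywise
  -- small. Since `q` has only `r` coordinates, bounding its length bounds every row.
  set q : Fin r → ℝ := fun a => ∑ j : Fin n with j.val < r, α j a * p j b - if a = b then 1 else 0
    with hq
  set R : Fin n → ℝ := fun i => ∑ j : Fin n with j.val < r, (w j i - ∑ a, Λ i a * α j a) * p j b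
    with hR
  set V : Fin n → ℝ := fun i => Λ i b - ∑ j : Fin n with j.val < r, w j i * p j b with hV
  have hΛq : ∀ i, (Λ *ᵥ q) i = -V i - R i := fun i => by
    have e1 : (Λ *ᵥ q) i = ∑ j : Fin n with j.val < r, (∑ a, Λ i a * α j a) * p j b - Λ i b := by
      simp only [Matrix.mulVec, dotProduct, hq, mul_sub, Finset.sum_sub_distrib, mul_ite, mul_one,
        mul_zero, Finset.sum_ite_eq', Finset.mem_univ, if_true, Finset.mul_sum, Finset.sum_mul]
      rw [Finset.sum_comm]
      congr 1
      exact Finset.sum_congr rfl fun j _ => Finset.sum_congr rfl fun a _ => by ring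
    rw [e1]
    simp only [hV, hR, sub_mul, Finset.sum_sub_distrib]
    ring
  have hRle : ∀ i, |R i| ≤ r * (c₂ * η * lb) := fun i => by
    refine abs_sum_filter_lt_le (by positivity) fun j hj => ?_
    rw [abs_mul]
    calc _ ≤ c₂ * η / √n * (lb * √n) :=
          mul_le_mul (d.abs_remainder_le hj i) (d.abs_loading_le j b) (abs_nonneg _)
            (by positivity)
      _ = _ := by field_simp
  have hVe : ∀ l, w l ⬝ᵥ V = if l.val < r then 0 else p l b := fun l => by
    have e1 : V = (fun i => Λ i b) - ∑ j : Fin n with j.val < r, p j b • w j := by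
      ext i
      simp only [hV, Pi.sub_apply, Finset.sum_apply, Pi.smul_apply, smul_eq_mul]
      congr 1
      exact Finset.sum_congr rfl fun j _ => mul_comm _ _
    have e2 : w l ⬝ᵥ (fun i => Λ i b) = p l b := dotProduct_comm _ _
    rw [e1, dotProduct_sub, dotProduct_sum, e2]
    simp only [dotProduct_smul, d.ortho, smul_eq_mul, mul_ite, mul_one, mul_zero]
    rw [Finset.sum_ite_eq]
    simp only [Finset.mem_filter, Finset.mem_univ, true_and]
    split_ifs <;> simp
  -- `V` has trailing components only, so this is a sum of products of trailing loadings, which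
  -- `sum_loading_sq_le` controls.
  have hΛV : ∀ a, |(Λᵀ *ᵥ V) a| ≤ c₄ * (n * η) := fun a => by
    have e1 : (Λᵀ *ᵥ V) a = ∑ j : Fin n with ¬ j.val < r, p j a * p j b := by
      have : (Λᵀ *ᵥ V) a = (fun i => Λ i a) ⬝ᵥ V := rfl
      rw [this, d.dotProduct_eq, Finset.sum_filter]
      refine Finset.sum_congr rfl fun l _ => ?_
      have e2 : w l ⬝ᵥ (fun i => Λ i a) = p l a := dotProduct_comm _ _
      rw [hVe, e2]
      split_ifs <;> simp
    have h1 := d.sum_loading_sq_le a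
    have h2 := d.sum_loading_sq_le b
    rw [e1]
    refine (Finset.abs_sum_le_sum_abs _ _).trans ?_
    have h3 : ∀ j : Fin n, |p j a * p j b| ≤ (p j a ^ 2 + p j b ^ 2) / 2 := fun j => by
      rw [abs_le]
      constructor <;> nlinarith [sq_nonneg (p j a - p j b), sq_nonneg (p j a + p j b)]
    refine (Finset.sum_le_sum fun j _ => h3 j).trans ?_
    rw [← Finset.sum_div, Finset.sum_add_distrib]
    linarith
  set c₅ := c₄ + r * c₂ * lb ^ 2 with hc₅
  have hΛΛq : ∀ a, |(Λᵀ *ᵥ (Λ *ᵥ q)) a| ≤ c₅ * (n * η) := fun a => by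
    have e1 : Λ *ᵥ q = -(V + R) := by
      ext i
      rw [hΛq]; simp only [Pi.neg_apply, Pi.add_apply]; ring
    have h1 : |(Λᵀ *ᵥ R) a| ≤ n * (lb * (r * (c₂ * η * lb))) :=
      abs_dotProduct_le hlb.le (fun i => d.Λ_le i a) hRle
    rw [e1, Matrix.mulVec_neg, Matrix.mulVec_add, Pi.neg_apply, abs_neg, Pi.add_apply]
    refine (abs_add_le _ _).trans ((add_le_add (hΛV a) h1).trans_eq ?_)
    rw [hc₅]; ring
  -- Inverts the Gram matrix, of order `n`: `h n |q|² ≤ |Λq|² = (ΛᵀΛq)·q`.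
  have hq2 : √(q ⬝ᵥ q) ≤ c₅ * √r / h * η := by
    have h1 := d.le_gram q
    have h2 : (Λ *ᵥ q) ⬝ᵥ (Λ *ᵥ q) ≤ c₅ * (n * η) * √r * √(q ⬝ᵥ q) := by
      rw [dotProduct_mulVec_eq_transpose]
      exact (le_abs_self _).trans (abs_dotProduct_le_sqrt (by positivity) hΛΛq q)
    have h3 := Real.mul_self_sqrt (dotProduct_self_nonneg' q)
    rcases (Real.sqrt_nonneg (q ⬝ᵥ q)).eq_or_lt with h0 | h0
    · rw [← h0]; positivity
    · refine le_of_mul_le_mul_left ?_ (mul_pos (mul_pos hh hn0) h0)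
      calc h * n * √(q ⬝ᵥ q) * √(q ⬝ᵥ q) = h * n * (√(q ⬝ᵥ q) * √(q ⬝ᵥ q)) := by ring
        _ ≤ c₅ * (n * η) * √r * √(q ⬝ᵥ q) := by rw [h3]; exact h1.trans h2
        _ = _ := by field_simp
  have hfin : |(Λ *ᵥ q) i| ≤ r * (lb * (c₅ * √r / h * η)) :=
    abs_dotProduct_le hlb.le (d.Λ_le i) fun a => (abs_le_sqrt_dotProduct_self q a).trans hq2
  have e : ∑ j : Fin n with j.val < r, w j i * p j b - Λ i b = (Λ *ᵥ q) i + R i := by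
    rw [hΛq]; simp only [hV]; ring
  rw [e]
  refine (abs_add_le _ _).trans ((add_le_add hfin (hRle i)).trans_eq ?_)
  rw [projConst]; ring

/-- Error bound for the PCA estimator without capping. -/
theorem abs_estimator_sub_le (d : FactorDecomp Γ Λ F G S Δ w μ lb C h τ)
    (hη : 4 * (2 * r * lb + 1 + C) / h * (τ + 1 / √n) ≤ 1) {φ : Fin r → ℝ} {e : Fin n → ℝ} {L : ℝ}
    (hφ : ∀ a, |φ a| ≤ L) (he : ∀ i, |e i| ≤ L) (hΛe : ∀ a, |(Λᵀ *ᵥ e) a| ≤ L * √n) (i : Fin n) :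
    |∑ j : Fin n with j.val < r, w j i * (w j ⬝ᵥ (Λ *ᵥ φ + e)) - (Λ *ᵥ φ) i| ≤
      errConst r lb C h * (τ + 1 / √n) * L := by
  have hs := d.sqrt_pos
  have hlb := d.lb_pos
  have hh := d.h_pos
  have hC := d.one_le_C
  have hη0 := d.η_pos
  have hL : 0 ≤ L := (abs_nonneg _).trans (he i)
  have hpc : 0 ≤ projConst r lb C h := by unfold projConst; positivity
  have e1 : ∑ j : Fin n with j.val < r, w j i * (w j ⬝ᵥ (Λ *ᵥ φ + e)) - (Λ *ᵥ φ) i =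
      (fun b => ∑ j : Fin n with j.val < r, w j i * (Λᵀ *ᵥ w j) b - Λ i b) ⬝ᵥ φ +
        ∑ j : Fin n with j.val < r, w j i * (w j ⬝ᵥ e) := by
    have e2 : ∀ j, w j ⬝ᵥ (Λ *ᵥ φ + e) = ∑ b, (Λᵀ *ᵥ w j) b * φ b + w j ⬝ᵥ e := fun j => by
      rw [dotProduct_add, dotProduct_mulVec_eq_transpose]; rfl
    have e3 : (fun b => ∑ j : Fin n with j.val < r, w j i * (Λᵀ *ᵥ w j) b - Λ i b) ⬝ᵥ φ =
        ∑ j : Fin n with j.val < r, w j i * ∑ b, (Λᵀ *ᵥ w j) b * φ b - (Λ *ᵥ φ) i := by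
      simp only [dotProduct, sub_mul, Finset.sum_sub_distrib, Finset.sum_mul]
      rw [Finset.sum_comm]
      congr 1
      refine Finset.sum_congr rfl fun j _ => ?_
      rw [Finset.mul_sum]
      exact Finset.sum_congr rfl fun b _ => mul_assoc _ _ _
    rw [e3]
    simp only [e2, mul_add, Finset.sum_add_distrib]
    ring
  have h1 : |(fun b => ∑ j : Fin n with j.val < r, w j i * (Λᵀ *ᵥ w j) b - Λ i b) ⬝ᵥ φ| ≤
      r * (projConst r lb C h * (τ + 1 / √n) * L) :=
    abs_dotProduct_le (by positivity) (d.abs_projection_loading_sub_le i) hφ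
  have h2 : |∑ j : Fin n with j.val < r, w j i * (w j ⬝ᵥ e)| ≤
      r * ((r * lb * (8 * r * lb / h) + 1) / √n *
        ((8 * r * lb / h * r + 4 * (2 * r * lb + 1 + C) / h) * (τ + 1 / √n) * √n * L)) := by
    refine abs_sum_filter_lt_le (by positivity) fun j hj => ?_
    rw [abs_mul]
    exact mul_le_mul (d.abs_eigenvector_le hη hj i) (d.abs_eigenvector_dotProduct_le hj he hΛe)
      (abs_nonneg _) (by positivity)
  have e3 : (r * lb * (8 * r * lb / h) + 1) / √n *
        ((8 * r * lb / h * r + 4 * (2 * r * lb + 1 + C) / h) * (τ + 1 / √n) * √n * L) =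
      (r * lb * (8 * r * lb / h) + 1) *
        (8 * r * lb / h * r + 4 * (2 * r * lb + 1 + C) / h) * (τ + 1 / √n) * L := by
    generalize τ + 1 / √(n : ℝ) = η
    field_simp
  rw [e3] at h2
  rw [e1]
  refine (abs_add_le _ _).trans ((add_le_add h1 h2).trans_eq ?_)
  rw [errConst]; ring

end FactorDecomp

/-- The form attains a positive minimum on the unit sphere of the sup norm, and `u·u ≤ r‖u‖²`. For
`r = 0` that sphere is empty and any constant works. -/
lemma exists_le_quadForm_of_posDef {r : ℕ} {H : Matrix (Fin r) (Fin r) ℝ} (hH : H.PosDef) :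
    ∃ h : ℝ, 0 < h ∧ ∀ u, h * (u ⬝ᵥ u) ≤ u ⬝ᵥ H *ᵥ u := by
  have hpos : ∀ u : Fin r → ℝ, u ≠ 0 → 0 < u ⬝ᵥ H *ᵥ u := fun u hu => by
    simpa using hH.dotProduct_mulVec_pos hu
  rcases (Metric.sphere (0 : Fin r → ℝ) 1).eq_empty_or_nonempty with h0 | h0
  · refine ⟨1, one_pos, fun u => ?_⟩
    have hu : u = 0 := by
      by_contra hu
      have : (‖u‖⁻¹ • u) ∈ Metric.sphere (0 : Fin r → ℝ) 1 := by
        simp [norm_smul, inv_mul_cancel₀ (norm_ne_zero_iff.2 hu)]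
      rw [h0] at this
      exact this
    simp [hu]
  · have hcont : Continuous fun u : Fin r → ℝ => u ⬝ᵥ H *ᵥ u :=
      continuous_id.dotProduct (continuous_const.matrix_mulVec continuous_id)
    obtain ⟨u₀, hu₀, hmin⟩ := (isCompact_sphere (0 : Fin r → ℝ) 1).exists_isMinOn h0
      hcont.continuousOn
    have hu₀0 : u₀ ≠ 0 := by
      rintro rfl
      simp at hu₀
    have hm := hpos u₀ hu₀0
    set m := u₀ ⬝ᵥ H *ᵥ u₀
    refine ⟨m / (r + 1), by positivity, fun u => ?_⟩
    by_cases hu : u = 0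
    · simp [hu]
    have hN : 0 < ‖u‖ := norm_pos_iff.2 hu
    have h1 : m ≤ (‖u‖⁻¹ • u) ⬝ᵥ H *ᵥ (‖u‖⁻¹ • u) :=
      hmin (by simp [norm_smul, inv_mul_cancel₀ hN.ne'])
    rw [Matrix.mulVec_smul, dotProduct_smul, smul_dotProduct, smul_eq_mul, smul_eq_mul] at h1
    have h2 : m * ‖u‖ ^ 2 ≤ u ⬝ᵥ H *ᵥ u := by
      have := mul_le_mul_of_nonneg_right h1 (sq_nonneg ‖u‖)
      refine this.trans_eq ?_
      field_simp
    have h3 : u ⬝ᵥ u ≤ r * ‖u‖ ^ 2 := dotProduct_self_le fun i => norm_le_pi_norm u i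
    calc m / (r + 1) * (u ⬝ᵥ u) ≤ m / (r + 1) * ((r + 1) * ‖u‖ ^ 2) := by
          refine mul_le_mul_of_nonneg_left (h3.trans ?_) (by positivity)
          nlinarith [sq_nonneg ‖u‖]
      _ = m * ‖u‖ ^ 2 := by field_simp
      _ ≤ _ := h2

lemma abs_cap_le {c : ℝ} (hc : 0 ≤ c) (x : ℝ) : |cap c x| ≤ c := by
  unfold cap
  split_ifs with h
  · exact h
  · rw [abs_mul, abs_of_nonneg hc]
    refine mul_le_of_le_one_left hc ?_
    rcases lt_trichotomy x 0 with hx | hx | hx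
    · simp [Real.sign_of_neg hx]
    · simp [hx]
    · simp [Real.sign_of_pos hx]

/-! ### From the controlled event to the decomposition -/

namespace Model

variable {r : ℕ} {Ω : ℕ → Type u} [∀ T, MeasurableSpace (Ω T)] (M : Model r Ω)

lemma integral_f_mul_ε (hI : M.FactorIdioIndep) {T t : ℕ} (ht : t ∈ Finset.Icc 1 T) (j : Fin r)
    (i : Fin (M.n T)) : ∫ ω, M.f T t j ω * M.ε T t i ω ∂M.P T = 0 := by
  have h : IndepFun (M.f T t j) (M.ε T t i) (M.P T) :=
    (hI T).comp (φ := fun g : Finset.Icc 1 T × Fin r → ℝ => g (⟨t, ht⟩, j))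
      (ψ := fun g : Finset.Icc 1 T × Fin (M.n T) → ℝ => g (⟨t, ht⟩, i))
      (measurable_pi_apply _) (measurable_pi_apply _)
  rw [h.integral_fun_mul_eq_mul_integral (M.f_meas T t ht j).aestronglyMeasurable
    (M.ε_meas T t ht i).aestronglyMeasurable, (M.f_mean T t ht j).2, zero_mul]

/-- Once all entries of `n⁻¹ΛᵀΛ - H` are below `h / (2(r + 1))`, the form moves by at most `h/2`
times `u·u`, which costs half of `h`. -/
lemma eventually_le_gram {H : Matrix (Fin r) (Fin r) ℝ} {h : ℝ} (hh : 0 < h)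
    (hH : ∀ u, h * (u ⬝ᵥ u) ≤ u ⬝ᵥ H *ᵥ u)
    (hΛ : Tendsto (fun T => (M.n T : ℝ)⁻¹ • ((M.Λ T)ᵀ * M.Λ T)) atTop (𝓝 H))
    (hn : Tendsto M.n atTop atTop) :
    ∀ᶠ T in atTop, ∀ u, h / 2 * M.n T * (u ⬝ᵥ u) ≤ (M.Λ T *ᵥ u) ⬝ᵥ (M.Λ T *ᵥ u) := by
  have hentry : ∀ a b, ∀ᶠ T in atTop,
      |((M.n T : ℝ)⁻¹ • ((M.Λ T)ᵀ * M.Λ T) - H) a b| < h / (2 * (r + 1)) := fun a b => by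
    have h1 : Tendsto (fun T => ((M.n T : ℝ)⁻¹ • ((M.Λ T)ᵀ * M.Λ T)) a b) atTop (𝓝 (H a b)) :=
      ((continuous_id.matrix_elem a b).tendsto H).comp hΛ
    have h2 := (tendsto_order.1 (h1.sub_const (H a b)).abs).2 (h / (2 * (r + 1)))
      (by rw [sub_self, abs_zero]; positivity)
    exact h2
  filter_upwards [eventually_all.2 fun a => eventually_all.2 fun b => hentry a b,
    hn.eventually_ge_atTop 1] with T hT hn1 u
  have hn0 : (0 : ℝ) < M.n T := by exact_mod_cast hn1
  set E := (M.n T : ℝ)⁻¹ • ((M.Λ T)ᵀ * M.Λ T) - H with hE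
  have hEu : ∀ a, |(E *ᵥ u) a| ≤ h / (2 * (r + 1)) * √r * √(u ⬝ᵥ u) := fun a =>
    abs_dotProduct_le_sqrt (by positivity) (fun b => (hT a b).le) u
  have h1 : |(E *ᵥ u) ⬝ᵥ u| ≤ h / 2 * (u ⬝ᵥ u) := by
    refine (abs_dotProduct_le_sqrt (by positivity) hEu u).trans ?_
    have e1 := Real.mul_self_sqrt (dotProduct_self_nonneg' u)
    have e2 := Real.mul_self_sqrt (Nat.cast_nonneg (α := ℝ) r)
    have h0 := dotProduct_self_nonneg' u
    calc _ = h / (2 * (r + 1)) * (√r * √r) * (√(u ⬝ᵥ u) * √(u ⬝ᵥ u)) := by ring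
      _ = h / (2 * (r + 1)) * r * (u ⬝ᵥ u) := by rw [e1, e2]
      _ ≤ h / (2 * (r + 1)) * (r + 1) * (u ⬝ᵥ u) := by gcongr; linarith
      _ = _ := by field_simp
  have e : (M.Λ T *ᵥ u) ⬝ᵥ (M.Λ T *ᵥ u) = M.n T * (u ⬝ᵥ H *ᵥ u + (E *ᵥ u) ⬝ᵥ u) := by
    rw [hE, Matrix.sub_mulVec, sub_dotProduct, Matrix.smul_mulVec, smul_dotProduct, smul_eq_mul,
      dotProduct_comm (H *ᵥ u), FactorDecomp.dotProduct_mulVec_eq_transpose (M.Λ T),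
      Matrix.mulVec_mulVec]
    field_simp
    ring
  have h2 := hH u
  have h3 := (abs_le.1 h1).1
  rw [e]
  calc h / 2 * M.n T * (u ⬝ᵥ u) = M.n T * (h / 2 * (u ⬝ᵥ u)) := by ring
    _ ≤ _ := mul_le_mul_of_nonneg_left (by linarith) hn0.le

/-- Normalised partial sum of a process over the times `s, …, e`. -/
noncomputable def partialSum {T : ℕ} {ι : Type*} (X : ℕ → ι → Ω T → ℝ) (s e : ℕ) (ω : Ω T)
    (i : ι) : ℝ :=
  (√((e - s + 1 : ℕ) : ℝ))⁻¹ * ∑ t ∈ Finset.Icc s e, X t i ω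

lemma sqrt_length_pos (s e : ℕ) : 0 < √((e - s + 1 : ℕ) : ℝ) :=
  Real.sqrt_pos.2 (by exact_mod_cast Nat.succ_pos _)

section Controlled

variable {M} {T : ℕ} {L : ℝ} {ω : Ω T}

/-- Pairing with the constant process `none` turns control of products into control of plain sums.
-/
lemma Controlled.abs_partialSum_base_le (hc : M.Controlled T L ω)
    {v : Option (Fin r ⊕ Fin (M.n T) ⊕ Fin r)} (hv : ∀ t ∈ Finset.Icc 1 T,
      ∫ ω, M.base T t v ω ∂M.P T = 0) {s e : ℕ} (hs : 1 ≤ s) (hse : s ≤ e) (he : e ≤ T) :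
    |(√((e - s + 1 : ℕ) : ℝ))⁻¹ * ∑ t ∈ Finset.Icc s e, M.base T t v ω| ≤ L := by
  have h := hc v none s e hs hse he
  have e1 : ∑ t ∈ Finset.Icc s e, (M.base T t v ω * M.base T t none ω
      - ∫ ω', M.base T t v ω' * M.base T t none ω' ∂M.P T) =
        ∑ t ∈ Finset.Icc s e, M.base T t v ω := by
    refine Finset.sum_congr rfl fun t ht => ?_
    rw [Finset.mem_Icc] at ht
    have := hv t (Finset.mem_Icc.2 ⟨by omega, by omega⟩)
    simp only [base, mul_one] at this ⊢
    rw [this, sub_zero]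
  rw [e1] at h
  have hp := sqrt_length_pos s e
  rw [abs_mul, abs_of_pos (inv_pos.2 hp), inv_mul_le_iff₀ hp]
  linarith

lemma Controlled.abs_partialSum_f_le (hc : M.Controlled T L ω) {s e : ℕ} (hs : 1 ≤ s)
    (hse : s ≤ e) (he : e ≤ T) (a : Fin r) : |partialSum (M.f T) s e ω a| ≤ L :=
  hc.abs_partialSum_base_le (v := some (Sum.inl a)) (fun t ht => (M.f_mean T t ht a).2) hs hse he

lemma Controlled.abs_partialSum_ε_le (hc : M.Controlled T L ω) {s e : ℕ} (hs : 1 ≤ s)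
    (hse : s ≤ e) (he : e ≤ T) (i : Fin (M.n T)) : |partialSum (M.ε T) s e ω i| ≤ L :=
  hc.abs_partialSum_base_le (v := some (Sum.inr (Sum.inl i))) (fun t ht => (M.ε_mean T t ht i).2)
    hs hse he

lemma Controlled.abs_transpose_mulVec_partialSum_ε_le (hc : M.Controlled T L ω) (hn : 0 < M.n T)
    {s e : ℕ} (hs : 1 ≤ s) (hse : s ≤ e) (he : e ≤ T) (a : Fin r) :
    |((M.Λ T)ᵀ *ᵥ partialSum (M.ε T) s e ω) a| ≤ L * √(M.n T) := by
  have h := hc.abs_partialSum_base_le (v := some (Sum.inr (Sum.inr a)))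
    (fun t ht => M.integral_linearCombination_eq_zero ht _) hs hse he
  have hn0 : 0 < √(M.n T : ℝ) := Real.sqrt_pos.2 (by exact_mod_cast hn)
  have e1 : (√((e - s + 1 : ℕ) : ℝ))⁻¹ *
      ∑ t ∈ Finset.Icc s e, M.base T t (some (Sum.inr (Sum.inr a))) ω =
        (√(M.n T : ℝ))⁻¹ * ((M.Λ T)ᵀ *ᵥ partialSum (M.ε T) s e ω) a := by
    simp only [base, partialSum, Matrix.mulVec, dotProduct, Matrix.transpose_apply]
    rw [Finset.sum_comm, Finset.mul_sum, Finset.mul_sum]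
    refine Finset.sum_congr rfl fun i _ => ?_
    rw [← Finset.mul_sum]; ring
  rw [e1, abs_mul, abs_of_pos (inv_pos.2 hn0), inv_mul_le_iff₀ hn0] at h
  linarith

/-- Control on the full interval, divided by `T`; this is where `τ = L/√T` comes from. -/
lemma Controlled.abs_average_le (hc : M.Controlled T L ω) (hT : 1 ≤ T)
    (u v : Option (Fin r ⊕ Fin (M.n T) ⊕ Fin r)) :
    |(T : ℝ)⁻¹ * ∑ t ∈ Finset.Icc 1 T, (M.base T t u ω * M.base T t v ω
      - ∫ ω', M.base T t u ω' * M.base T t v ω' ∂M.P T)| ≤ L / √T := by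
  have h := hc u v 1 T le_rfl hT le_rfl
  rw [Nat.sub_add_cancel hT] at h
  have hT0 : (0 : ℝ) < T := by exact_mod_cast hT
  have hs := Real.sqrt_pos.2 hT0
  rw [abs_mul, abs_of_pos (inv_pos.2 hT0), inv_mul_le_iff₀ hT0]
  refine h.trans_eq ?_
  have := Real.mul_self_sqrt hT0.le
  field_simp
  rw [sq, this]

/-- On the controlled event, the sample covariance matrix is close to `Λ Λᵀ`. -/
lemma Controlled.factorDecomp (hc : M.Controlled T L ω) (hT : 1 ≤ T) (hn : 0 < M.n T)
    {βf lbar C h : ℝ} (hF : M.FactorMoments βf) (hI : M.FactorIdioIndep) (hW : M.WeakIdiosyncrasy)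
    (hΛ : ∀ T i j, |M.Λ T i j| < lbar) (hC1 : 1 ≤ C)
    (hC : ∀ T, ∀ t ∈ Finset.Icc 1 T, ∀ a : Fin (M.n T) → ℝ,
      ∫ ω, (∑ i, a i * M.ε T t i ω) ^ 2 ∂M.P T ≤ C * ∑ i, a i ^ 2)
    (hh : 0 < h) (hg : ∀ u, h * M.n T * (u ⬝ᵥ u) ≤ (M.Λ T *ᵥ u) ⬝ᵥ (M.Λ T *ᵥ u))
    (hL : 0 ≤ L) (hτ1 : L / √T ≤ 1) (hτ2 : r * (L / √T) ≤ 1 / 2)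
    (hτ3 : (2 * r * (1 + |lbar|) + 1) * (L / √T) ≤ h / 4)
    {w : Fin (M.n T) → Fin (M.n T) → ℝ} (hw : IsOrderedEigenbasis (M.sampleCov T ω) w) :
    ∃ F G S Δ μ, FactorDecomp (M.sampleCov T ω) (M.Λ T) F G S Δ w μ (1 + |lbar|) C h (L / √T) := by
  obtain ⟨μ, hanti, heig, horth⟩ := hw
  have hT0 : (0 : ℝ) < T := by exact_mod_cast hT
  set F : Matrix (Fin r) (Fin r) ℝ := Matrix.of fun a b =>
    (T : ℝ)⁻¹ * ∑ t ∈ Finset.Icc 1 T, M.f T t a ω * M.f T t b ω with hFdef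
  set G : Matrix (Fin r) (Fin (M.n T)) ℝ := Matrix.of fun a i =>
    (T : ℝ)⁻¹ * ∑ t ∈ Finset.Icc 1 T, M.f T t a ω * M.ε T t i ω with hGdef
  set S : Matrix (Fin (M.n T)) (Fin (M.n T)) ℝ := Matrix.of fun i l =>
    (T : ℝ)⁻¹ * ∑ t ∈ Finset.Icc 1 T, ∫ ω, M.ε T t i ω * M.ε T t l ω ∂M.P T with hSdef
  set Δ : Matrix (Fin (M.n T)) (Fin (M.n T)) ℝ := Matrix.of fun i l =>
    (T : ℝ)⁻¹ * ∑ t ∈ Finset.Icc 1 T, (M.ε T t i ω * M.ε T t l ω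
      - ∫ ω, M.ε T t i ω * M.ε T t l ω ∂M.P T) with hΔdef
  -- The form of `S` is a time average of variances, so positivity and the bound `C` both follow.
  have hS : ∀ v : Fin (M.n T) → ℝ, v ⬝ᵥ S *ᵥ v =
      (T : ℝ)⁻¹ * ∑ t ∈ Finset.Icc 1 T, ∫ ω, (∑ i, v i * M.ε T t i ω) ^ 2 ∂M.P T := fun v => by
    rw [Finset.sum_congr rfl fun t ht => M.integral_linearCombination_sq hW ht v, Finset.sum_comm,
      Finset.mul_sum]
    refine Finset.sum_congr rfl fun i _ => ?_
    rw [Finset.sum_comm, Finset.mul_sum, Matrix.mulVec, dotProduct, Finset.mul_sum]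
    refine Finset.sum_congr rfl fun l _ => ?_
    rw [← Finset.mul_sum, hSdef, Matrix.of_apply]
    ring
  refine ⟨F, G, S, Δ, μ, ?_⟩
  refine
    { eq := ?_
      anti := hanti
      eigen := heig
      ortho := horth
      n_pos := hn
      one_le_lb := by linarith [abs_nonneg lbar]
      one_le_C := hC1
      h_pos := hh
      τ_nonneg := by positivity
      τ_le_one := hτ1
      rτ_le := hτ2
      Dτ_le := hτ3
      Λ_le := fun i a => (hΛ T i a).le.trans (by linarith [le_abs_self lbar])
      F_le := ?_
      G_le := ?_
      Δ_le := fun i l => hc.abs_average_le hT (some (Sum.inr (Sum.inl i)))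
        (some (Sum.inr (Sum.inl l)))
      S_symm := ?_
      S_nonneg := ?_
      S_le := ?_
      le_gram := hg }
  · have hA : ∀ i l, (M.Λ T * F * (M.Λ T)ᵀ) i l =
        (T : ℝ)⁻¹ * ∑ t ∈ Finset.Icc 1 T, M.χ T t i ω * M.χ T t l ω := fun i l => by
      simp only [Matrix.mul_apply, Matrix.transpose_apply, hFdef, Matrix.of_apply, χ,
        Finset.sum_mul, Finset.mul_sum]
      rw [Finset.sum_comm]
      conv_lhs => enter [2, a]; rw [Finset.sum_comm]
      rw [Finset.sum_comm]
      refine Finset.sum_congr rfl fun t _ => ?_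
      rw [Finset.sum_comm]
      exact Finset.sum_congr rfl fun a _ => Finset.sum_congr rfl fun b _ => by ring
    have hB : ∀ i l, (M.Λ T * G) i l =
        (T : ℝ)⁻¹ * ∑ t ∈ Finset.Icc 1 T, M.χ T t i ω * M.ε T t l ω := fun i l => by
      simp only [Matrix.mul_apply, hGdef, Matrix.of_apply, χ, Finset.sum_mul, Finset.mul_sum]
      rw [Finset.sum_comm]
      exact Finset.sum_congr rfl fun a _ => Finset.sum_congr rfl fun b _ => by ring
    ext i l
    have hB' : (Gᵀ * (M.Λ T)ᵀ) i l =
        (T : ℝ)⁻¹ * ∑ t ∈ Finset.Icc 1 T, M.χ T t l ω * M.ε T t i ω := by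
      rw [← Matrix.transpose_mul, Matrix.transpose_apply, hB]
    rw [Matrix.add_apply, Matrix.add_apply, Matrix.add_apply, Matrix.add_apply, hA, hB, hB']
    simp only [hSdef, hΔdef, Matrix.of_apply, sampleCov, x]
    rw [← mul_add, ← mul_add, ← mul_add, ← mul_add, ← Finset.sum_add_distrib,
      ← Finset.sum_add_distrib, ← Finset.sum_add_distrib, ← Finset.sum_add_distrib]
    congr 1
    exact Finset.sum_congr rfl fun t _ => by ring
  · intro a b
    have h1 := hc.abs_average_le hT (some (Sum.inl a)) (some (Sum.inl b))
    simp only [base, Finset.sum_sub_distrib, mul_sub] at h1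
    rwa [hF.1 T hT a b] at h1
  · intro a i
    have h1 := hc.abs_average_le hT (some (Sum.inl a)) (some (Sum.inr (Sum.inl i)))
    simp only [base] at h1
    rwa [Finset.sum_congr rfl fun t ht => by rw [M.integral_f_mul_ε hI ht a i, sub_zero]] at h1
  · ext i l
    simp only [hSdef, Matrix.transpose_apply, Matrix.of_apply, mul_comm]
  · intro v
    rw [hS]
    exact mul_nonneg (by positivity)
      (Finset.sum_nonneg fun t _ => integral_nonneg fun ω => sq_nonneg _)
  · intro v
    rw [hS, inv_mul_le_iff₀ hT0]
    refine (Finset.sum_le_card_nsmul _ _ _ fun t ht => hC T t ht v).trans_eq ?_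
    simp [dotProduct, sq]

end Controlled

end Model

/-! ### Bounds for the maximal error on the controlled event -/

namespace Model

variable {r : ℕ} {Ω : ℕ → Type u} [∀ T, MeasurableSpace (Ω T)] (M : Model r Ω)

lemma partialSum_χ (T s e : ℕ) (ω : Ω T) (i : Fin (M.n T)) :
    partialSum (M.χ T) s e ω i = (M.Λ T *ᵥ partialSum (M.f T) s e ω) i := by
  simp only [partialSum, χ, Matrix.mulVec, dotProduct]
  rw [Finset.sum_comm, Finset.mul_sum]
  refine Finset.sum_congr rfl fun a _ => ?_
  rw [← Finset.mul_sum]; ring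

lemma partialSum_x (T s e : ℕ) (ω : Ω T) (i : Fin (M.n T)) :
    partialSum (M.x T) s e ω i =
      (M.Λ T *ᵥ partialSum (M.f T) s e ω + partialSum (M.ε T) s e ω) i := by
  rw [Pi.add_apply, ← partialSum_χ]
  simp only [partialSum, x, Finset.sum_add_distrib, mul_add]

/-- The weights do not depend on time, so summing over a segment commutes with the estimator; the
error becomes that of one linear map applied to normalised partial sums. -/
lemma normalized_error_eq (w : ∀ T, Ω T → Fin (M.n T) → Fin (M.n T) → ℝ) (cw : ℝ) (k T s e : ℕ)
    (ω : Ω T) (i : Fin (M.n T)) :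
    1 / √((e - s + 1 : ℕ) : ℝ) *
        |∑ t ∈ Finset.Icc s e, (M.cappedEst w cw k T t i ω - M.χ T t i ω)| =
      |∑ j with j.val < k, cap (cw / √(M.n T)) (w T ω j i) *
        ((fun l => cap (cw / √(M.n T)) (w T ω j l)) ⬝ᵥ
          (M.Λ T *ᵥ partialSum (M.f T) s e ω + partialSum (M.ε T) s e ω))
        - (M.Λ T *ᵥ partialSum (M.f T) s e ω) i| := by
  have hp := sqrt_length_pos s e
  rw [one_div]
  conv_lhs => rw [← abs_of_pos (inv_pos.2 hp), ← abs_mul]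
  rw [Finset.sum_sub_distrib, mul_sub]
  congr 2
  · simp only [cappedEst, dotProduct, ← partialSum_x]
    rw [Finset.sum_comm, Finset.mul_sum]
    refine Finset.sum_congr rfl fun j _ => ?_
    rw [← Finset.mul_sum, Finset.sum_comm, Finset.mul_sum, Finset.mul_sum, Finset.mul_sum]
    refine Finset.sum_congr rfl fun l _ => ?_
    rw [partialSum, ← Finset.mul_sum]; ring
  · rw [← partialSum_χ]; rfl

lemma maxErr_nonneg (w : ∀ T, Ω T → Fin (M.n T) → Fin (M.n T) → ℝ) (cw : ℝ) (k T : ℕ)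
    (ω : Ω T) : 0 ≤ M.maxErr w cw k T ω := by
  refine Real.sSup_nonneg ?_
  rintro y ⟨i, s, e, -, -, -, rfl⟩
  positivity

/-- Error bound with the correct number of factors. -/
lemma Controlled.maxErr_le {M : Model r Ω} {T : ℕ} {L : ℝ} {ω : Ω T} (hc : M.Controlled T L ω)
    {w : ∀ T, Ω T → Fin (M.n T) → Fin (M.n T) → ℝ} {F G S Δ μ} {lb C h τ cw : ℝ}
    (d : FactorDecomp (M.sampleCov T ω) (M.Λ T) F G S Δ (w T ω) μ lb C h τ)
    (hη : 4 * (2 * r * lb + 1 + C) / h * (τ + 1 / √(M.n T)) ≤ 1)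
    (hcw : r * lb * (8 * r * lb / h) + 1 ≤ cw) (hL : 0 ≤ L) :
    M.maxErr w cw r T ω ≤ errConst r lb C h * (τ + 1 / √(M.n T)) * L := by
  have hη0 := d.η_pos
  have herr : 0 ≤ errConst r lb C h := by
    have := d.lb_pos
    have := d.h_pos
    have := d.one_le_C
    unfold errConst projConst
    positivity
  refine Real.sSup_le ?_ (by positivity)
  rintro y ⟨i, s, e, hs, hse, he, rfl⟩
  rw [M.normalized_error_eq]
  have hcap : ∀ j : Fin (M.n T), j.val < r → ∀ l, cap (cw / √(M.n T)) (w T ω j l) = w T ω j l :=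
    fun j hj l => if_pos ((d.abs_eigenvector_le hη hj l).trans
      (div_le_div_of_nonneg_right hcw d.sqrt_pos.le))
  have hsum : ∀ v : Fin (M.n T) → ℝ, ∑ j : Fin (M.n T) with j.val < r,
      cap (cw / √(M.n T)) (w T ω j i) * ((fun l => cap (cw / √(M.n T)) (w T ω j l)) ⬝ᵥ v) =
        ∑ j : Fin (M.n T) with j.val < r, w T ω j i * (w T ω j ⬝ᵥ v) := fun v => by
    refine Finset.sum_congr rfl fun j hj => ?_
    have hj' : j.val < r := by simpa using hj
    rw [hcap j hj', show (fun l => cap (cw / √(M.n T)) (w T ω j l)) = w T ω j from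
      funext fun l => hcap j hj' l]
  rw [hsum]
  exact d.abs_estimator_sub_le hη (hc.abs_partialSum_f_le hs hse.le he)
    (hc.abs_partialSum_ε_le hs hse.le he)
    (hc.abs_transpose_mulVec_partialSum_ε_le d.n_pos hs hse.le he) i

/-- Error bound with any number of factors. -/
lemma Controlled.maxErr_le_of_cap {M : Model r Ω} {T : ℕ} {L : ℝ} {ω : Ω T}
    (hc : M.Controlled T L ω) (w : ∀ T, Ω T → Fin (M.n T) → Fin (M.n T) → ℝ) {lb cw : ℝ} (k : ℕ)
    (hcw : 0 ≤ cw) (hlb : 0 ≤ lb) (hΛ : ∀ i a, |M.Λ T i a| ≤ lb) (hL : 0 ≤ L) :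
    M.maxErr w cw k T ω ≤ (k * cw ^ 2 * (r * lb + 1) + r * lb) * L := by
  refine Real.sSup_le ?_ (by positivity)
  rintro y ⟨i, s, e, hs, hse, he, rfl⟩
  have hn : (0 : ℝ) < M.n T := by exact_mod_cast Fin.pos i
  have hsn := Real.sqrt_pos.2 hn
  have hχ : ∀ l, |(M.Λ T *ᵥ partialSum (M.f T) s e ω) l| ≤ r * (lb * L) := fun l =>
    abs_dotProduct_le hlb (hΛ l) (hc.abs_partialSum_f_le hs hse.le he)
  have hx : ∀ l, |(M.Λ T *ᵥ partialSum (M.f T) s e ω + partialSum (M.ε T) s e ω) l| ≤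
      (r * lb + 1) * L := fun l => by
    refine (abs_add_le _ _).trans ((add_le_add (hχ l)
      (hc.abs_partialSum_ε_le hs hse.le he l)).trans_eq (by ring))
  rw [M.normalized_error_eq]
  refine (abs_sub _ _).trans ?_
  have hcn : 0 ≤ cw / √(M.n T : ℝ) := by positivity
  have h1 : |∑ j : Fin (M.n T) with j.val < k, cap (cw / √(M.n T)) (w T ω j i) *
        ((fun l => cap (cw / √(M.n T)) (w T ω j l)) ⬝ᵥ
          (M.Λ T *ᵥ partialSum (M.f T) s e ω + partialSum (M.ε T) s e ω))| ≤
      k * (cw / √(M.n T) * (M.n T * (cw / √(M.n T) * ((r * lb + 1) * L)))) := by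
    refine abs_sum_filter_lt_le (by positivity) fun j _ => ?_
    rw [abs_mul]
    exact mul_le_mul (abs_cap_le hcn _) (abs_dotProduct_le hcn (fun l => abs_cap_le hcn _) hx)
      (abs_nonneg _) hcn
  -- Two capped weights give `cw² / n`, cancelling the `n` summands of the inner product.
  have e1 : (k : ℝ) * (cw / √(M.n T) * (M.n T * (cw / √(M.n T) * ((r * lb + 1) * L)))) =
      k * cw ^ 2 * (r * lb + 1) * L := by
    have := Real.mul_self_sqrt hn.le
    calc _ = k * cw ^ 2 * (r * lb + 1) * L * (M.n T / (√(M.n T) * √(M.n T))) := by field_simp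
      _ = _ := by rw [this, div_self hn.ne', mul_one]
  rw [e1] at h1
  have := hχ i
  linarith

end Model

/-! ### Asymptotics and the theorem -/

lemma tendsto_log_rpow_div_sqrt (C a : ℝ) :
    Tendsto (fun T : ℕ => C * Real.log T ^ a / √T) atTop (𝓝 0) := by
  have h1 : (fun x : ℝ => Real.log x ^ a) =o[atTop] fun x : ℝ => x ^ (1 / 2 : ℝ) :=
    isLittleO_log_rpow_rpow_atTop a (by norm_num)
  have h2 := ((h1.const_mul_left C).comp_tendsto tendsto_natCast_atTop_atTop).tendsto_div_nhds_zero
  refine h2.congr fun T => ?_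
  simp [Function.comp, Real.sqrt_eq_rpow]

end PSFactor

theorem theorem2 (βf β : ℝ) (hβf : 0 < βf) (hβ : 0 < β) (hββ : 1 < 3 * βf⁻¹ + β⁻¹) :
    ∃ θ : ℝ, 1 + max βf⁻¹ (1 / 2) ≤ θ ∧
    ∀ (r : ℕ) (H : Matrix (Fin r) (Fin r) ℝ) (lbar : ℝ),
    ∃ c₀ : ℝ, 0 < c₀ ∧
    ∀ (Ω : ℕ → Type*) [∀ T, MeasurableSpace (Ω T)] (M : PSFactor.Model r Ω),
      M.PiecewiseStationaryCommon → M.PiecewiseStationaryIdio →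
      M.FactorMoments βf → M.PervasiveLoadings H lbar → M.WeakIdiosyncrasy →
      M.FactorIdioIndep → M.StrongMixing β → M.SpacedChangePoints → M.DimensionGrowth →
      ∀ w, M.IsPCA w →
        (∀ cw : ℝ, c₀ ≤ cw →
          PSFactor.IsBigOp M.P (fun T ω => M.maxErr w cw r T ω)
            (fun T => max (√(Real.log (M.n T) / T)) (1 / √(M.n T)) * Real.log T ^ θ)) ∧
        (∀ cw : ℝ, 0 < cw → ∀ k : ℕ, r < k →
          PSFactor.IsBigOp M.P (fun T ω => M.maxErr w cw k T ω)
            (fun T => Real.log T ^ θ)) := by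
  set θ₀ : ℝ := β⁻¹ + (min βf 2 / 2)⁻¹ + 1 / 2 with hθ₀
  have hθ₀0 : 0 < θ₀ := by
    have : 0 < min βf 2 := lt_min hβf two_pos
    positivity
  -- The error `(L/√T + 1/√n) L` is quadratic in `L` in its first part, hence `2θ₀`. The other entry
  -- secures the prescribed lower bound on `θ`.
  refine ⟨max (1 + max βf⁻¹ (1 / 2)) (2 * θ₀), le_max_left _ _, fun r H lbar => ?_⟩
  set θ := max (1 + max βf⁻¹ (1 / 2)) (2 * θ₀) with hθ
  have hθ1 : 2 * θ₀ ≤ θ := le_max_right _ _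
  obtain ⟨h, hh, hH⟩ : ∃ h : ℝ, 0 < h ∧ (H.PosDef → ∀ u, h * (u ⬝ᵥ u) ≤ u ⬝ᵥ H *ᵥ u) := by
    by_cases hH : H.PosDef
    · obtain ⟨h, hh, hu⟩ := PSFactor.exists_le_quadForm_of_posDef hH
      exact ⟨h, hh, fun _ => hu⟩
    · exact ⟨1, one_pos, fun h => absurd h hH⟩
  set lb : ℝ := 1 + |lbar| with hlb
  have hlb0 : 0 < lb := by positivity
  -- The entry bound of `abs_eigenvector_le` times `√n`, with the `h / 2` left by
  -- `eventually_le_gram`: above it the cap does not act.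
  refine ⟨r * lb * (8 * r * lb / (h / 2)) + 1, by positivity, ?_⟩
  intro Ω _ M _ _ hF hΛ hW hI hα _ hD w hw
  obtain ⟨hHpos, -, hHlim, hΛb⟩ := hΛ
  obtain ⟨C, hC0, hC⟩ := M.exists_eventually_controlled hβf hβ hF hW hΛb hα hD
  obtain ⟨Cε, hCε1, hCε⟩ := M.exists_integral_linearCombination_sq_le hW
  set L : ℕ → ℝ := fun T => C * Real.log T ^ θ₀ with hL
  have hLθ : ∀ T : ℕ, 1 ≤ Real.log T → 0 ≤ L T ∧ L T ≤ C * Real.log T ^ θ ∧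
      L T * L T ≤ C * C * Real.log T ^ θ := fun T hT => by
    have hT0 : 0 < Real.log T := by linarith
    refine ⟨by positivity, ?_, ?_⟩
    · exact mul_le_mul_of_nonneg_left (Real.rpow_le_rpow_of_exponent_le hT (by linarith)) hC0.le
    · have : L T * L T = C * C * Real.log T ^ (2 * θ₀) := by
        rw [two_mul, Real.rpow_add hT0]; ring
      rw [this]
      exact mul_le_mul_of_nonneg_left (Real.rpow_le_rpow_of_exponent_le hT hθ1) (by positivity)
  constructor
  · intro cw hcw δ hδ
    have herr : 0 ≤ PSFactor.errConst r lb Cε (h / 2) := by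
      unfold PSFactor.errConst PSFactor.projConst
      positivity
    refine ⟨PSFactor.errConst r lb Cε (h / 2) * (C * C + C) + 1, by positivity, ?_⟩
    have hτ := PSFactor.tendsto_log_rpow_div_sqrt C θ₀
    have hn0 : Tendsto (fun T => 1 / √(M.n T : ℝ)) atTop (𝓝 0) := by
      have := Real.tendsto_sqrt_atTop.comp (tendsto_natCast_atTop_atTop.comp hD.1)
      simp only [one_div]
      exact this.inv_tendsto_atTop
    have hη : Tendsto (fun T => 4 * (2 * r * lb + 1 + Cε) / (h / 2) * (L T / √T + 1 / √(M.n T)))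
        atTop (𝓝 0) := by
      simpa using (hτ.add hn0).const_mul (4 * (2 * r * lb + 1 + Cε) / (h / 2))
    have hτ2 : Tendsto (fun T => r * (L T / √T)) atTop (𝓝 0) := by
      simpa using hτ.const_mul (r : ℝ)
    have hτ3 : Tendsto (fun T => (2 * r * lb + 1) * (L T / √T)) atTop (𝓝 0) := by
      simpa using hτ.const_mul (2 * r * lb + 1)
    filter_upwards [hC δ hδ, M.eventually_le_gram hh (hH hHpos) hHlim hD.1,
      hτ.eventually_le_const one_pos, hτ2.eventually_le_const (show (0 : ℝ) < 1 / 2 by norm_num),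
      hτ3.eventually_le_const (show 0 < h / 2 / 4 by positivity), hη.eventually_le_const one_pos,
      eventually_ge_atTop 1, hD.1.eventually_ge_atTop 3, PSFactor.eventually_one_le_log]
      with T h1 h2 h3 h4 h5 h6 h7 h8 h9
    -- Monotonicity holds for arbitrary sets, so no measurability is asked of the choice of
    -- eigenvectors.
    refine (measure_mono fun ω hω => ?_).trans h1
    by_contra hcon
    have hctrl : M.Controlled T (L T) ω := not_not.1 hcon
    obtain ⟨hL0, hL1, hL2⟩ := hLθ T h9
    obtain ⟨F, G, S, Δ, μ, d⟩ := hctrl.factorDecomp h7 (by omega) hF hI hW hΛb hCε1 hCε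
      (by positivity) h2 hL0 h3 h4 h5 (hw T ω)
    have hle := hctrl.maxErr_le d h6 hcw hL0
    have hω' : _ < |M.maxErr w cw r T ω| := hω
    rw [abs_of_nonneg (M.maxErr_nonneg w cw r T ω)] at hω'
    refine absurd hω' (not_lt.2 (hle.trans ?_))
    set A := max (√(Real.log (M.n T) / T)) (1 / √(M.n T)) with hA
    have hT0 : (0 : ℝ) < T := by exact_mod_cast h7
    -- Uses `log n ≥ 1`, which is why `n ≥ 3 > e` was required.
    have hA1 : 1 / √(T : ℝ) ≤ A := by
      refine le_trans ?_ (le_max_left _ _)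
      rw [Real.sqrt_div' _ hT0.le]
      refine div_le_div_of_nonneg_right ?_ (Real.sqrt_nonneg _)
      refine Real.one_le_sqrt.2 ?_
      rw [Real.le_log_iff_exp_le (by exact_mod_cast (by omega : 0 < M.n T))]
      have : (3 : ℝ) ≤ M.n T := by exact_mod_cast h8
      linarith [Real.exp_one_lt_d9]
    have hA2 : 1 / √(M.n T : ℝ) ≤ A := le_max_right _ _
    have hA0 : 0 ≤ A := le_trans (by positivity) hA2
    have hℓ : 0 ≤ Real.log T ^ θ := by
      have : 0 < Real.log T := by linarith
      positivity
    have e1 : L T / √T * L T ≤ C * C * (A * Real.log T ^ θ) := by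
      calc L T / √T * L T = 1 / √T * (L T * L T) := by ring
        _ ≤ A * (C * C * Real.log T ^ θ) := mul_le_mul hA1 hL2 (by positivity) hA0
        _ = _ := by ring
    have e2 : 1 / √(M.n T : ℝ) * L T ≤ C * (A * Real.log T ^ θ) := by
      calc 1 / √(M.n T : ℝ) * L T ≤ A * (C * Real.log T ^ θ) := mul_le_mul hA2 hL1 hL0 hA0
        _ = _ := by ring
    calc PSFactor.errConst r lb Cε (h / 2) * (L T / √T + 1 / √(M.n T)) * L T
        = PSFactor.errConst r lb Cε (h / 2) * (L T / √T * L T + 1 / √(M.n T) * L T) := by ring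
      _ ≤ PSFactor.errConst r lb Cε (h / 2) *
          (C * C * (A * Real.log T ^ θ) + C * (A * Real.log T ^ θ)) :=
        mul_le_mul_of_nonneg_left (add_le_add e1 e2) herr
      _ ≤ _ := by
        have : 0 ≤ A * Real.log T ^ θ := mul_nonneg hA0 hℓ
        linarith
  · intro cw hcw k _ δ hδ
    refine ⟨(k * cw ^ 2 * (r * lb + 1) + r * lb) * C + 1, by positivity, ?_⟩
    filter_upwards [hC δ hδ, PSFactor.eventually_one_le_log] with T h1 h9
    refine (measure_mono fun ω hω => ?_).trans h1
    by_contra hcon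
    have hctrl : M.Controlled T (L T) ω := not_not.1 hcon
    obtain ⟨hL0, hL1, -⟩ := hLθ T h9
    have hle := hctrl.maxErr_le_of_cap w k hcw.le hlb0.le
      (fun i a => (hΛb T i a).le.trans (by linarith [le_abs_self lbar])) hL0
    have hω' : _ < |M.maxErr w cw k T ω| := hω
    rw [abs_of_nonneg (M.maxErr_nonneg w cw k T ω)] at hω'
    refine absurd hω' (not_lt.2 (hle.trans ?_))
    have hℓ : 0 ≤ Real.log T ^ θ := by
      have : 0 < Real.log T := by linarith
      positivity
    calc _ ≤ (k * cw ^ 2 * (r * lb + 1) + r * lb) * (C * Real.log T ^ θ) :=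
          mul_le_mul_of_nonneg_left hL1 (by positivity)
      _ ≤ _ := by linarith
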